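/- Let $\Gamma_0(\sqrt{-2})$ be the subgroup of $\mathrm{SL}_2(\mathbb{Z}[\sqrt{-2}])$ consisting of the matrices $\begin{pmatrix} a & b\\ c & d\end{pmatrix}$ whose entry $c$ lies in the ideal $\langle\sqrt{-2}\rangle$ of $\mathbb{Z}[\sqrt{-2}]$. Then the group cohomology of $\Gamma_0(\sqrt{-2})$ with trivial coefficients $\mathbb{F}_2$ is finite-dimensional in every degree, with $$\dim_{\mathbb{F}_2} H^p(\Gamma_0(\sqrt{-2});\mathbb{F}_2)=\begin{cases}1, & p=0,\\ 4, & p=1,\\ 6, & p\ge 2 \text{ and } p\equiv 2 \text{ or } 3 \pmod 4,\\ 5, & p\ge 2\text{ and } p\equiv 0 \text{ or } 1 \pmod 4.\end{cases}$$ -/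

import Mathlib

/-- For a commutative ring `R` and `r : R`, the subgroup of `SL₂(R)` of matrices
`(a, b; c, d)` whose lower left entry `c` lies in the ideal `⟨r⟩`. -/
def congruenceGamma0 {R : Type} [CommRing R] (r : R) :
    Subgroup (Matrix.SpecialLinearGroup (Fin 2) R) where
  carrier := {g | g.1 1 0 ∈ Ideal.span {r}}
  one_mem' := by simp
  mul_mem' {a b} ha hb := by
    have h : (a * b).1 1 0 = a.1 1 0 * b.1 0 0 + a.1 1 1 * b.1 1 0 := by
      simp [Matrix.mul_apply, Fin.sum_univ_two]
    change (a * b).1 1 0 ∈ Ideal.span {r}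
    rw [h]
    exact Ideal.add_mem _ (Ideal.mul_mem_right _ _ ha) (Ideal.mul_mem_left _ _ hb)
  inv_mem' {a} ha := by
    change a⁻¹.1 1 0 ∈ Ideal.span {r}
    have h : a⁻¹.1 1 0 = - a.1 1 0 := by
      simp [Matrix.SpecialLinearGroup.SL2_inv_expl a]
    rw [h]
    exact neg_mem ha

/-- `Γ₀(√-2)` inside `SL₂(ℤ[√-2])`; here `Zsqrtd.sqrtd = √-2` in `ℤ√(-2) = ℤ[√-2]`. -/
abbrev Gamma0SqrtNegTwo : Subgroup (Matrix.SpecialLinearGroup (Fin 2) (ℤ√(-2))) :=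
  congruenceGamma0 (Zsqrtd.sqrtd : ℤ√(-2))

/-- `H^p(Γ₀(√-2); 𝔽₂)`, group cohomology with trivial coefficients `𝔽₂`. -/
noncomputable abbrev cohomologyGamma0SqrtNegTwo (p : ℕ) : ModuleCat (ZMod 2) :=
  groupCohomology (Rep.trivial (ZMod 2) Gamma0SqrtNegTwo (ZMod 2)) p

/-! Write Γ for the congruence subgroup and T, U, W, I, R for `matT`, `matU`, `matW`, `matI`,
`matR`. Behind the proof is a two-dimensional complex in hyperbolic 3-space on which Γ acts with two
orbits of vertices, with stabilizers the quaternion groups ⟨I, W⟩ and ⟨I, R⟩, three orbits of edges,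
with stabilizers ⟨I⟩, ⟨W⟩ and ⟨R⟩ of order 4, and one orbit of faces, with stabilizer {±1}. The
first edge joins the two kinds of vertices; the second joins the first vertex to its translate by T;
the third joins the second vertex to its translate by V = UWR.

The complex itself is never constructed. Periodic resolutions of the stabilizers are induced to
𝔽₂[Γ] and glued, by chain maps and homotopies between them, into the total complex of three columns
(`totalMatrix`). It is a resolution if the columns are exact in positive degrees, which explicit
contractions show (`exact_of_contraction`), and if the cellular chain complex is exact.

Cellular exactness at the vertices says that T, U, W, I, R generate Γ, which is a Euclidean
algorithm (`mem_of_mem_gamma0`). At the edges and faces it comes from pairing chains with indicator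
functions of sides of planes. Translates of the real plane are crossed only by third edges, and the
real matrices are generated by T and R; so modulo face boundaries a cycle has no third component
(`exists_of_mem_ideals_third`). Translates of the imaginary plane show that each remaining edge
separates the graph of first and second edges, so nothing else survives
(`exists_of_mem_ideals_first`, `exists_of_mem_ideals_second`). A half-plane inside the real plane
isolates a single face (`mul_zz_eq_zero`). Each crossing statement is an inequality for integral
hermitian forms, sharpened by a congruence.

After reduction along the augmentation to 𝔽₂, only the map from edges to vertices is nonzero. Its
ranks repeat as 1, 2, 0, 0, and counting basis elements gives the dimensions. -/

noncomputable section

open CategoryTheory MonoidAlgebra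

/-! ### Free resolutions given by matrices over the group ring. -/

namespace MatrixResolution

variable {k G : Type} [CommRing k] [Group G]

/-- The augmentation `k[G] → k`. -/
def aug (k G : Type) [CommRing k] [Group G] : k[G] →ₐ[k] k := MonoidAlgebra.lift k k G 1

@[simp] lemma aug_single (g : G) (r : k) : aug k G (single g r) = r := by
  simp [aug, MonoidAlgebra.lift_single]

/-- The representation of `G` on row vectors over `k[G]` by left multiplication. -/
def rowRep (k G : Type) [CommRing k] [Group G] (I : Type) : Representation k G (I → k[G]) where
  toFun g :=
    { toFun := fun x i => single g 1 * x i
      map_add' := fun x y => by ext1 i; simp [mul_add]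
      map_smul' := fun r x => by ext1 i; simp }
  map_one' := by ext1 x; funext i; simp [← MonoidAlgebra.one_def]
  map_mul' g h := by
    ext1 x; funext i; simp [← mul_assoc, MonoidAlgebra.single_mul_single]

/-- The row vectors over `k[G]` as an object of `Rep k G`. -/
abbrev RowRep (k G : Type) [CommRing k] [Group G] (I : Type) : Rep k G := Rep.of (rowRep k G I)

lemma rowRep_apply {I : Type} (g : G) (x : I → k[G]) (i : I) :
    rowRep k G I g x i = single g 1 * x i := rfl

/-- The row vectors are isomorphic to the free representation. -/
def rowRepIso (I : Type) [Finite I] : Rep.free k G I ≅ RowRep k G I :=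
  Rep.mkIso <| .mk (Finsupp.linearEquivFunOnFinite k (k[G]) I) fun g => by
    refine Finsupp.lhom_ext fun i y => ?_
    classical
    funext j
    by_cases hij : i = j
    · subst hij
      simp [rowRep_apply]
      induction y using MonoidAlgebra.induction_linear with
      | zero => simp
      | add x y hx hy => rw [map_add, hx, hy, mul_add]
      | single h r => simp [MonoidAlgebra.single_mul_single]
    · simp [rowRep_apply, hij]

instance (I : Type) [Finite I] : Projective (RowRep k G I) :=
  Projective.of_iso (rowRepIso I) inferInstance

/-- The morphism given by right multiplication by a matrix. -/
def rowHom {I J : Type} [Fintype I] (M : Matrix I J (k[G])) :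
    RowRep k G I ⟶ RowRep k G J :=
  Rep.ofHom 
    { toFun := fun x => Matrix.vecMul x M
      map_add' := fun x y => Matrix.add_vecMul ..
      map_smul' := fun r x => by
        exact Matrix.smul_vecMul ..
      isIntertwining' := fun g => by
        ext1 x
        funext j
        simp [rowRep_apply, Matrix.vecMul, dotProduct, Finset.mul_sum, mul_assoc] }

/-- The augmentation of the row vectors. -/
def augHom (k G : Type) [CommRing k] [Group G] (I : Type) [Fintype I] :
    RowRep k G I ⟶ Rep.trivial k G k :=
  Rep.ofHom
    { toFun := fun x => ∑ i, aug k G (x i)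
      map_add' := fun x y => by simp [Finset.sum_add_distrib]
      map_smul' := fun r x => by simp [Finset.mul_sum]
      isIntertwining' := fun g => by
        ext1 x
        simp [rowRep_apply] }

/-- Morphisms from the row vectors to the trivial representation. -/
def homTrivialEquiv (k G : Type) [CommRing k] [Group G] (I : Type) [Fintype I] [DecidableEq I] :
    (RowRep k G I ⟶ Rep.trivial k G k) ≃ₗ[k] (I → k) where
  toFun f i := f.hom (Pi.single i 1 : I → k[G])
  map_add' _ _ := rfl
  map_smul' _ _ := rfl
  invFun v := Rep.ofHom
    { toFun := fun x => ∑ i, aug k G (x i) * v i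
      map_add' := fun x y => by simp [Finset.sum_add_distrib, add_mul]
      map_smul' := fun r x => by simp [Finset.mul_sum, mul_assoc]
      isIntertwining' := fun g => by
        refine LinearMap.ext fun x => ?_
        simp [rowRep_apply] }
  left_inv f := by
    refine Rep.hom_ext (Representation.IntertwiningMap.ext (LinearMap.ext fun x => ?_))
    change ∑ i, aug k G (x i) * f.hom (Pi.single i 1 : I → k[G]) = f.hom x
    have key : ∀ (i : I) (y : k[G]), f.hom (Pi.single i y : I → k[G]) =
        aug k G y * f.hom (Pi.single i 1 : I → k[G]) := by
      intro i y
      induction y using MonoidAlgebra.induction_linear with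
      | zero => simp
      | add x y hx hy => rw [Pi.single_add, map_add, hx, hy, map_add, add_mul]
      | single g r =>
        have h1 := Rep.hom_comm_apply f g (r • Pi.single i 1 : I → k[G])
        have h2 : (RowRep k G I).ρ g (r • Pi.single i 1 : I → k[G]) =
            (Pi.single i (single g r) : I → k[G]) := by
          funext j
          change single g 1 * (r • Pi.single i 1 : I → k[G]) j = _
          by_cases hij : j = i
          · subst hij
            simp
          · simp [hij]
        rw [h2] at h1
        rw [h1, map_smul, aug_single]
        rfl
    conv_rhs => rw [← Finset.univ_sum_single x, map_sum]
    exact Finset.sum_congr rfl fun i _ => (key i (x i)).symm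
  right_inv v := by
    funext i
    change ∑ j, aug k G ((Pi.single i 1 : I → k[G]) j) * v j = v i
    rw [Finset.sum_eq_single i] <;> simp +contextual

/-- A sequence of matrices over `k[G]` forming a free resolution of the trivial module. -/
structure IsResolution (k G : Type) [CommRing k] [Group G] (I : ℕ → Type) [∀ n, Fintype (I n)]
    (D : ∀ n, Matrix (I (n + 1)) (I n) (k[G])) : Prop where
  nonempty : Nonempty (I 0)
  mul_eq_zero : ∀ n, D (n + 1) * D n = 0
  aug_eq_zero : ∀ i, ∑ j, aug k G (D 0 i j) = 0
  exact_zero : ∀ x : I 0 → k[G], ∑ i, aug k G (x i) = 0 → ∃ y, Matrix.vecMul y (D 0) = x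
  exact_succ : ∀ n, ∀ x : I (n + 1) → k[G], Matrix.vecMul x (D n) = 0 →
    ∃ y, Matrix.vecMul y (D (n + 1)) = x

section

variable {I : ℕ → Type} [∀ n, Fintype (I n)] {D : ∀ n, Matrix (I (n + 1)) (I n) (k[G])}

/-- The chain complex of a sequence of matrices. -/
def complex (hD : ∀ n, D (n + 1) * D n = 0) : ChainComplex (Rep k G) ℕ :=
  ChainComplex.of (fun n => RowRep k G (I n)) (fun n => rowHom (D n)) fun n => by
    refine Rep.hom_ext (Representation.IntertwiningMap.ext (LinearMap.ext fun x => ?_))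
    change Matrix.vecMul (Matrix.vecMul x (D (n + 1))) (D n) = 0
    rw [Matrix.vecMul_vecMul, hD, Matrix.vecMul_zero]

lemma complex_d (hD : ∀ n, D (n + 1) * D n = 0) (n : ℕ) :
    (complex hD).d (n + 1) n = rowHom (D n) := by
  simp [complex]

/-- The augmentation of the chain complex. -/
def complexπ (h : IsResolution k G I D) :
    complex h.mul_eq_zero ⟶ (ChainComplex.single₀ (Rep k G)).obj (Rep.trivial k G k) :=
  ((complex h.mul_eq_zero).toSingle₀Equiv _).symm ⟨augHom k G (I 0), by
    rw [complex_d]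
    refine Rep.hom_ext (Representation.IntertwiningMap.ext (LinearMap.ext fun x => ?_))
    change ∑ i, aug k G (Matrix.vecMul x (D 0) i) = 0
    simp only [Matrix.vecMul, dotProduct, map_sum, map_mul]
    rw [Finset.sum_comm]
    simp [← Finset.mul_sum, h.aug_eq_zero]⟩

lemma quasiIso_complexπ (h : IsResolution k G I D) : QuasiIso (complexπ h) where
  quasiIsoAt m := by
    induction m with
    | zero =>
      rw [ChainComplex.quasiIsoAt₀_iff, ShortComplex.quasiIso_iff_of_zeros' _ rfl rfl rfl]
      constructor
      -- Exactness may be tested on underlying modules, where it is a statement about elements.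
      · apply (forget₂ _ (ModuleCat k)).reflects_exact_of_faithful
        rw [ShortComplex.moduleCat_exact_iff]
        intro (x : I 0 → k[G]) hx
        obtain ⟨y, hy⟩ := h.exact_zero x hx
        exact ⟨y, (congrArg (fun f => f.hom y) (complex_d h.mul_eq_zero 0)).trans hy⟩
      · rw [Rep.epi_iff_surjective]
        intro x
        classical
        refine ⟨(Pi.single h.nonempty.some (single 1 x) : I 0 → k[G]), ?_⟩
        change ∑ j, aug k G ((Pi.single h.nonempty.some (single 1 x) : I 0 → k[G]) j) = x
        rw [Finset.sum_eq_single h.nonempty.some, Pi.single_eq_same]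
        · exact aug_single (k := k) (1 : G) x
        · intro b _ hb
          rw [Pi.single_eq_of_ne hb, map_zero]
        · simp
    | succ m _ =>
      rw [quasiIsoAt_iff_exactAt' (hL := ChainComplex.exactAt_succ_single_obj ..),
          HomologicalComplex.exactAt_iff' _ (m + 2) (m + 1) m (by simp) (by simp)]
      apply (forget₂ _ (ModuleCat k)).reflects_exact_of_faithful
      rw [ShortComplex.moduleCat_exact_iff]
      intro (x : I (m + 1) → k[G]) hx
      obtain ⟨y, hy⟩ := h.exact_succ m x
        ((congrArg (fun f => f.hom x) (complex_d h.mul_eq_zero m)).symm.trans hx)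
      exact ⟨y, (congrArg (fun f => f.hom y) (complex_d h.mul_eq_zero (m + 1))).trans hy⟩

/-- The projective resolution of a sequence of matrices. -/
def resolution (h : IsResolution k G I D) : ProjectiveResolution (Rep.trivial k G k) where
  complex := complex h.mul_eq_zero
  projective n := inferInstanceAs (Projective (RowRep k G (I n)))
  π := complexπ h
  quasiIso := quasiIso_complexπ h

lemma augMatrix_mul (hD : ∀ n, D (n + 1) * D n = 0) (n : ℕ) :
    (D (n + 1)).map (aug k G) * (D n).map (aug k G) = 0 := by
  have := congrArg (fun M => M.map (aug k G)) (hD n)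
  simpa [Matrix.map_mul] using this

/-- The cochain complex of column vectors defined by the augmented matrices. -/
def cochains (hD : ∀ n, D (n + 1) * D n = 0) : CochainComplex (ModuleCat k) ℕ :=
  CochainComplex.of (fun n => ModuleCat.of k (I n → k))
    (fun n => ModuleCat.ofHom (Matrix.mulVecLin ((D n).map (aug k G)))) fun n => by
    ext1
    refine LinearMap.ext fun x => ?_
    change Matrix.mulVec _ (Matrix.mulVec _ x) = 0
    rw [Matrix.mulVec_mulVec, augMatrix_mul hD, Matrix.zero_mulVec]

lemma cochains_d (hD : ∀ n, D (n + 1) * D n = 0) (n : ℕ) :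
    (cochains hD).d n (n + 1) =
      ModuleCat.ofHom (Matrix.mulVecLin ((D n).map (aug k G))) := by
  simp [cochains]

/-- The cochain complex of morphisms to the trivial representation. -/
def homComplexIso [∀ n, DecidableEq (I n)] (hD : ∀ n, D (n + 1) * D n = 0) :
    (complex hD).linearYonedaObj k (Rep.trivial k G k) ≅ cochains hD :=
  HomologicalComplex.Hom.isoOfComponents
    (fun n => (homTrivialEquiv k G (I n)).toModuleIso) <| by
    rintro i j ⟨rfl⟩
    rw [cochains_d]
    ext1
    refine LinearMap.ext fun (f : RowRep k G (I i) ⟶ Rep.trivial k G k) => ?_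
    funext l
    have h1 : ((homTrivialEquiv k G (I (i + 1))) ((complex hD).d (i + 1) i ≫ f)) l =
        f.hom (Matrix.vecMul (Pi.single l 1) (D i)) := by
      rw [complex_d]; rfl
    have h2 : ∀ v : I i → k[G], f.hom v = ∑ j, aug k G (v j) * homTrivialEquiv k G (I i) f j := by
      intro v
      conv_lhs => rw [← (homTrivialEquiv k G (I i)).symm_apply_apply f]
      rfl
    refine Eq.symm (h1.trans ?_)
    rw [h2, Matrix.single_one_vecMul]
    rfl

end

/-! ### Dimensions of cohomology from ranks of augmented matrices. -/

section Field

variable {k G : Type} [Field k] [Group G]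
variable {I : ℕ → Type} [∀ n, Fintype (I n)] {D : ∀ n, Matrix (I (n + 1)) (I n) (k[G])}

/-- Homology is kernel modulo image; rank-nullity for the outgoing map combines with the dimension
of the quotient. -/
lemma finrank_homology (S : ShortComplex (ModuleCat.{0} k)) [Module.Finite k S.X₂] :
    Module.Finite k S.homology ∧
    Module.finrank k S.homology + Module.finrank k (LinearMap.range S.g.hom) +
      Module.finrank k (LinearMap.range S.f.hom) = Module.finrank k S.X₂ := by
  let e : S.homology ≃ₗ[k] (LinearMap.ker S.g.hom ⧸ LinearMap.range S.moduleCatToCycles) :=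
    S.moduleCatHomologyIso.toLinearEquiv
  refine ⟨Module.Finite.equiv e.symm, ?_⟩
  have h1 := Submodule.finrank_quotient_add_finrank (LinearMap.range S.moduleCatToCycles)
  have h2 := LinearMap.finrank_range_add_finrank_ker S.g.hom
  have h3 : Module.finrank k (LinearMap.range S.moduleCatToCycles) =
      Module.finrank k (LinearMap.range S.f.hom) := by
    refine (congrArg (fun W : Submodule k _ => Module.finrank k W)
      (LinearMap.range_codRestrict _ S.f.hom S.moduleCat_zero_apply)).trans
      (LinearEquiv.finrank_eq (Submodule.comapSubtypeEquivOfLe ?_))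
    rintro _ ⟨x, rfl⟩
    exact S.moduleCat_zero_apply x
  rw [e.finrank_eq]
  omega

/-- Group cohomology is the cohomology of the complex of augmented matrices. -/
def cohomologyIso [∀ n, DecidableEq (I n)] (h : IsResolution k G I D) (n : ℕ) :
    groupCohomology (Rep.trivial k G k) n ≅ (cochains h.mul_eq_zero).homology n :=
  groupCohomologyIso _ n (resolution h) ≪≫
    HomologicalComplex.homologyMapIso (homComplexIso h.mul_eq_zero) n

lemma cohomology_zero (h : IsResolution k G I D) :
    Module.Finite k (groupCohomology (Rep.trivial k G k) 0) ∧
    Module.finrank k (groupCohomology (Rep.trivial k G k) 0) + ((D 0).map (aug k G)).rank =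
      Fintype.card (I 0) := by
  classical
  let K := cochains h.mul_eq_zero
  let e := (cohomologyIso h 0 ≪≫ K.homologyIsoSc' 0 0 1 (by simp) (by simp)).toLinearEquiv
  have : Module.Finite k (K.sc' 0 0 1).X₂ := inferInstanceAs (Module.Finite k (I 0 → k))
  obtain ⟨h1, h2⟩ := finrank_homology (K.sc' 0 0 1)
  refine ⟨Module.Finite.equiv e.symm, ?_⟩
  rw [e.finrank_eq]
  -- In degree 0 the "previous" degree is 0 itself; the differential from 0 to 0 is zero because it
  -- is not part of the complex shape.
  have hf : (K.sc' 0 0 1).f = 0 := K.shape _ _ (by simp)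
  have hg : (K.sc' 0 0 1).g.hom = Matrix.mulVecLin ((D 0).map (aug k G)) :=
    congrArg ModuleCat.Hom.hom (cochains_d h.mul_eq_zero 0)
  rw [hf, hg] at h2
  have h3 : Module.finrank k (K.sc' 0 0 1).X₂ = Fintype.card (I 0) :=
    Module.finrank_fintype_fun_eq_card k
  have h4 : Module.finrank k (LinearMap.range
      (0 : (K.sc' 0 0 1).X₁ ⟶ (K.sc' 0 0 1).X₂).hom) = 0 := by
    rw [ModuleCat.hom_zero, LinearMap.range_zero, finrank_bot]
  rw [h4, add_zero] at h2
  exact h2.trans h3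

lemma cohomology_succ (h : IsResolution k G I D) (n : ℕ) :
    Module.Finite k (groupCohomology (Rep.trivial k G k) (n + 1)) ∧
    Module.finrank k (groupCohomology (Rep.trivial k G k) (n + 1)) +
      ((D (n + 1)).map (aug k G)).rank + ((D n).map (aug k G)).rank =
      Fintype.card (I (n + 1)) := by
  classical
  let K := cochains h.mul_eq_zero
  let e := (cohomologyIso h (n + 1) ≪≫
    K.homologyIsoSc' n (n + 1) (n + 2) (by simp) (by simp)).toLinearEquiv
  have : Module.Finite k (K.sc' n (n + 1) (n + 2)).X₂ :=
    inferInstanceAs (Module.Finite k (I (n + 1) → k))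
  obtain ⟨h1, h2⟩ := finrank_homology (K.sc' n (n + 1) (n + 2))
  refine ⟨Module.Finite.equiv e.symm, ?_⟩
  rw [e.finrank_eq]
  have hf : (K.sc' n (n + 1) (n + 2)).f.hom = Matrix.mulVecLin ((D n).map (aug k G)) :=
    congrArg ModuleCat.Hom.hom (cochains_d h.mul_eq_zero n)
  have hg : (K.sc' n (n + 1) (n + 2)).g.hom = Matrix.mulVecLin ((D (n + 1)).map (aug k G)) :=
    congrArg ModuleCat.Hom.hom (cochains_d h.mul_eq_zero (n + 1))
  rw [hf, hg] at h2
  have h3 : Module.finrank k (K.sc' n (n + 1) (n + 2)).X₂ = Fintype.card (I (n + 1)) :=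
    Module.finrank_fintype_fun_eq_card k
  exact h2.trans h3

end Field

end MatrixResolution

end

/-! ### Matrices and the hermitian forms of the real and imaginary planes. -/

namespace BianchiTwo

open Matrix

/-- The group `SL₂(ℤ[√-2])`. -/
abbrev SL2 := Matrix.SpecialLinearGroup (Fin 2) (ℤ√(-2))

/-- The matrix `(0, -1; 1, 0)`. -/
def matA : SL2 := ⟨!![0, -1; 1, 0], by simp [Matrix.det_fin_two]⟩
/-- The matrix `(1, 1; 0, 1)`. -/
def matT : SL2 := ⟨!![1, 1; 0, 1], by simp [Matrix.det_fin_two]⟩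
/-- The matrix `(1, √-2; 0, 1)`. -/
def matU : SL2 := ⟨!![1, ⟨0, 1⟩; 0, 1], by simp [Matrix.det_fin_two]⟩
/-- The matrix `(0, -1; 1, 1)`. -/
def matS : SL2 := ⟨!![0, -1; 1, 1], by simp [Matrix.det_fin_two]⟩
/-- The matrix `(1, √-2; √-2, -1)`. -/
def matW : SL2 := ⟨!![1, ⟨0, 1⟩; ⟨0, 1⟩, -1], by
  simp [Matrix.det_fin_two, Zsqrtd.ext_iff]⟩
/-- The conjugate of `matW` by `matS`. -/
def matI : SL2 := ⟨!![⟨-1, -1⟩, ⟨0, -1⟩; 2, ⟨1, 1⟩], by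
  simp [Matrix.det_fin_two, Zsqrtd.ext_iff]⟩
/-- The conjugate of `matA` by `matS`. -/
def matR : SL2 := ⟨!![-1, -1; 2, 1], by simp [Matrix.det_fin_two, Zsqrtd.ext_iff]⟩

lemma det_re (g : SL2) : (g 0 0).re * (g 1 1).re - 2 * (g 0 0).im * (g 1 1).im
    - (g 0 1).re * (g 1 0).re + 2 * (g 0 1).im * (g 1 0).im = 1 := by
  have h := g.2
  rw [Matrix.det_fin_two, Zsqrtd.ext_iff] at h
  have := h.1
  simp only [Zsqrtd.re_sub, Zsqrtd.re_mul, Zsqrtd.re_one] at this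
  linarith

lemma det_im (g : SL2) : (g 0 0).re * (g 1 1).im + (g 0 0).im * (g 1 1).re
    - (g 0 1).re * (g 1 0).im - (g 0 1).im * (g 1 0).re = 0 := by
  have h := g.2
  rw [Matrix.det_fin_two, Zsqrtd.ext_iff] at h
  have := h.2
  simp only [Zsqrtd.im_sub, Zsqrtd.im_mul, Zsqrtd.im_one] at this
  linarith

lemma ext_coord {g h : SL2} (h00 : g 0 0 = h 0 0) (h01 : g 0 1 = h 0 1) (h10 : g 1 0 = h 1 0)
    (h11 : g 1 1 = h 1 1) : g = h := by
  refine Subtype.ext (Matrix.ext fun i j => ?_)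
  fin_cases i <;> fin_cases j <;> assumption

section entries

lemma mul_apply_two (g h : SL2) (i j : Fin 2) : (g * h) i j = g i 0 * h 0 j + g i 1 * h 1 j := by
  simp [Matrix.mul_apply, Fin.sum_univ_two]

@[simp] lemma matA_00 : matA 0 0 = 0 := rfl
@[simp] lemma matA_01 : matA 0 1 = -1 := rfl
@[simp] lemma matA_10 : matA 1 0 = 1 := rfl
@[simp] lemma matA_11 : matA 1 1 = 0 := rfl
@[simp] lemma matT_00 : matT 0 0 = 1 := rfl
@[simp] lemma matT_01 : matT 0 1 = 1 := rfl
@[simp] lemma matT_10 : matT 1 0 = 0 := rfl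
@[simp] lemma matT_11 : matT 1 1 = 1 := rfl
@[simp] lemma matU_00 : matU 0 0 = 1 := rfl
@[simp] lemma matU_01 : matU 0 1 = ⟨0, 1⟩ := rfl
@[simp] lemma matU_10 : matU 1 0 = 0 := rfl
@[simp] lemma matU_11 : matU 1 1 = 1 := rfl
@[simp] lemma matS_00 : matS 0 0 = 0 := rfl
@[simp] lemma matS_01 : matS 0 1 = -1 := rfl
@[simp] lemma matS_10 : matS 1 0 = 1 := rfl
@[simp] lemma matS_11 : matS 1 1 = 1 := rfl
@[simp] lemma matW_00 : matW 0 0 = 1 := rfl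
@[simp] lemma matW_01 : matW 0 1 = ⟨0, 1⟩ := rfl
@[simp] lemma matW_10 : matW 1 0 = ⟨0, 1⟩ := rfl
@[simp] lemma matW_11 : matW 1 1 = -1 := rfl
@[simp] lemma matI_00 : matI 0 0 = ⟨-1, -1⟩ := rfl
@[simp] lemma matI_01 : matI 0 1 = ⟨0, -1⟩ := rfl
@[simp] lemma matI_10 : matI 1 0 = 2 := rfl
@[simp] lemma matI_11 : matI 1 1 = ⟨1, 1⟩ := rfl
@[simp] lemma matR_00 : matR 0 0 = -1 := rfl
@[simp] lemma matR_01 : matR 0 1 = -1 := rfl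
@[simp] lemma matR_10 : matR 1 0 = 2 := rfl
@[simp] lemma matR_11 : matR 1 1 = 1 := rfl

end entries

/-- The coordinates of a hermitian form `(A, B; B̄, C)` with `B = u + v√-2`. -/
structure Herm where
  A : ℤ
  u : ℤ
  v : ℤ
  C : ℤ

/-- The transform by `g` of the indefinite form `(0, √-2; -√-2, 0)`. -/
def planeReal (g : SL2) : Herm where
  A := -4 * ((g 0 0).re * (g 1 0).im - (g 0 0).im * (g 1 0).re)
  u := -2 * ((g 0 0).re * (g 1 1).im - (g 0 0).im * (g 1 1).re
    - (g 1 0).re * (g 0 1).im + (g 1 0).im * (g 0 1).re)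
  v := (g 0 0).re * (g 1 1).re + 2 * (g 0 0).im * (g 1 1).im
    - (g 1 0).re * (g 0 1).re - 2 * (g 1 0).im * (g 0 1).im
  C := -4 * ((g 0 1).re * (g 1 1).im - (g 0 1).im * (g 1 1).re)

/-- The transform by `g` of the indefinite form `(0, 1; 1, 0)`. -/
def planeImag (g : SL2) : Herm where
  A := 2 * ((g 0 0).re * (g 1 0).re + 2 * (g 0 0).im * (g 1 0).im)
  u := (g 0 0).re * (g 1 1).re + 2 * (g 0 0).im * (g 1 1).im
    + (g 1 0).re * (g 0 1).re + 2 * (g 1 0).im * (g 0 1).im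
  v := (g 0 0).re * (g 1 1).im - (g 0 0).im * (g 1 1).re
    + (g 1 0).re * (g 0 1).im - (g 1 0).im * (g 0 1).re
  C := 2 * ((g 0 1).re * (g 1 1).re + 2 * (g 0 1).im * (g 1 1).im)

/-- The pairing of a form with the definite form `(2, 1 + √-2; 1 - √-2, 2)`. -/
def Herm.height (h : Herm) : ℤ := h.u + 2 * h.v - h.A - h.C

/-- On which side of the plane of the real form the point translated by `g` lies. -/
def realHeight (g : SL2) : ℤ := (planeReal g).height
/-- On which side of the plane of the imaginary form the point translated by `g` lies. -/
def imagHeight (g : SL2) : ℤ := (planeImag g).height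

/-- A transform by a matrix of determinant 1 preserves the determinant of a form. With det g = D₀ +
D₁√-2, the coefficients below come from factoring 2(D₀² - 1) + 4D₁². -/
lemma planeReal_disc (g : SL2) : (planeReal g).u ^ 2 + 2 * (planeReal g).v ^ 2
    - (planeReal g).A * (planeReal g).C = 2 := by
  have h1 := det_re g
  have h2 := det_im g
  simp only [planeReal]
  generalize (g 0 0).re = a0 at *; generalize (g 0 0).im = a1 at *
  generalize (g 0 1).re = b0 at *; generalize (g 0 1).im = b1 at *
  generalize (g 1 0).re = c0 at *; generalize (g 1 0).im = c1 at *
  generalize (g 1 1).re = d0 at *; generalize (g 1 1).im = d1 at *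
  linear_combination 2 * (a0 * d0 - 2 * a1 * d1 - b0 * c0 + 2 * b1 * c1 + 1) * h1
    + 4 * (a0 * d1 + a1 * d0 - b0 * c1 - b1 * c0) * h2

/-- The form is √-2·J with J = (0, 1; -1, 0). Conjugation changes entries of g by multiples of 2√-2,
so modulo 4 the transform is √-2·det(g)·J. -/
lemma planeReal_congr (g : SL2) : ∃ A u v C : ℤ, (planeReal g).A = 4 * A ∧
    (planeReal g).u = 4 * u ∧ (planeReal g).v = 1 + 4 * v ∧ (planeReal g).C = 4 * C := by
  have h1 := det_re g
  have h2 := det_im g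
  refine ⟨-((g 0 0).re * (g 1 0).im - (g 0 0).im * (g 1 0).re),
    (g 0 0).im * (g 1 1).re - (g 1 0).im * (g 0 1).re,
    (g 0 0).im * (g 1 1).im - (g 1 0).im * (g 0 1).im,
    -((g 0 1).re * (g 1 1).im - (g 0 1).im * (g 1 1).re),
    by simp only [planeReal]; ring, ?_, ?_, by simp only [planeReal]; ring⟩
  · simp only [planeReal]; linear_combination -2 * h2
  · simp only [planeReal]; linear_combination h1

lemma planeImag_disc (g : SL2) : (planeImag g).u ^ 2 + 2 * (planeImag g).v ^ 2
    - (planeImag g).A * (planeImag g).C = 1 := by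
  have h1 := det_re g
  have h2 := det_im g
  simp only [planeImag]
  generalize (g 0 0).re = a0 at *; generalize (g 0 0).im = a1 at *
  generalize (g 0 1).re = b0 at *; generalize (g 0 1).im = b1 at *
  generalize (g 1 0).re = c0 at *; generalize (g 1 0).im = c1 at *
  generalize (g 1 1).re = d0 at *; generalize (g 1 1).im = d1 at *
  linear_combination (a0 * d0 - 2 * a1 * d1 - b0 * c0 + 2 * b1 * c1 + 1) * h1
    + 2 * (a0 * d1 + a1 * d0 - b0 * c1 - b1 * c0) * h2

/-- Modulo 2 conjugation is trivial and the form agrees with J, so its transform is det(g)·J. -/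
lemma planeImag_congr (g : SL2) : ∃ A u v C : ℤ, (planeImag g).A = 2 * A ∧
    (planeImag g).u = 1 + 2 * u ∧ (planeImag g).v = 2 * v ∧ (planeImag g).C = 2 * C := by
  have h1 := det_re g
  have h2 := det_im g
  refine ⟨_, (g 0 1).re * (g 1 0).re + 2 * (g 0 0).im * (g 1 1).im,
    (g 1 0).re * (g 0 1).im - (g 0 0).im * (g 1 1).re, _, rfl, ?_, ?_, rfl⟩
  · simp only [planeImag]; linear_combination h1
  · simp only [planeImag]; linear_combination h2

/-! ### Which generators can cross a translate of a plane. -/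

section heights

/-- W and S fix the definite form, that is, the base point, so neither height sees them. -/
lemma realHeight_mul_W (g : SL2) : realHeight (g * matW) = realHeight g := by
  simp [realHeight, Herm.height, planeReal, mul_apply_two]; ring

lemma realHeight_mul_S (g : SL2) : realHeight (g * matS) = realHeight g := by
  simp [realHeight, Herm.height, planeReal, mul_apply_two]; ring

lemma realHeight_mul_A (g : SL2) : realHeight (g * matA) =
    -(planeReal g).u + 2 * (planeReal g).v - (planeReal g).A - (planeReal g).C := by
  simp [realHeight, Herm.height, planeReal, mul_apply_two]; ring

lemma realHeight_mul_U (g : SL2) : realHeight (g * matU) =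
    (planeReal g).u - 2 * (planeReal g).v - (planeReal g).A - (planeReal g).C := by
  simp [realHeight, Herm.height, planeReal, mul_apply_two]; ring

lemma imagHeight_mul_W (g : SL2) : imagHeight (g * matW) = imagHeight g := by
  simp [imagHeight, Herm.height, planeImag, mul_apply_two]; ring

lemma imagHeight_mul_S (g : SL2) : imagHeight (g * matS) = imagHeight g := by
  simp [imagHeight, Herm.height, planeImag, mul_apply_two]; ring

lemma imagHeight_mul_A (g : SL2) : imagHeight (g * matA) =
    -(planeImag g).u + 2 * (planeImag g).v - (planeImag g).A - (planeImag g).C := by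
  simp [imagHeight, Herm.height, planeImag, mul_apply_two]; ring

/-- The two heights are m + u and m - u with m = 2v - A - C, so they have the same sign once u² <
m². The discriminant only gives u² - m² ≤ 2; the congruence u² - m² ≡ -4 mod 16 closes the gap. -/
lemma realHeight_mul_A_pos (g : SL2) : 0 < realHeight (g * matA) ↔ 0 < realHeight g := by
  rw [realHeight_mul_A, realHeight, Herm.height]
  have h := planeReal_disc g
  obtain ⟨A, u, v, C, hA, hu, hv, hC⟩ := planeReal_congr g
  rw [hA, hu, hv, hC] at h ⊢
  have key : (4 * u) ^ 2 - (2 * (1 + 4 * v) - 4 * A - 4 * C) ^ 2 ≤ 2 := by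
    nlinarith [sq_nonneg (3 * (1 + 4 * v) - (4 * A + 4 * C)), sq_nonneg (A - C), sq_nonneg (A + C)]
  have hne : (4 * u) ^ 2 - (2 * (1 + 4 * v) - 4 * A - 4 * C) ^ 2 < 0 := by
    have : (4 * u) ^ 2 - (2 * (1 + 4 * v) - 4 * A - 4 * C) ^ 2 =
      16 * (u ^ 2 - (2 * v - A - C) ^ 2 - (2 * v - A - C)) - 4 := by ring
    rw [this] at key ⊢
    omega
  constructor
  · intro h1; by_contra h2; nlinarith
  · intro h1; by_contra h2; nlinarith

/-- The two heights are m ± 2v with m = u - A - C. If m² ≤ 4v², twice the discriminant identity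
yields u² + (u - A)² + (u - C)² ≤ 4, and divisibility by 4 leaves only the original form. -/
lemma realHeight_mul_U_pos (g : SL2) : (0 < realHeight (g * matU) ↔ 0 < realHeight g) ∨
    (planeReal g).A = 0 ∧ (planeReal g).u = 0 ∧ (planeReal g).v = 1 ∧ (planeReal g).C = 0 := by
  rw [realHeight_mul_U, realHeight, Herm.height]
  have h := planeReal_disc g
  obtain ⟨A, u, v, C, hA, hu, hv, hC⟩ := planeReal_congr g
  rw [hA, hu, hv, hC] at h ⊢
  by_cases hle : (4 * u - 4 * A - 4 * C) ^ 2 ≤ (2 * (1 + 4 * v)) ^ 2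
  · right
    have key : (4 * u) ^ 2 + (4 * u - 4 * A) ^ 2 + (4 * u - 4 * C) ^ 2 ≤ 4 := by nlinarith
    have hu0 : u = 0 := by nlinarith [sq_nonneg (4 * u - 4 * A), sq_nonneg (4 * u - 4 * C)]
    subst hu0
    have hA0 : A = 0 := by nlinarith [sq_nonneg (4 * C)]
    have hC0 : C = 0 := by nlinarith [sq_nonneg (4 * A)]
    subst hA0 hC0
    have : v = 0 := by
      have : v * (1 + 2 * v) = 0 := by nlinarith
      rcases mul_eq_zero.1 this with h | h
      · exact h
      · omega
    subst this
    simp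
  · left
    constructor
    · intro h1; by_contra h2; nlinarith
    · intro h1; by_contra h2; nlinarith

/-- The two heights are m ± u with m = 2v - A - C. Here u is odd and m even, so m² ≤ u² improves to
m² + 1 ≤ u². The discriminant identity then makes a definite form in A, v, C nonpositive, so all
three vanish. -/
lemma imagHeight_mul_A_pos (g : SL2) : (0 < imagHeight (g * matA) ↔ 0 < imagHeight g) ∨
    (planeImag g).A = 0 ∧ (planeImag g).v = 0 ∧ (planeImag g).C = 0 := by
  rw [imagHeight_mul_A, imagHeight, Herm.height]
  have h := planeImag_disc g
  obtain ⟨A, u, v, C, hA, hu, hv, hC⟩ := planeImag_congr g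
  rw [hA, hu, hv, hC] at h ⊢
  by_cases hle : (2 * (2 * v) - 2 * A - 2 * C) ^ 2 ≤ (1 + 2 * u) ^ 2
  · right
    have h1 : 0 < (1 + 2 * u) ^ 2 - (2 * (2 * v) - 2 * A - 2 * C) ^ 2 := by
      have : (1 + 2 * u) ^ 2 - (2 * (2 * v) - 2 * A - 2 * C) ^ 2 =
        4 * (u ^ 2 + u - (2 * v - A - C) ^ 2) + 1 := by ring
      omega
    have key : 6 * (2 * v) ^ 2 - 4 * (2 * v) * (2 * A + 2 * C) + (2 * A + 2 * C) ^ 2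
      - 4 * A * C ≤ 0 := by nlinarith
    have key' : A ^ 2 - A * C + C ^ 2 ≤ 0 := by
      nlinarith [sq_nonneg (6 * (2 * v) - 2 * (2 * A + 2 * C))]
    have hA0 : A = 0 := by
      have : A ^ 2 ≤ 0 := by nlinarith [sq_nonneg (2 * C - A)]
      exact pow_eq_zero_iff two_ne_zero |>.1 (le_antisymm this (sq_nonneg _))
    have hC0 : C = 0 := by
      have : C ^ 2 ≤ 0 := by nlinarith [sq_nonneg (2 * A - C)]
      exact pow_eq_zero_iff two_ne_zero |>.1 (le_antisymm this (sq_nonneg _))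
    subst hA0 hC0
    have hv0 : v = 0 := by
      have : v ^ 2 ≤ 0 := by nlinarith
      exact pow_eq_zero_iff two_ne_zero |>.1 (le_antisymm this (sq_nonneg _))
    subst hv0
    simp
  · left
    constructor
    · intro h1; by_contra h2; nlinarith
    · intro h1; by_contra h2; nlinarith

end heights

end BianchiTwo

namespace BianchiTwo

open Matrix

/-! ### Relations between the matrices, and the region cut out by the real planes. -/

section relations

lemma matA_mul_matT : matA * matT = matS := by
  apply ext_coord <;> simp [mul_apply_two]
lemma matS_mul_matA : matR * matS = matS * matA := by
  apply ext_coord <;> simp [mul_apply_two, Zsqrtd.ext_iff]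
lemma matS_mul_matW : matI * matS = matS * matW := by
  apply ext_coord <;> simp [mul_apply_two, Zsqrtd.ext_iff]
lemma matW_mul_matT : matW * matT = matT * (matI * matW) := by
  apply ext_coord <;> simp [mul_apply_two, Zsqrtd.ext_iff]
lemma matT_mul_matU : matT * matU = matU * matT := by
  apply ext_coord <;> simp [mul_apply_two, Zsqrtd.ext_iff]
lemma matR_mul_conj : matR * (matU * matW * matR) = (matU * matW * matR) * (matI * matR) := by
  apply ext_coord <;> simp [mul_apply_two, Zsqrtd.ext_iff]
lemma matA_sq : matA * matA = -1 := by
  apply ext_coord <;> simp [mul_apply_two]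
lemma matW_sq : matW * matW = -1 := by
  apply ext_coord <;> simp [mul_apply_two, Zsqrtd.ext_iff]

end relations

/-- The stabilizer of the connected component of the base point in the complement of the
translates of the real plane. -/
def regionGroup : Subgroup SL2 where
  carrier := {g | ∀ m, 0 < realHeight (m * g) ↔ 0 < realHeight m}
  one_mem' m := by simp
  mul_mem' {g h} hg hh m := by rw [← mul_assoc, hh, hg]
  inv_mem' {g} hg m := by rw [← hg (m * g⁻¹), inv_mul_cancel_right]

lemma matW_mem : matW ∈ regionGroup := fun m => by rw [realHeight_mul_W]
lemma matS_mem : matS ∈ regionGroup := fun m => by rw [realHeight_mul_S]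
lemma matA_mem : matA ∈ regionGroup := realHeight_mul_A_pos
lemma matT_mem : matT ∈ regionGroup := by
  rw [show matT = matA⁻¹ * matS by rw [← matA_mul_matT, inv_mul_cancel_left]]
  exact mul_mem (inv_mem matA_mem) matS_mem
lemma matR_mem : matR ∈ regionGroup := by
  rw [show matR = matS * matA * matS⁻¹ by rw [← matS_mul_matA, mul_inv_cancel_right]]
  exact mul_mem (mul_mem matS_mem matA_mem) (inv_mem matS_mem)
lemma matI_mem : matI ∈ regionGroup := by
  rw [show matI = matS * matW * matS⁻¹ by rw [← matS_mul_matW, mul_inv_cancel_right]]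
  exact mul_mem (mul_mem matS_mem matW_mem) (inv_mem matS_mem)

/-- Matrices with rational integral entries. -/
def IsReal (g : SL2) : Prop :=
  (g 0 0).im = 0 ∧ (g 0 1).im = 0 ∧ (g 1 0).im = 0 ∧ (g 1 1).im = 0

/-- A real g preserves √-2·J, so the heights are 2 and -2. -/
lemma realHeight_mul_U_of_isReal {g : SL2} (h : IsReal g) :
    0 < realHeight g ∧ ¬ 0 < realHeight (g * matU) := by
  obtain ⟨ha, hb, hc, hd⟩ := h
  have h1 := det_re g
  rw [realHeight_mul_U, realHeight, Herm.height]
  simp only [planeReal, ha, hb, hc, hd] at h1 ⊢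
  constructor <;> nlinarith

/-- In the exceptional case g*Jg = J, with g* the conjugate transpose. Comparison with gᵀJg = J,
which is det g = 1, shows that g equals its conjugate. -/
lemma realHeight_mul_U_iff_of_not_isReal {g : SL2} (h : ¬ IsReal g) :
    0 < realHeight (g * matU) ↔ 0 < realHeight g := by
  rcases realHeight_mul_U_pos g with h' | ⟨hA, hu, hv, hC⟩
  · exact h'
  · refine absurd ?_ h
    have h1 := det_re g
    have h2 := det_im g
    simp only [planeReal] at hA hu hv hC
    simp only [IsReal]
    generalize (g 0 0).re = a0 at *; generalize (g 0 0).im = a1 at *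
    generalize (g 0 1).re = b0 at *; generalize (g 0 1).im = b1 at *
    generalize (g 1 0).re = c0 at *; generalize (g 1 0).im = c1 at *
    generalize (g 1 1).re = d0 at *; generalize (g 1 1).im = d1 at *
    have e1 : a1 * d1 = b1 * c1 := by linarith
    have e2 : a0 * c1 = a1 * c0 := by linarith
    have e3 : b0 * d1 = b1 * d0 := by linarith
    have e4 : b0 * c1 = a1 * d0 := by linarith
    have e5 : a0 * d1 = b1 * c0 := by linarith
    have e6 : a0 * d0 - b0 * c0 = 1 := by linarith
    refine ⟨?_, ?_, ?_, ?_⟩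
    · linear_combination -a1 * e6 - a0 * e4 + b0 * e2
    · linear_combination -b1 * e6 - a0 * e3 + b0 * e5
    · linear_combination -c1 * e6 - c0 * e4 + d0 * e2
    · linear_combination -d1 * e6 - c0 * e3 + d0 * e5

/-- In terms of E, D, N below the four inequalities become 1 ≤ E, E ≤ D, 3E - 1 ≤ N + D and E ≤ N,
while the determinant gives DN = 2E² - 2E + 1. Expanding (D - E)(N - E) ≥ 0 forces E = 1, hence D =
N = 1, and finitely many entries remain. -/
lemma imaginary_entries {a b c d : ℤ} (h1 : a * d + 2 * b * c = 1)
    (e1 : 4 * (b * d) < 2 * (a * d - 2 * c * b) + 4 * (a * c))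
    (e2 : 2 * ((a + -(2 * c)) * d - 2 * c * (b + d)) + 4 * ((a + -(2 * c)) * c)
      ≤ 4 * ((b + d) * d))
    (e3 : 4 * ((b + d) * (-(2 * b) + -d)) <
      2 * ((a + -(2 * c)) * (-(2 * b) + -d) - 2 * (a + -c) * (b + d))
        + 4 * ((a + -(2 * c)) * (a + -c)))
    (e4 : 2 * (-(a * (-(2 * b) + -d)) + 2 * (a + -c) * b) - 4 * (a * (a + -c))
      + 4 * (b * (-(2 * b) + -d)) ≤ 0) :
    (a = 1 ∧ b = 0 ∧ c = 0 ∧ d = 1) ∨ (a = -1 ∧ b = 0 ∧ c = 0 ∧ d = -1) ∨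
    (a = 1 ∧ b = 1 ∧ c = 1 ∧ d = -1) ∨ (a = -1 ∧ b = -1 ∧ c = -1 ∧ d = 1) := by
  obtain ⟨E, hE⟩ : ∃ E, E = a * d + a * c - b * d := ⟨_, rfl⟩
  obtain ⟨D, hD⟩ : ∃ D, D = c ^ 2 + (c + d) ^ 2 := ⟨_, rfl⟩
  obtain ⟨N, hN⟩ : ∃ N, N = (a - b) ^ 2 + b ^ 2 := ⟨_, rfl⟩
  have i1 : 1 ≤ E := by by_contra h; push Not at h; nlinarith
  have i2 : E ≤ D := by by_contra h; push Not at h; nlinarith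
  have i3 : 3 * E - 1 ≤ N + D := by by_contra h; push Not at h; nlinarith
  have i4 : E ≤ N := by by_contra h; push Not at h; nlinarith
  have hDN : D * N = 2 * E ^ 2 - 2 * E + 1 := by
    rw [hD, hN, hE]
    linear_combination (a * d + 2 * b * c + 1 - 2 * (a * d + a * c - b * d)) * h1
  have hE1 : E = 1 := by nlinarith [mul_nonneg (sub_nonneg.2 i2) (sub_nonneg.2 i4)]
  subst hE1
  have hD1 : D = 1 := by nlinarith
  have hN1 : N = 1 := by nlinarith
  rw [hD1] at hD
  rw [hN1] at hN
  have c1 : c ≤ 1 := by nlinarith [sq_nonneg (c + d)]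
  have c2 : -1 ≤ c := by nlinarith [sq_nonneg (c + d)]
  have d1 : c + d ≤ 1 := by nlinarith [sq_nonneg c]
  have d2 : -1 ≤ c + d := by nlinarith [sq_nonneg c]
  have b1 : b ≤ 1 := by nlinarith [sq_nonneg (a - b)]
  have b2 : -1 ≤ b := by nlinarith [sq_nonneg (a - b)]
  have a1 : a - b ≤ 1 := by nlinarith [sq_nonneg b]
  have a2 : -1 ≤ a - b := by nlinarith [sq_nonneg b]
  obtain ⟨e, rfl⟩ : ∃ e, d = e - c := ⟨c + d, by ring⟩
  obtain ⟨f, rfl⟩ : ∃ f, a = f + b := ⟨a - b, by ring⟩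
  rw [add_sub_cancel] at d1 d2
  rw [add_sub_cancel_right] at a1 a2
  clear e1 e2 e3 e4 hDN i1 i2 i3 i4 hD1 hN1
  interval_cases c <;> interval_cases e <;> omega

/-- The four elements generated by `matW`. -/
def InCyclicW (g : SL2) : Prop := g = 1 ∨ g = -1 ∨ g = matW ∨ g = -matW

lemma inCyclicW_of_imaginary {g : SL2} (hg : g ∈ regionGroup) (ha : (g 0 0).im = 0)
    (hb : (g 0 1).re = 0) (hc : (g 1 0).re = 0) (hd : (g 1 1).im = 0) : InCyclicW g := by
  -- Four test points, 1, U, W and UW, already single out ⟨W⟩ among the matrices of this shape.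
  have e1 := (hg 1).2 (by decide)
  have e2 := mt (hg matU).1 (by decide)
  have e3 := (hg matW).2 (by decide)
  have e4 := mt (hg (matU * matW)).1 (by decide)
  have h1 := det_re g
  simp only [realHeight, Herm.height, planeReal, mul_apply_two] at e1 e2 e3 e4
  simp [ha, hb, hc, hd] at e1 e2 e3 e4 h1
  rcases imaginary_entries h1 e1 e2 e3 e4 with ⟨p, q, r, t⟩ | ⟨p, q, r, t⟩ | ⟨p, q, r, t⟩ |
    ⟨p, q, r, t⟩
  · left; apply ext_coord <;> ext <;> simp [*]
  · right; left; apply ext_coord <;> ext <;> simp [*]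
  · right; right; left; apply ext_coord <;> ext <;> simp [*]
  · right; right; right; apply ext_coord <;> ext <;> simp [*]

/-- The form is carried to itself or to its negative, and `matA` exchanges the two cases. If it is
fixed, comparison with gᵀJg = J shows that conjugating the entries of g amounts to conjugating g by
diag(1, -1): the diagonal is real and the rest imaginary. -/
lemma inCyclicW_of_planeImag {g : SL2} (hg : g ∈ regionGroup) (hA : (planeImag g).A = 0)
    (hv : (planeImag g).v = 0) (hC : (planeImag g).C = 0) :
    InCyclicW g ∨ InCyclicW (g * matA) := by
  have hu : (planeImag g).u ^ 2 = 1 := by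
    have := planeImag_disc g
    rw [hA, hv, hC] at this
    linarith
  have h1 := det_re g
  have h2 := det_im g
  rcases sq_eq_one_iff.1 hu with hu | hu
  all_goals
    simp only [planeImag] at hA hv hC hu
    obtain ⟨a0, ha0⟩ : ∃ a, a = (g 0 0).re := ⟨_, rfl⟩
    obtain ⟨a1, ha1⟩ : ∃ a, a = (g 0 0).im := ⟨_, rfl⟩
    obtain ⟨b0, hb0⟩ : ∃ a, a = (g 0 1).re := ⟨_, rfl⟩
    obtain ⟨b1, hb1⟩ : ∃ a, a = (g 0 1).im := ⟨_, rfl⟩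
    obtain ⟨c0, hc0⟩ : ∃ a, a = (g 1 0).re := ⟨_, rfl⟩
    obtain ⟨c1, hc1⟩ : ∃ a, a = (g 1 0).im := ⟨_, rfl⟩
    obtain ⟨d0, hd0⟩ : ∃ a, a = (g 1 1).re := ⟨_, rfl⟩
    obtain ⟨d1, hd1⟩ : ∃ a, a = (g 1 1).im := ⟨_, rfl⟩
    rw [← ha0, ← ha1, ← hb0, ← hb1, ← hc0, ← hc1, ← hd0, ← hd1] at h1 h2
    rw [← ha0, ← ha1, ← hc0, ← hc1] at hA
    rw [← hb0, ← hb1, ← hd0, ← hd1] at hC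
    rw [← ha0, ← ha1, ← hb0, ← hb1, ← hc0, ← hc1, ← hd0, ← hd1] at hu hv
  · left
    refine inCyclicW_of_imaginary hg ?_ ?_ ?_ ?_
    · rw [← ha1]
      have : 2 * a1 = 0 := by
        linear_combination -a1 * h1 + a0 * h2 + b1 * hA - a0 * hv - a1 * hu
      omega
    · rw [← hb0]
      have : 2 * b0 = 0 := by
        linear_combination -b0 * h1 - 2 * b1 * h2 - b0 * hu - 2 * b1 * hv + a0 * hC
      omega
    · rw [← hc0]
      have : 2 * c0 = 0 := by
        linear_combination -c0 * h1 - 2 * c1 * h2 + d0 * hA - c0 * hu + 2 * c1 * hv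
      omega
    · rw [← hd1]
      have : 2 * d1 = 0 := by
        linear_combination -d1 * h1 + d0 * h2 + d0 * hv - d1 * hu + c1 * hC
      omega
  · right
    refine inCyclicW_of_imaginary (mul_mem hg matA_mem) ?_ ?_ ?_ ?_ <;>
      simp [mul_apply_two]
    · rw [← hb1]
      have : 2 * b1 = 0 := by
        linear_combination -b1 * h1 + b0 * h2 - b0 * hv + b1 * hu - a1 * hC
      omega
    · rw [← ha0]
      have : 2 * a0 = 0 := by
        linear_combination -a0 * h1 - 2 * a1 * h2 - b0 * hA + a0 * hu - 2 * a1 * hv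
      omega
    · rw [← hd0]
      have : 2 * d0 = 0 := by
        linear_combination -d0 * h1 - 2 * d1 * h2 + d0 * hu + 2 * d1 * hv - c0 * hC
      omega
    · rw [← hc1]
      have : 2 * c1 = 0 := by
        linear_combination -c1 * h1 + c0 * h2 - d1 * hA + c0 * hv + c1 * hu
      omega

end BianchiTwo

/-! ### Imaginary planes as separators for the edges of the congruence subgroup. -/

namespace BianchiTwo

open Matrix

/-- The multiples of √-2 are the elements with even real part, since √-2·x has real part -2·`x.im`.
-/
lemma mem_gamma0_iff {g : SL2} : g ∈ Gamma0SqrtNegTwo ↔ Even (g 1 0).re := by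
  change g 1 0 ∈ Ideal.span {(Zsqrtd.sqrtd : ℤ√(-2))} ↔ _
  rw [Ideal.mem_span_singleton]
  constructor
  · rintro ⟨x, hx⟩
    rw [hx]
    refine ⟨-x.im, ?_⟩
    simp
    ring
  · rintro ⟨n, hn⟩
    refine ⟨⟨(g 1 0).im, -n⟩, ?_⟩
    ext
    · simp [hn]; ring
    · simp

lemma even_of_mem {g : SL2} (hg : g ∈ Gamma0SqrtNegTwo) :
    Even (g 1 0).re ∧ Odd (g 0 0).re ∧ Odd (g 1 1).re := by
  have h := mem_gamma0_iff.1 hg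
  have h1 := det_re g
  have h2 : Odd ((g 0 0).re * (g 1 1).re) := by
    obtain ⟨n, hn⟩ := h
    rw [hn] at h1
    exact ⟨(g 0 0).im * (g 1 1).im + (g 0 1).re * n - (g 0 1).im * (g 1 0).im, by linarith⟩
  rw [Int.odd_mul] at h2
  exact ⟨h, h2⟩

lemma InCyclicW.re_eq_zero {g : SL2} (h : InCyclicW g) : (g 1 0).re = 0 ∧ (g 0 1).re = 0 := by
  rcases h with rfl | rfl | rfl | rfl <;> simp

/-- Parity excludes one of the two ways of crossing the imaginary plane: the lower left entry of
g·`matA` is that of an odd diagonal entry, not purely imaginary. -/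
lemma not_inCyclicW_mul_A {g : SL2} (hg : g ∈ Gamma0SqrtNegTwo) : ¬ InCyclicW (g * matA) := by
  intro h
  have h1 := h.re_eq_zero.1
  obtain ⟨-, -, k, hk⟩ := even_of_mem hg
  simp [mul_apply_two] at h1
  omega

section entries

lemma matS_inv : matS⁻¹.1 = !![1, 1; -1, 0] := by
  rw [Matrix.SpecialLinearGroup.SL2_inv_expl]
  simp
  rfl

@[simp] lemma matS_inv_00 : matS⁻¹ 0 0 = 1 := congrFun₂ matS_inv 0 0
@[simp] lemma matS_inv_01 : matS⁻¹ 0 1 = 1 := congrFun₂ matS_inv 0 1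
@[simp] lemma matS_inv_10 : matS⁻¹ 1 0 = -1 := congrFun₂ matS_inv 1 0
@[simp] lemma matS_inv_11 : matS⁻¹ 1 1 = 0 := congrFun₂ matS_inv 1 1

end entries

/-- Again parity of the diagonal entries. As a result the second edges never cross the imaginary
plane conjugated by S. -/
lemma not_inCyclicW_S_inv_mul {g : SL2} (hg : g ∈ Gamma0SqrtNegTwo) :
    ¬ (InCyclicW (matS⁻¹ * g) ∨ InCyclicW (matS⁻¹ * g * matA)) := by
  obtain ⟨⟨l, hl⟩, ⟨k, hk⟩, -⟩ := even_of_mem hg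
  rintro (h | h)
  · have h1 := h.re_eq_zero.1
    simp [mul_apply_two] at h1
    omega
  · have h1 := h.re_eq_zero.2
    simp [mul_apply_two] at h1
    omega

lemma imagHeight_mul_T (g : SL2) : imagHeight (g * matT) = imagHeight (g * matA) := by
  simp [imagHeight, Herm.height, planeImag, mul_apply_two]; ring

lemma imagHeight_mul_S_inv (g : SL2) : imagHeight (g * matS⁻¹) = imagHeight g := by
  rw [← imagHeight_mul_S, inv_mul_cancel_right]

lemma imagHeight_mul_I (g : SL2) : imagHeight (g * matI) = imagHeight g := by
  rw [show matI = matS * matW * matS⁻¹ by rw [← matS_mul_matW, mul_inv_cancel_right],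
    ← mul_assoc, imagHeight_mul_S_inv, ← mul_assoc, imagHeight_mul_W, imagHeight_mul_S]

lemma imagHeight_mul_R (g : SL2) : imagHeight (g * matR) = imagHeight (g * matS * matA) := by
  rw [show matR = matS * matA * matS⁻¹ by rw [← matS_mul_matA, mul_inv_cancel_right],
    ← mul_assoc, imagHeight_mul_S_inv, ← mul_assoc]

lemma imagHeight_neg (g : SL2) : imagHeight (-g) = imagHeight g := by
  simp [imagHeight, Herm.height, planeImag]

lemma mul_mem_region {g h : SL2} (hh : h ∈ regionGroup) : g * h ∈ regionGroup ↔ g ∈ regionGroup :=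
  Subgroup.mul_mem_cancel_right _ hh

lemma neg_one_mem_region : (-1 : SL2) ∈ regionGroup := matA_sq ▸ mul_mem matA_mem matA_mem

lemma InCyclicW.mem_region {g : SL2} (h : InCyclicW g) : g ∈ regionGroup := by
  rcases h with rfl | rfl | rfl | rfl
  · exact one_mem _
  · exact neg_one_mem_region
  · exact matW_mem
  · exact neg_one_mul matW ▸ mul_mem neg_one_mem_region matW_mem

lemma InCyclicW.imagHeight {g : SL2} (h : InCyclicW g) :
    0 < imagHeight g ∧ ¬ 0 < imagHeight (g * matA) := by
  have h1 : 0 < BianchiTwo.imagHeight 1 ∧ ¬ 0 < BianchiTwo.imagHeight (1 * matA) := by decide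
  have h2 : 0 < BianchiTwo.imagHeight matW ∧ ¬ 0 < BianchiTwo.imagHeight (matW * matA) := by decide
  rcases h with rfl | rfl | rfl | rfl
  · exact h1
  · simpa only [neg_mul, imagHeight_neg] using h1
  · exact h2
  · simpa only [neg_mul, imagHeight_neg] using h2

/-- The side of the imaginary plane, inside the region of the base point. -/
def SideImag (g : SL2) : Prop := g ∈ regionGroup ∧ 0 < imagHeight g

/-- Restricting to the region is what makes the exceptions finite: up to `matA`, the only elements
of `regionGroup` that preserve the imaginary plane are those of ⟨W⟩. -/
lemma sideImag_mul_A_iff {g : SL2} (h : ¬ (InCyclicW g ∨ InCyclicW (g * matA))) :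
    SideImag (g * matA) ↔ SideImag g := by
  rw [SideImag, SideImag, mul_mem_region matA_mem]
  refine and_congr_right fun hg => ?_
  rcases imagHeight_mul_A_pos g with h1 | ⟨hA, hv, hC⟩
  · exact h1
  · exact absurd (inCyclicW_of_planeImag hg hA hv hC) h

lemma sideImag_mul_A_of_inCyclicW {g : SL2} (h : InCyclicW g) :
    SideImag g ∧ ¬ SideImag (g * matA) :=
  ⟨⟨h.mem_region, h.imagHeight.1⟩, fun h' => h.imagHeight.2 h'.2⟩

lemma sideImag_mul_W (g : SL2) : SideImag (g * matW) ↔ SideImag g := by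
  rw [SideImag, SideImag, mul_mem_region matW_mem, imagHeight_mul_W]

lemma sideImag_mul_S (g : SL2) : SideImag (g * matS) ↔ SideImag g := by
  rw [SideImag, SideImag, mul_mem_region matS_mem, imagHeight_mul_S]

lemma sideImag_mul_I (g : SL2) : SideImag (g * matI) ↔ SideImag g := by
  rw [SideImag, SideImag, mul_mem_region matI_mem, imagHeight_mul_I]

lemma sideImag_mul_T (g : SL2) : SideImag (g * matT) ↔ SideImag (g * matA) := by
  rw [SideImag, SideImag, mul_mem_region matT_mem, mul_mem_region matA_mem, imagHeight_mul_T]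

lemma sideImag_mul_R (g : SL2) : SideImag (g * matR) ↔ SideImag (g * matS * matA) := by
  rw [SideImag, SideImag, mul_mem_region matR_mem, mul_mem_region matA_mem,
    mul_mem_region matS_mem, imagHeight_mul_R]

lemma sideImag_neg (g : SL2) : SideImag (-g) ↔ SideImag g := by
  have h := mul_mem_region (g := g) neg_one_mem_region
  rw [mul_neg_one] at h
  rw [SideImag, SideImag, h, imagHeight_neg]

section separation

variable {g : SL2}

lemma sideImag_mul_T_of_not (hg : g ∈ Gamma0SqrtNegTwo) (h : ¬ InCyclicW g) :
    SideImag (g * matT) ↔ SideImag g := by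
  rw [sideImag_mul_T, sideImag_mul_A_iff (not_or.2 ⟨h, not_inCyclicW_mul_A hg⟩)]

lemma sideImag_mul_T_of_inCyclicW (h : InCyclicW g) : SideImag g ∧ ¬ SideImag (g * matT) := by
  rw [sideImag_mul_T]
  exact sideImag_mul_A_of_inCyclicW h

/-- The four elements generated by `matI`. -/
def InCyclicI (g : SL2) : Prop := g = 1 ∨ g = -1 ∨ g = matI ∨ g = -matI

lemma inCyclicI_iff (g : SL2) : InCyclicI g ↔ InCyclicW (matS⁻¹ * g * matS) := by
  have h : ∀ x : SL2, matS⁻¹ * g * matS = x ↔ g = matS * x * matS⁻¹ := fun x => by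
    rw [eq_mul_inv_iff_mul_eq, mul_assoc, inv_mul_eq_iff_eq_mul]
  simp only [InCyclicI, InCyclicW, h]
  simp [← matS_mul_matW]

lemma sideImag_conj_mul_W : SideImag (matS⁻¹ * (g * matW)) ↔ SideImag (matS⁻¹ * g) := by
  rw [← mul_assoc, sideImag_mul_W]

lemma sideImag_conj_mul_I : SideImag (matS⁻¹ * (g * matI)) ↔ SideImag (matS⁻¹ * g) := by
  rw [← mul_assoc, sideImag_mul_I]

lemma sideImag_conj_mul_T (hg : g ∈ Gamma0SqrtNegTwo) :
    SideImag (matS⁻¹ * (g * matT)) ↔ SideImag (matS⁻¹ * g) := by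
  rw [← mul_assoc, sideImag_mul_T, sideImag_mul_A_iff (not_inCyclicW_S_inv_mul hg)]

lemma inCyclicI_mul_R_iff : InCyclicI (g * matR) ↔ InCyclicW (matS⁻¹ * g * matS * matA) := by
  rw [inCyclicI_iff, ← mul_assoc, mul_assoc _ matR, matS_mul_matA, ← mul_assoc]

lemma sideImag_conj_mul_R_of_not (h : ¬ InCyclicI g) (h' : ¬ InCyclicI (g * matR)) :
    SideImag (matS⁻¹ * (g * matR)) ↔ SideImag (matS⁻¹ * g) := by
  rw [inCyclicI_iff] at h
  rw [inCyclicI_mul_R_iff] at h'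
  rw [← mul_assoc, sideImag_mul_R, sideImag_mul_A_iff (not_or.2 ⟨h, h'⟩), sideImag_mul_S]

lemma sideImag_conj_mul_R_of_inCyclicI (h : InCyclicI g) :
    SideImag (matS⁻¹ * g) ∧ ¬ SideImag (matS⁻¹ * (g * matR)) := by
  rw [inCyclicI_iff] at h
  have := sideImag_mul_A_of_inCyclicW h
  rwa [sideImag_mul_S, ← sideImag_mul_R, mul_assoc _ g] at this

lemma matR_sq : matR * matR = -1 := by
  apply ext_coord <;> simp [mul_apply_two, Zsqrtd.ext_iff]

lemma matI_sq : matI * matI = -1 := by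
  apply ext_coord <;> simp [mul_apply_two, Zsqrtd.ext_iff]

lemma InCyclicI.neg (h : InCyclicI g) : InCyclicI (-g) := by
  rcases h with rfl | rfl | rfl | rfl <;> simp [InCyclicI]

lemma inCyclicI_mul_I_iff : InCyclicI (g * matI) ↔ InCyclicI g := by
  have key : ∀ x, InCyclicI x → InCyclicI (x * matI) := by
    rintro x (rfl | rfl | rfl | rfl) <;> simp [InCyclicI, matI_sq]
  refine ⟨fun h => ?_, key g⟩
  have := (key _ h).neg
  rwa [mul_assoc, matI_sq, mul_neg_one, neg_neg] at this

lemma not_inCyclicI_mul_R (h : InCyclicI g) : ¬ InCyclicI (g * matR) := by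
  have key : ∀ x, InCyclicI x → (x 0 1).im ≠ 0 ∨ (x 0 1).re = 0 ∧ (x 1 0).re = 0 := by
    rintro x (rfl | rfl | rfl | rfl) <;> simp
  intro h'
  have := key _ h'
  rcases h with rfl | rfl | rfl | rfl
  · simp at this
  · simp at this
  · simp [mul_apply_two] at this
  · simp [Matrix.mul_apply, Fin.sum_univ_two] at this

/-- The side of the conjugated imaginary plane, modified along the plane. -/
def SideConj (g : SL2) : Prop := Xor (SideImag (matS⁻¹ * g)) (InCyclicI g)

lemma sideConj_mul_I : SideConj (g * matI) ↔ SideConj g := by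
  rw [SideConj, SideConj, sideImag_conj_mul_I, inCyclicI_mul_I_iff]

/-- Along R the conjugated side jumps exactly between ⟨I⟩ and ⟨I⟩R, and so does the indicator of
⟨I⟩; the jumps cancel. This makes the modified side a function on the vertices of the second kind.
-/
lemma sideConj_mul_R : SideConj (g * matR) ↔ SideConj g := by
  rw [SideConj, SideConj]
  by_cases h : InCyclicI g
  · have h1 := sideImag_conj_mul_R_of_inCyclicI h
    have h2 := not_inCyclicI_mul_R h
    simp [Xor, h, h1, h2]
  · by_cases h' : InCyclicI (g * matR)
    · have h1 := sideImag_conj_mul_R_of_inCyclicI h'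
      rw [mul_assoc g, matR_sq, mul_neg_one, mul_neg, sideImag_neg] at h1
      simp [Xor, h, h', h1]
    · have h1 := sideImag_conj_mul_R_of_not h h'
      simp [h, h', h1]

end separation

end BianchiTwo

namespace BianchiTwo

open Matrix

/-! ### A half-plane in the real plane that isolates one face. -/

section realSide

/-- A half-plane for the action of the real matrices on the hyperbolic plane. -/
def RealSide (g : SL2) : Prop := IsReal g ∧
  0 < 2 * (g 0 0).re * (g 1 1).re - 1 - (g 0 0).re * (g 1 0).re - 2 * (g 0 1).re * (g 1 1).re

variable {g : SL2}

lemma IsReal.mul {h : SL2} (hg : IsReal g) (hh : IsReal h) : IsReal (g * h) := by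
  obtain ⟨h1, h2, h3, h4⟩ := hg
  obtain ⟨k1, k2, k3, k4⟩ := hh
  refine ⟨?_, ?_, ?_, ?_⟩ <;> simp [mul_apply_two, *]

lemma isReal_R : IsReal matR := by refine ⟨?_, ?_, ?_, ?_⟩ <;> simp
lemma isReal_T : IsReal matT := by refine ⟨?_, ?_, ?_, ?_⟩ <;> simp

lemma isReal_mul_R : IsReal (g * matR) ↔ IsReal g := by
  refine ⟨fun h => ?_, fun h => h.mul isReal_R⟩
  obtain ⟨h1, h2, h3, h4⟩ := h
  simp [mul_apply_two] at h1 h2 h3 h4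
  refine ⟨?_, ?_, ?_, ?_⟩ <;> omega

lemma isReal_mul_T : IsReal (g * matT) ↔ IsReal g := by
  refine ⟨fun h => ?_, fun h => h.mul isReal_T⟩
  obtain ⟨h1, h2, h3, h4⟩ := h
  simp [mul_apply_two] at h1 h2 h3 h4
  refine ⟨?_, ?_, ?_, ?_⟩ <;> omega

lemma IsReal.det (h : IsReal g) : (g 0 0).re * (g 1 1).re - (g 0 1).re * (g 1 0).re = 1 := by
  obtain ⟨h1, h2, h3, h4⟩ := h
  have := det_re g
  simpa [h1, h2, h3, h4] using this

lemma realSide_mul_R : RealSide (g * matR) ↔ RealSide g := by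
  rw [RealSide, RealSide, isReal_mul_R]
  refine and_congr_right fun h => ?_
  have h1 := h.det
  simp only [mul_apply_two, matR_00, matR_01, matR_10, matR_11]
  simp
  ring_nf
  constructor <;> intro <;> linarith

/-- With X = 2ad - 1 and Y = ac + 2bd the two values are X - Y and -X - Y, of equal sign if X² < Y².
Since X² - Y² = 1 - (ac)² - 4(bd)² and X is odd, Y even, this can fail only for ac = bd = 0, which
means g = ±1 as a and d are odd. -/
lemma realSide_mul_T_of_ne (hg : g ∈ Gamma0SqrtNegTwo) (h1 : g ≠ 1) (h2 : g ≠ -1) :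
    RealSide (g * matT) ↔ RealSide g := by
  rw [RealSide, RealSide, isReal_mul_T]
  refine and_congr_right fun h => ?_
  obtain ⟨⟨l, hl⟩, oa, od⟩ := even_of_mem hg
  have h3 := h.det
  obtain ⟨r1, r2, r3, r4⟩ := h
  have key : ¬ ((g 0 0).re * (g 1 0).re = 0 ∧ (g 0 1).re * (g 1 1).re = 0) := by
    clear hl
    rintro ⟨e1, e2⟩
    have ha : (g 0 0).re ≠ 0 := by rintro h; simp [h] at oa
    have hd : (g 1 1).re ≠ 0 := by rintro h; simp [h] at od
    have hc := (mul_eq_zero.1 e1).resolve_left ha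
    have hb := (mul_eq_zero.1 e2).resolve_right hd
    rw [hb, hc, mul_zero, sub_zero] at h3
    rcases Int.mul_eq_one_iff_eq_one_or_neg_one.1 h3 with ⟨e, e'⟩ | ⟨e, e'⟩
    · exact h1 (by apply ext_coord <;> ext <;> simp [*])
    · exact h2 (by apply ext_coord <;> ext <;> simp [*])
  simp [mul_apply_two]
  generalize (g 0 0).re = a at *
  generalize (g 0 1).re = b at *
  generalize (g 1 0).re = c at *
  generalize (g 1 1).re = d at *
  obtain ⟨X, hX⟩ : ∃ X, X = 2 * a * d - 1 := ⟨_, rfl⟩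
  obtain ⟨Y, hY⟩ : ∃ Y, Y = a * c + 2 * b * d := ⟨_, rfl⟩
  have hXY : X ^ 2 - Y ^ 2 = 1 - (a * c) ^ 2 - 4 * (b * d) ^ 2 := by
    rw [hX, hY]; linear_combination 4 * a * d * h3
  have hle : X ^ 2 ≤ Y ^ 2 := by
    by_contra hlt
    refine key ⟨?_, ?_⟩ <;> nlinarith [sq_nonneg (a * c), sq_nonneg (b * d)]
  have hodd : X ^ 2 ≠ Y ^ 2 := by
    intro he
    have hY' : Y = 2 * (a * l + b * d) := by rw [hY, hl]; ring
    have hX' : X = 2 * (a * d) - 1 := by rw [hX]; ring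
    rcases sq_eq_sq_iff_eq_or_eq_neg.1 he with he | he <;> omega
  have hlt := lt_of_le_of_ne hle hodd
  have e1 : 2 * a * (c + d) - 1 - a * c - 2 * (a + b) * (c + d) = - X - Y := by
    rw [hX, hY]; linear_combination 2 * h3
  have e2 : 2 * a * d - 1 - a * c - 2 * b * d = X - Y := by rw [hX, hY]; ring
  rw [← sub_pos (b := 2 * (a + b) * (c + d)), ← sub_pos (b := 2 * b * d), e1, e2]
  constructor <;> intro h <;> by_contra h' <;> nlinarith

lemma realSide_mul_T_one : RealSide 1 ∧ ¬ RealSide (1 * matT) := by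
  simp [RealSide, IsReal]

lemma realSide_mul_T_neg_one : RealSide (-1) ∧ ¬ RealSide (-1 * matT) := by
  simp [RealSide, IsReal]

end realSide

/-! ### Generation by Euclidean algorithms. -/

section generation

/-- The unipotent upper triangular matrix with entry `x`. -/
def upper (x : ℤ√(-2)) : SL2 := ⟨!![1, x; 0, 1], by simp [Matrix.det_fin_two]⟩
/-- The unipotent lower triangular matrix with entry `x`. -/
def lower (x : ℤ√(-2)) : SL2 := ⟨!![1, 0; x, 1], by simp [Matrix.det_fin_two]⟩

@[simp] lemma upper_00 (x) : upper x 0 0 = 1 := rfl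
@[simp] lemma upper_01 (x) : upper x 0 1 = x := rfl
@[simp] lemma upper_10 (x) : upper x 1 0 = 0 := rfl
@[simp] lemma upper_11 (x) : upper x 1 1 = 1 := rfl
@[simp] lemma lower_00 (x) : lower x 0 0 = 1 := rfl
@[simp] lemma lower_01 (x) : lower x 0 1 = 0 := rfl
@[simp] lemma lower_10 (x) : lower x 1 0 = x := rfl
@[simp] lemma lower_11 (x) : lower x 1 1 = 1 := rfl

/-- The upper triangular matrices as a homomorphism. -/
def upperHom : Multiplicative (ℤ√(-2)) →* SL2 where
  toFun x := upper x.toAdd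
  map_one' := by apply ext_coord <;> simp
  map_mul' x y := by apply ext_coord <;> simp [mul_apply_two, add_comm]

/-- The lower triangular matrices as a homomorphism. -/
def lowerHom : Multiplicative (ℤ√(-2)) →* SL2 where
  toFun x := lower x.toAdd
  map_one' := by apply ext_coord <;> simp
  map_mul' x y := by apply ext_coord <;> simp [mul_apply_two]

lemma upper_zsmul (n : ℤ) (x : ℤ√(-2)) : upper (n • x) = upper x ^ n :=
  map_zpow upperHom (Multiplicative.ofAdd x) n
lemma lower_zsmul (n : ℤ) (x : ℤ√(-2)) : lower (n • x) = lower x ^ n :=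
  map_zpow lowerHom (Multiplicative.ofAdd x) n
lemma upper_add (x y : ℤ√(-2)) : upper (x + y) = upper x * upper y :=
  map_mul upperHom (Multiplicative.ofAdd x) (Multiplicative.ofAdd y)
lemma lower_add (x y : ℤ√(-2)) : lower (x + y) = lower x * lower y :=
  map_mul lowerHom (Multiplicative.ofAdd x) (Multiplicative.ofAdd y)

lemma lower_two : lower 2 = matT * matR := by
  apply ext_coord <;> simp [mul_apply_two, Zsqrtd.ext_iff]
lemma lower_sqrtd : lower ⟨0, 1⟩ * matU = matW := by
  apply ext_coord <;> simp [mul_apply_two, Zsqrtd.ext_iff]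

lemma exists_two_mul_abs_add_mul_le {c : ℤ} (hc : c ≠ 0) (d : ℤ) :
    ∃ n, 2 * |d + n * c| ≤ |c| := by
  have hc' := abs_pos.2 hc
  have h1 := Int.emod_nonneg d hc
  have h2 := Int.emod_lt_abs d hc
  have h3 := Int.emod_add_mul_ediv d c
  by_cases h : 2 * (d % c) ≤ |c|
  · refine ⟨-(d / c), ?_⟩
    rw [show d + -(d / c) * c = d % c by linarith, abs_of_nonneg h1]
    exact h
  · rcases abs_choice c with hs | hs
    · refine ⟨-(d / c) - 1, ?_⟩
      rw [show d + (-(d / c) - 1) * c = d % c - |c| by rw [hs]; linarith, abs_of_neg (by linarith)]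
      linarith
    · refine ⟨-(d / c) + 1, ?_⟩
      rw [show d + (-(d / c) + 1) * c = d % c - |c| by rw [hs]; linarith, abs_of_neg (by linarith)]
      linarith

lemma mem_of_isReal {H : Subgroup SL2} (hR : matR ∈ H) (hT : matT ∈ H) {g : SL2}
    (hg : g ∈ Gamma0SqrtNegTwo) (h : IsReal g) : g ∈ H := by
  have hu : ∀ n : ℤ, upper n ∈ H := fun n => by
    have := upper_zsmul n 1
    rw [zsmul_one] at this
    rw [this]
    exact zpow_mem hT n
  have hl : ∀ n : ℤ, lower (2 * n) ∈ H := fun n => by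
    have := lower_zsmul n 2
    rw [zsmul_eq_mul, mul_comm] at this
    rw [this, lower_two]
    exact zpow_mem (mul_mem hT hR) n
  have hneg : (-1 : SL2) ∈ H := matR_sq ▸ mul_mem hR hR
  induction hn : (g 1 0).re.natAbs using Nat.strong_induction_on generalizing g with
  | _ n ih =>
    by_cases hc : (g 1 0).re = 0
    · have h3 := h.det
      obtain ⟨r1, r2, r3, r4⟩ := h
      rw [hc, mul_zero, sub_zero] at h3
      rcases Int.mul_eq_one_iff_eq_one_or_neg_one.1 h3 with ⟨e, e'⟩ | ⟨e, e'⟩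
      · rw [show g = upper ((g 0 1).re : ℤ) by apply ext_coord <;> ext <;> simp [*]]
        exact hu _
      · rw [show g = -1 * upper ((-(g 0 1).re : ℤ)) by
          rw [neg_one_mul]
          apply ext_coord <;> ext <;> simp [*]]
        exact mul_mem hneg (hu _)
    · obtain ⟨p, hp⟩ := exists_two_mul_abs_add_mul_le hc (g 1 1).re
      obtain ⟨-, -, od⟩ := even_of_mem hg
      have ec := mem_gamma0_iff.1 hg
      obtain ⟨d, hd⟩ : ∃ d, d = (g 1 1).re + p * (g 1 0).re := ⟨_, rfl⟩
      have od' : Odd d := hd ▸ od.add_even (ec.mul_left p)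
      have d0 : d ≠ 0 := by rintro rfl; simp at od'
      -- After 2|d| ≤ |c|, reducing c modulo 2d gives |c'| ≤ |d|, a strict descent. Division by 2d
      -- is possible because d is odd, hence nonzero.
      obtain ⟨q, hq⟩ := exists_two_mul_abs_add_mul_le (mul_ne_zero two_ne_zero d0) (g 1 0).re
      have hu' : IsReal (upper p) := by refine ⟨?_, ?_, ?_, ?_⟩ <;> simp
      have hl' : IsReal (lower (2 * q)) := by refine ⟨?_, ?_, ?_, ?_⟩ <;> simp
      have e : (((g * upper p) * lower (2 * q)) 1 0).re = (g 1 0).re + q * (2 * d) := by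
        simp [mul_apply_two, hd]
        ring
      have key : ((g * upper p) * lower (2 * q)) ∈ H := by
        refine ih _ ?_ ?_ ((h.mul hu').mul hl') rfl
        · rw [e, ← hn]
          zify
          rw [← hd] at hp
          rw [abs_mul] at hq
          simp at hq
          have : 0 < |d| := abs_pos.2 d0
          linarith
        · rw [mem_gamma0_iff, e]
          exact ec.add ((even_two_mul d).mul_left q)
      have := mul_mem (mul_mem key (inv_mem (hl q))) (inv_mem (hu p))
      rwa [mul_inv_cancel_right, mul_inv_cancel_right] at this

lemma norm_eq (x : ℤ√(-2)) : x.norm = x.re ^ 2 + 2 * x.im ^ 2 := by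
  rw [Zsqrtd.norm]; ring

lemma norm_pos {x : ℤ√(-2)} (hx : x ≠ 0) : 0 < x.norm := by
  rw [norm_eq]
  by_contra h
  refine hx (Zsqrtd.ext ?_ ?_)
  · simp; nlinarith [sq_nonneg x.re, sq_nonneg x.im]
  · simp; nlinarith [sq_nonneg x.re, sq_nonneg x.im]

/-- Euclidean division in `ℤ[√-2]`, with an improved bound away from the deep holes. -/
lemma exists_norm_add_mul_le {c : ℤ√(-2)} (hc : c ≠ 0) (d : ℤ√(-2)) :
    ∃ q, 4 * (d + c * q).norm ≤ 3 * c.norm ∧ (2 * (d + c * q).norm ≤ c.norm ∨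
      ∃ q', (2 * (d + c * q') - ⟨1, 1⟩ * c).norm < c.norm) := by
  have hN := norm_pos hc
  obtain ⟨N, hNe⟩ : ∃ N, N = c.norm := ⟨_, rfl⟩
  rw [← hNe] at hN
  obtain ⟨P, hP⟩ : ∃ P, P = d * star c := ⟨_, rfl⟩
  have hcc : c * star c = (N : ℤ√(-2)) := by rw [hNe]; exact (Zsqrtd.norm_eq_mul_conj c).symm
  have hnorm : ∀ x : ℤ√(-2), x.norm * N = (x * star c).norm := fun x => by
    rw [Zsqrtd.norm_mul, Zsqrtd.norm_conj, hNe]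
  obtain ⟨m, hm⟩ := exists_two_mul_abs_add_mul_le hN.ne' P.re
  obtain ⟨n, hn⟩ := exists_two_mul_abs_add_mul_le hN.ne' P.im
  obtain ⟨e, he⟩ : ∃ e, e = P.re + m * N := ⟨_, rfl⟩
  obtain ⟨f, hf⟩ : ∃ f, f = P.im + n * N := ⟨_, rfl⟩
  rw [← he, abs_of_pos hN] at hm
  rw [← hf, abs_of_pos hN] at hn
  -- Multiplying by the conjugate of c turns division by c into rounding both coordinates modulo the
  -- integer N.
  have hq : (d + c * ⟨m, n⟩) * star c = ⟨e, f⟩ := by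
    rw [add_mul, ← hP, mul_right_comm, hcc, he, hf]
    ext <;> simp [mul_comm]
  have hnq : (d + c * ⟨m, n⟩).norm * N = e ^ 2 + 2 * f ^ 2 := by
    rw [hnorm, hq, norm_eq]
  have he2 : 2 * e ^ 2 ≤ N * |e| := by nlinarith [abs_nonneg e, sq_abs e]
  have hf2 : 2 * f ^ 2 ≤ N * |f| := by nlinarith [abs_nonneg f, sq_abs f]
  refine ⟨⟨m, n⟩, ?_, ?_⟩
  · rw [← hNe]
    have : 4 * (e ^ 2 + 2 * f ^ 2) ≤ 3 * N * N := by nlinarith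
    nlinarith
  rw [← hNe]
  by_cases hle : 2 * (e ^ 2 + 2 * f ^ 2) ≤ N * N
  · left
    nlinarith
  right
  -- This measures the distance to the deep hole (1 + √-2)/2; the shifts i, j ∈ {0, 1} bring the
  -- remainder into the quadrant of that hole.
  have key : ∀ i j : ℤ, (2 * (d + c * ⟨m + i, n + j⟩) - ⟨1, 1⟩ * c).norm * N =
      (2 * e + (2 * i - 1) * N) ^ 2 + 2 * (2 * f + (2 * j - 1) * N) ^ 2 := fun i j => by
    have : (2 * (d + c * ⟨m + i, n + j⟩) - ⟨1, 1⟩ * c) * star c =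
        ⟨2 * e + (2 * i - 1) * N, 2 * f + (2 * j - 1) * N⟩ := by
      have : (2 * (d + c * ⟨m + i, n + j⟩) - ⟨1, 1⟩ * c) * star c =
          2 * ((d + c * ⟨m, n⟩) * star c) + (2 * ⟨i, j⟩ - ⟨1, 1⟩) * (c * star c) := by
        rw [show (⟨m + i, n + j⟩ : ℤ√(-2)) = ⟨m, n⟩ + ⟨i, j⟩ from rfl]
        ring
      rw [this, hq, hcc]
      ext <;> simp
    rw [hnorm, this, norm_eq]
  have hex : ∀ e : ℤ, ∃ i : ℤ, (2 * e + (2 * i - 1) * N) ^ 2 = (2 * |e| - N) ^ 2 := fun e => by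
    rcases abs_choice e with h | h
    · exact ⟨0, by rw [h]; ring⟩
    · exact ⟨1, by rw [h]; ring⟩
  obtain ⟨i, hi⟩ := hex e
  obtain ⟨j, hj⟩ := hex f
  refine ⟨⟨m + i, n + j⟩, ?_⟩
  have h1 := key i j
  rw [hi, hj] at h1
  -- By `he2` and `hf2` the left side is at most 3N² - 4(e² + 2f²), and e² + 2f² exceeds N²/2.
  have : (2 * |e| - N) ^ 2 + 2 * (2 * |f| - N) ^ 2 < N * N := by
    nlinarith [sq_abs e, sq_abs f]
  rw [← h1] at this
  exact lt_of_mul_lt_mul_right this hN.le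

lemma mem_of_mem_gamma0 {H : Subgroup SL2} (hT : matT ∈ H) (hU : matU ∈ H) (hW : matW ∈ H)
    (hI : matI ∈ H) (hR : matR ∈ H) {g : SL2} (hg : g ∈ Gamma0SqrtNegTwo) : g ∈ H := by
  have hu : ∀ x, upper x ∈ H := fun x => by
    have : x = x.re • 1 + x.im • ⟨0, 1⟩ := by ext <;> simp
    rw [this, upper_add, upper_zsmul, upper_zsmul]
    exact mul_mem (zpow_mem hT _) (zpow_mem hU _)
  have hlw : lower ⟨0, 1⟩ ∈ H := by
    have : lower ⟨0, 1⟩ = matW * matU⁻¹ := by rw [← lower_sqrtd, mul_inv_cancel_right]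
    rw [this]
    exact mul_mem hW (inv_mem hU)
  have hl : ∀ x, lower (⟨0, 1⟩ * x) ∈ H := fun x => by
    have : (⟨0, 1⟩ : ℤ√(-2)) * x = (-x.im) • 2 + x.re • ⟨0, 1⟩ := by
      ext <;> simp; ring
    rw [this, lower_add, lower_zsmul, lower_zsmul, lower_two]
    exact mul_mem (zpow_mem (mul_mem hT hR) _) (zpow_mem hlw _)
  have hneg : (-1 : SL2) ∈ H := matR_sq ▸ mul_mem hR hR
  have hGu : ∀ x, upper x ∈ Gamma0SqrtNegTwo := fun x => by simp [mem_gamma0_iff]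
  have hGl : ∀ x, lower (⟨0, 1⟩ * x) ∈ Gamma0SqrtNegTwo := fun x => by simp [mem_gamma0_iff]
  have hGI : matI ∈ Gamma0SqrtNegTwo := by simp [mem_gamma0_iff]
  induction hn : (g 1 0).norm.natAbs using Nat.strong_induction_on generalizing g with
  | _ n ih =>
    have hdet : g 0 0 * g 1 1 - g 0 1 * g 1 0 = 1 := by
      rw [← Matrix.det_fin_two]; exact g.2
    by_cases hc : g 1 0 = 0
    · rw [hc, mul_zero, sub_zero] at hdet
      have h1 := congrArg Zsqrtd.norm hdet
      rw [Zsqrtd.norm_mul, Zsqrtd.norm_one] at h1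
      have h2 : (g 0 0).norm = 1 := by
        have h0 : 0 ≤ (g 0 0).norm := by rw [norm_eq]; positivity
        rcases Int.mul_eq_one_iff_eq_one_or_neg_one.1 h1 with ⟨e, e'⟩ | ⟨e, e'⟩
        · exact e
        · omega
      rw [norm_eq] at h2
      have him : (g 0 0).im = 0 := by nlinarith [sq_nonneg (g 0 0).re]
      rw [him] at h2
      have hre : (g 0 0).re = 1 ∨ (g 0 0).re = -1 := sq_eq_one_iff.1 (by linarith)
      rcases hre with hre | hre
      · have e : g 0 0 = 1 := by ext <;> simp [*]
        rw [e, one_mul] at hdet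
        rw [show g = upper (g 0 1) by apply ext_coord <;> simp [*]]
        exact hu _
      · have e : g 0 0 = -1 := by ext <;> simp [*]
        have e' : g 1 1 = -1 := by rw [e, neg_one_mul] at hdet; exact neg_eq_iff_eq_neg.1 hdet
        rw [show g = -1 * upper (-(g 0 1)) by
          rw [neg_one_mul]
          apply ext_coord <;> simp [*]]
        exact mul_mem hneg (hu _)
    · obtain ⟨q, -, hq | ⟨q, hq⟩⟩ := exists_norm_add_mul_le hc (g 1 1)
      -- Away from the deep holes d√-2 has norm at most that of c, so dividing c by d√-2 shrinks the
      -- norm by a factor 3/4; d is nonzero by parity.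
      · obtain ⟨d, hd⟩ : ∃ d, d = g 1 1 + g 1 0 * q := ⟨_, rfl⟩
        have d0 : d ≠ 0 := by
          rintro rfl
          obtain ⟨-, -, od⟩ := even_of_mem (mul_mem hg (hGu q))
          simp only [mul_apply_two, upper_01, upper_11, mul_one] at od
          rw [add_comm, ← hd] at od
          simp at od
        have dw : d * ⟨0, 1⟩ ≠ 0 := fun h => d0 (by
          simp [Zsqrtd.ext_iff] at h
          ext <;> simp [h])
        obtain ⟨y, hy, -⟩ := exists_norm_add_mul_le dw (g 1 0)
        have e : ((g * upper q) * lower (⟨0, 1⟩ * y)) 1 0 = g 1 0 + d * ⟨0, 1⟩ * y := by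
          simp [mul_apply_two, hd]
          ring
        have key : ((g * upper q) * lower (⟨0, 1⟩ * y)) ∈ H := by
          refine ih _ ?_ (mul_mem (mul_mem hg (hGu q)) (hGl y)) rfl
          rw [e, ← hn]
          have n1 : 0 ≤ (g 1 0 + d * ⟨0, 1⟩ * y).norm := by rw [norm_eq]; positivity
          have n2 := norm_pos hc
          rw [Zsqrtd.norm_mul, norm_eq ⟨0, 1⟩] at hy
          rw [← hd] at hq
          simp at hy
          omega
        have := mul_mem (mul_mem key (inv_mem (hl y))) (inv_mem (hu q))
        rwa [mul_inv_cancel_right, mul_inv_cancel_right] at this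
      -- Near a deep hole, right multiplication by I replaces c by exactly the small quantity 2d -
      -- (1 + √-2)c.
      · have e : ((g * upper q) * matI) 1 0 = 2 * (g 1 1 + g 1 0 * q) - ⟨1, 1⟩ * g 1 0 := by
          rw [mul_apply_two, mul_apply_two, mul_apply_two]
          simp only [upper_00, upper_01, upper_10, upper_11, matI_00, matI_10]
          rw [show (⟨-1, -1⟩ : ℤ√(-2)) = - ⟨1, 1⟩ from rfl]
          ring
        have key : ((g * upper q) * matI) ∈ H := by
          refine ih _ ?_ (mul_mem (mul_mem hg (hGu q)) hGI) rfl
          rw [e, ← hn]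
          have n1 : 0 ≤ (2 * (g 1 1 + g 1 0 * q) - ⟨1, 1⟩ * g 1 0).norm := by
            rw [norm_eq]; positivity
          have n2 := norm_pos hc
          omega
        have := mul_mem (mul_mem key (inv_mem hI)) (inv_mem (hu q))
        rwa [mul_inv_cancel_right, mul_inv_cancel_right] at this

end generation

end BianchiTwo

noncomputable section

open MonoidAlgebra

/-! ### Pairings of 𝔽₂[G] with functions, and membership in left ideals. -/

namespace GroupRing

section basis

variable {G : Type}

/-- The basis element of `𝔽₂[G]` given by `g`. -/
def el (g : G) : (ZMod 2)[G] := single g 1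

/-- The pairing of an element of `𝔽₂[G]` with a function on `G`. -/
def pairing (f : G → ZMod 2) : (ZMod 2)[G] →+ ZMod 2 :=
  (Finsupp.liftAddHom fun g => (AddMonoidHom.mulRight (f g))).comp
    (coeffAddEquiv (R := ZMod 2) (M := G)).toAddMonoidHom

@[simp] lemma pairing_el (f : G → ZMod 2) (g : G) : pairing f (el g) = f g := by
  simp [pairing, el]

end basis

variable {G : Type} [Group G]

lemma el_one : el (1 : G) = 1 := rfl
lemma el_mul (g h : G) : el (g * h) = el g * el h := by simp [el, single_mul_single]

lemma induction_el {p : (ZMod 2)[G] → Prop} (x : (ZMod 2)[G]) (zero : p 0)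
    (add : ∀ x y, p x → p y → p (x + y)) (el : ∀ g, p (el g)) : p x := by
  induction x using MonoidAlgebra.induction_linear with
  | zero => exact zero
  | add x y hx hy => exact add x y hx hy
  | single g r =>
    obtain rfl | rfl : r = 0 ∨ r = 1 := by revert r; decide
    · simpa using zero
    · exact el g

instance : CharP (ZMod 2)[G] 2 := charP_of_injective_algebraMap (algebraMap (ZMod 2) _).injective 2

lemma pairing_mul_el (f : G → ZMod 2) (x : (ZMod 2)[G]) (g : G) :
    pairing f (x * el g) = pairing (fun h => f (h * g)) x := by
  induction x using induction_el with
  | zero => simp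
  | add x y hx hy => rw [add_mul, map_add, map_add, hx, hy]
  | el h => rw [← el_mul, pairing_el, pairing_el]

lemma pairing_add_left (f f' : G → ZMod 2) (x : (ZMod 2)[G]) :
    pairing (fun g => f g + f' g) x = pairing f x + pairing f' x := by
  induction x using induction_el with
  | zero => simp
  | add x y hx hy => rw [map_add, map_add, map_add, hx, hy]; abel
  | el h => simp

/-- Right multiplication by 1 + g is adjoint to taking the difference of a function along the edges
from γ to γg. -/
lemma pairing_mul_one_add {f f' : G → ZMod 2} {g : G} (h : ∀ γ, f γ + f (γ * g) = f' γ)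
    (x : (ZMod 2)[G]) : pairing f (x * (1 + el g)) = pairing f' x := by
  rw [mul_add, mul_one, map_add, pairing_mul_el, ← pairing_add_left]
  congr 2
  funext γ
  exact h γ

/-- The pairing in the hypothesis is the coefficient of γ in x·n. -/
lemma mul_eq_zero_of_pairing {x n : (ZMod 2)[G]}
    (h : ∀ γ, pairing (fun g => n.coeff (g⁻¹ * γ)) x = 0) : x * n = 0 := by
  ext γ
  rw [coeff_zero, Finsupp.zero_apply, ← h γ]
  clear h
  induction x using induction_el with
  | zero => simp
  | add x y hx hy => rw [add_mul, map_add, coeff_add, Finsupp.add_apply, hx, hy]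
  | el h => rw [pairing_el, el, coeff_single_mul_apply, one_mul]

open Classical in
/-- The indicator function of a proposition. -/
def ind (p : Prop) : ZMod 2 := if p then 1 else 0

lemma ind_congr {p q : Prop} (h : p ↔ q) : ind p = ind q := by rw [propext h]
lemma ind_add_self {p q : Prop} (h : p ↔ q) : ind p + ind q = 0 := by
  rw [ind_congr h, CharTwo.add_self_eq_zero]
lemma ind_true {p : Prop} (h : p) : ind p = 1 := if_pos h
lemma ind_false {p : Prop} (h : ¬ p) : ind p = 0 := if_neg h

/-- An element of `𝔽₂[G]` whose sums over the cosets of a subgroup `L` vanish lies in every left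
ideal containing all `1 + l`, `l ∈ L`. -/
lemma mem_of_pairing_coset {L : Subgroup G} {J : Ideal (ZMod 2)[G]}
    (hJ : ∀ l ∈ L, 1 + el l ∈ J) {x : (ZMod 2)[G]}
    (hx : ∀ γ, pairing (fun g => ind (γ⁻¹ * g ∈ L)) x = 0) : x ∈ J := by
  let π : (ZMod 2)[G] →+ (G ⧸ L →₀ ZMod 2) :=
    (Finsupp.mapDomain.addMonoidHom (QuotientGroup.mk (s := L))).comp
      (coeffAddEquiv (R := ZMod 2) (M := G)).toAddMonoidHom
  let σ : (G ⧸ L →₀ ZMod 2) →+ (ZMod 2)[G] :=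
    (coeffAddEquiv (R := ZMod 2) (M := G)).symm.toAddMonoidHom.comp
      (Finsupp.mapDomain.addMonoidHom Quotient.out)
  have hσ : ∀ g, σ (π (el g)) = el (Quotient.out (QuotientGroup.mk (s := L) g)) := fun g => by
    simp [π, σ, el, Finsupp.mapDomain.addMonoidHom]
  have hπ : π x = 0 := by
    ext c
    obtain ⟨γ, rfl⟩ := QuotientGroup.mk_surjective c
    rw [Finsupp.zero_apply, ← hx γ]
    clear hx
    induction x using induction_el with
    | zero => simp
    | add x y hx hy => rw [map_add, map_add, Finsupp.add_apply, hx, hy]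
    | el h =>
      have : π (el h) = Finsupp.single (QuotientGroup.mk h) 1 := by
        simp [π, el, Finsupp.mapDomain.addMonoidHom]
      classical
      rw [this, pairing_el, Finsupp.single_apply, ← ind_congr (QuotientGroup.eq), ind]
      simp only [eq_comm]
      congr
  -- Modulo J every group element may be replaced by its coset representative; σ(π x) is the result,
  -- and it vanishes with the coset sums.
  have key : x + σ (π x) ∈ J := by
    clear hπ hx
    induction x using induction_el with
    | zero => simp
    | add x y hx hy =>
      rw [map_add, map_add, add_add_add_comm]
      exact J.add_mem hx hy
    | el h =>
      rw [hσ]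
      set r := Quotient.out (QuotientGroup.mk (s := L) h)
      have hr : r⁻¹ * h ∈ L := QuotientGroup.eq.1 (QuotientGroup.out_eq' _)
      have : el h + el r = el r * (1 + el (r⁻¹ * h)) := by
        rw [mul_add, mul_one, ← el_mul, mul_inv_cancel_left, add_comm]
      rw [this]
      exact J.mul_mem_left _ (hJ _ hr)
  rwa [hπ, map_zero, add_zero] at key

/-- The group elements congruent to `1` modulo a left ideal. -/
def congrOne (J : Ideal (ZMod 2)[G]) : Subgroup G where
  carrier := {g | 1 + el g ∈ J}
  one_mem' := by
    change 1 + el 1 ∈ J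
    rw [el_one, CharTwo.add_self_eq_zero]
    exact J.zero_mem
  mul_mem' {g h} hg hh := by
    change 1 + el (g * h) ∈ J
    have : 1 + el (g * h) = (1 + el g) + el g * (1 + el h) := by
      rw [mul_add, mul_one, el_mul, add_assoc, ← add_assoc (el g), CharTwo.add_self_eq_zero,
        zero_add]
    rw [this]
    exact J.add_mem hg (J.mul_mem_left _ hh)
  inv_mem' {g} hg := by
    change 1 + el g⁻¹ ∈ J
    have : 1 + el g⁻¹ = el g⁻¹ * (1 + el g) := by
      rw [mul_add, mul_one, ← el_mul, inv_mul_cancel, el_one, add_comm]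
    rw [this]
    exact J.mul_mem_left _ hg

lemma mem_congrOne {J : Ideal (ZMod 2)[G]} {g : G} : g ∈ congrOne J ↔ 1 + el g ∈ J := Iff.rfl

end GroupRing

end

noncomputable section

open MonoidAlgebra

namespace GroupRing

/-! ### Decidable computation in the group ring of a finite group by lists. -/

section lists

variable {G Q : Type} [Group G] [Group Q] (ψ : Q →* G)

/-- The element of `𝔽₂[G]` given by a list of elements of a group mapping to `G`. -/
def ofList (L : List Q) : (ZMod 2)[G] := (L.map fun q => el (ψ q)).sum

@[simp] lemma ofList_nil : ofList ψ [] = 0 := rfl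
@[simp] lemma ofList_cons (q : Q) (L : List Q) : ofList ψ (q :: L) = el (ψ q) + ofList ψ L := rfl
lemma ofList_singleton (q : Q) : ofList ψ [q] = el (ψ q) := by simp
@[simp] lemma ofList_append (L M : List Q) : ofList ψ (L ++ M) = ofList ψ L + ofList ψ M := by
  simp [ofList]

lemma ofList_map_mul (q : Q) (L : List Q) :
    ofList ψ (L.map (q * ·)) = el (ψ q) * ofList ψ L := by
  induction L with
  | nil => simp
  | cons r L ih => rw [List.map_cons, ofList_cons, ih, ofList_cons, mul_add, map_mul, el_mul]

lemma ofList_flatMap {ι : Type} (L : List ι) (f : ι → List Q) :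
    ofList ψ (L.flatMap f) = (L.map fun i => ofList ψ (f i)).sum := by
  induction L with
  | nil => simp
  | cons r L ih => rw [List.flatMap_cons, ofList_append, ih, List.map_cons, List.sum_cons]

/-- The product of lists. -/
def lmul (L M : List Q) : List Q := L.flatMap fun q => M.map (q * ·)

lemma ofList_lmul (L M : List Q) : ofList ψ (lmul L M) = ofList ψ L * ofList ψ M := by
  induction L with
  | nil => simp [lmul]
  | cons r L ih =>
    rw [ofList_cons, add_mul, ← ih, ← ofList_map_mul, ← ofList_append]
    rfl

/-- The row over `𝔽₂[G]` given by a row of lists. -/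
def row {n : ℕ} (v : Fin n → List Q) : Fin n → (ZMod 2)[G] := fun j => ofList ψ (v j)

/-- The product of a row of lists with a matrix of lists. -/
def lvecMul {m n : ℕ} (v : Fin m → List Q) (A : Matrix (Fin m) (Fin n) (List Q)) :
    Fin n → List Q :=
  fun j => (List.finRange m).flatMap fun l => lmul (v l) (A l j)

lemma row_lvecMul {m n : ℕ} (v : Fin m → List Q) (A : Matrix (Fin m) (Fin n) (List Q)) :
    row ψ (lvecMul v A) = Matrix.vecMul (row ψ v) (A.map (ofList ψ)) := by
  ext1 j
  simp only [lvecMul, row, Matrix.map_apply, ofList_flatMap, ofList_lmul,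
    Matrix.vecMul, dotProduct, Fin.sum_univ_def]

/-- The product of a list with a row of lists. -/
def lsmul {n : ℕ} (L : List Q) (v : Fin n → List Q) : Fin n → List Q := fun j => lmul L (v j)

lemma row_lsmul {n : ℕ} (L : List Q) (v : Fin n → List Q) :
    row ψ (lsmul L v) = ofList ψ L • row ψ v := funext fun _ => ofList_lmul ..

/-- The sum of rows of lists. -/
def ladd {n : ℕ} (u v : Fin n → List Q) : Fin n → List Q := fun j => u j ++ v j

lemma row_ladd {n : ℕ} (u v : Fin n → List Q) :
    row ψ (ladd u v) = row ψ u + row ψ v := funext fun _ => ofList_append ..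

variable [DecidableEq Q]

/-- Equality of lists as elements of `𝔽₂[Q]`. -/
def ListEq (L M : List Q) : Prop := ∀ q, L.count q % 2 = M.count q % 2

instance [Fintype Q] (L M : List Q) : Decidable (ListEq L M) :=
  inferInstanceAs (Decidable (∀ q, L.count q % 2 = M.count q % 2))

lemma ofList_eq_sum (L : List Q) [Fintype Q] :
    ofList ψ L = ∑ q, (L.count q : (ZMod 2)[G]) * el (ψ q) := by
  induction L with
  | nil => simp
  | cons r L ih =>
    simp [ih, List.count_cons, add_mul, Finset.sum_add_distrib, add_comm]

lemma ofList_congr [Fintype Q] {L M : List Q} (h : ListEq L M) : ofList ψ L = ofList ψ M := by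
  rw [ofList_eq_sum, ofList_eq_sum]
  refine Finset.sum_congr rfl fun q _ => ?_
  congr 1
  exact (CharP.natCast_eq_natCast _ 2).2 (h q)

/-- Equality of rows of lists as rows over `𝔽₂[Q]`. -/
def RowEq {n : ℕ} (u v : Fin n → List Q) : Prop := ∀ j, ListEq (u j) (v j)

instance [Fintype Q] {n : ℕ} (u v : Fin n → List Q) : Decidable (RowEq u v) :=
  by unfold RowEq; infer_instance

lemma row_congr [Fintype Q] {n : ℕ} {u v : Fin n → List Q} (h : RowEq u v) :
    row ψ u = row ψ v := funext fun j => ofList_congr ψ (h j)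

variable {ψ}

/-- A contraction of a sequence of free modules over `𝔽₂[Q]`, given on the basis, makes the
induced sequence over `𝔽₂[G]` exact. -/
theorem exact_of_contraction [Fintype Q] (hψ : Function.Injective ψ) {m n p : ℕ}
    {A : Matrix (Fin m) (Fin n) (List Q)} {B : Matrix (Fin n) (Fin p) (List Q)}
    (s : Fin n → Q → Fin m → List Q) (t : Fin p → Q → Fin n → List Q)
    (h : ∀ i q j, ListEq (if i = j then [q] else [])
      (lvecMul (s i q) A j ++
      (List.finRange p).flatMap fun l => (B i l).flatMap fun r => t l (q * r) j))
    {x : Fin n → (ZMod 2)[G]} (hx : Matrix.vecMul x (B.map (ofList ψ)) = 0) :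
    ∃ y, Matrix.vecMul y (A.map (ofList ψ)) = x := by
  -- Every g is written as ρ(g)·ψ(κ(g)), with ρ constant on cosets. The contraction acts on the
  -- factor κ(g) and is translated by ρ(g).
  let ρ : G → G := fun g => Quotient.out (QuotientGroup.mk (s := ψ.range) g)
  have hρ : ∀ g, ∃ q, ψ q = (ρ g)⁻¹ * g := fun g =>
    QuotientGroup.eq.1 (QuotientGroup.out_eq' (QuotientGroup.mk (s := ψ.range) g))
  choose κ hκ using hρ
  have hρmul : ∀ g q, ρ (g * ψ q) = ρ g := fun g q => by
    simp only [ρ]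
    congr 1
    rw [QuotientGroup.eq]
    exact ⟨q⁻¹, by simp⟩
  have hκmul : ∀ g q, κ (g * ψ q) = κ g * q := fun g q => hψ <| by
    rw [hκ, hρmul, map_mul, hκ, mul_assoc]
  have hg : ∀ g, el (ρ g) * el (ψ (κ g)) = el g := fun g => by
    rw [← el_mul, hκ, mul_inv_cancel_left]
  obtain ⟨Λ, hΛ⟩ : ∃ Λ : (Q → List Q) → (ZMod 2)[G] →+ (ZMod 2)[G],
      ∀ u g, Λ u (el g) = el (ρ g) * ofList ψ (u (κ g)) := by
    refine ⟨fun u => (Finsupp.liftAddHom fun g =>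
      ((AddMonoidHom.mulRight (el (ρ g) * ofList ψ (u (κ g)))).comp
        (algebraMap (ZMod 2) (ZMod 2)[G]).toAddMonoidHom)).comp
      (coeffAddEquiv (R := ZMod 2) (M := G)).toAddMonoidHom, fun u g => ?_⟩
    simp [el]
    exact one_mul _
  -- The translated contraction identity x = s(x)A + t(xB); for xB = 0 it exhibits x as s(x)A.
  have key : ∀ i j (x : (ZMod 2)[G]), (if i = j then x else 0) =
      ∑ l, Λ (s i · l) x * ofList ψ (A l j) + ∑ l, Λ (t l · j) (x * ofList ψ (B i l)) := by
    intro i j x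
    induction x using induction_el with
    | zero => simp
    | add x y hx hy =>
      have : (if i = j then x + y else 0) = (if i = j then x else 0) + (if i = j then y else 0) := by
        split_ifs <;> simp
      rw [this, hx, hy]
      simp only [map_add, add_mul, Finset.sum_add_distrib]
      abel
    | el g =>
      have h1 := congrArg (el (ρ g) * ·) (ofList_congr ψ (h i (κ g) j))
      simp only [lvecMul, ofList_append, ofList_flatMap, ofList_lmul, mul_add] at h1
      have h2 : el (ρ g) * ofList ψ (if i = j then [κ g] else []) = if i = j then el g else 0 := by
        split_ifs <;> simp [hg]
      rw [h2] at h1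
      rw [h1, ← Fin.sum_univ_def, ← Fin.sum_univ_def, Finset.mul_sum, Finset.mul_sum]
      congr 1
      · refine Finset.sum_congr rfl fun l _ => ?_
        rw [hΛ, mul_assoc]
      · refine Finset.sum_congr rfl fun l _ => ?_
        induction B i l with
        | nil => simp
        | cons r L ih =>
          rw [List.map_cons, List.sum_cons, mul_add, ih, ofList_cons, mul_add, map_add, ← el_mul,
            hΛ, hρmul, hκmul]
  refine ⟨fun l => ∑ i, Λ (s i · l) (x i), ?_⟩
  funext j
  have h1 : x j = ∑ i, if i = j then x i else 0 := by simp
  rw [h1]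
  simp only [key, Finset.sum_add_distrib]
  have h2 : ∑ i, ∑ l, Λ (t l · j) (x i * ofList ψ (B i l)) = 0 := by
    rw [Finset.sum_comm]
    refine Finset.sum_eq_zero fun l _ => ?_
    rw [← map_sum]
    have := congrFun hx l
    simp only [Matrix.vecMul, dotProduct, Matrix.map_apply] at this
    rw [this, Pi.zero_apply, map_zero]
  rw [h2, add_zero, Finset.sum_comm]
  simp only [Matrix.vecMul, dotProduct, Matrix.map_apply, Finset.sum_mul]

end lists

end GroupRing

end

noncomputable section

open MonoidAlgebra Matrix

namespace MatrixResolution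

variable {k G : Type} [CommRing k] [Group G]

/-! ### The total complex of vertex, edge and face columns. -/

section total

variable {α β γ : ℕ → Type} [∀ n, Fintype (α n)] [∀ n, Fintype (β n)] [∀ n, Fintype (γ n)]

/-- The differential of the total complex of three columns. -/
def totalMatrix {k G : Type} [CommRing k] [Group G] (dA : ∀ n, Matrix (α (n + 1)) (α n) k[G])
    (dB : ∀ n, Matrix (β (n + 1)) (β n) k[G]) (dC : ∀ n, Matrix (γ (n + 1)) (γ n) k[G])
    (f : ∀ n, Matrix (β (n + 1)) (α n) k[G]) (g : ∀ n, Matrix (γ (n + 1)) (β n) k[G])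
    (h : ∀ n, Matrix (γ (n + 1)) (α n) k[G]) (n : ℕ) :
    Matrix (α (n + 1) ⊕ β (n + 1) ⊕ γ (n + 1)) (α n ⊕ β n ⊕ γ n) k[G] :=
  fromBlocks (dA n) 0 (fromRows (f n) (h n)) (fromBlocks (dB n) 0 (g n) (dC n))

variable {dA : ∀ n, Matrix (α (n + 1)) (α n) k[G]}
  {dB : ∀ n, Matrix (β (n + 1)) (β n) k[G]} {dC : ∀ n, Matrix (γ (n + 1)) (γ n) k[G]}
  {f : ∀ n, Matrix (β (n + 1)) (α n) k[G]} {g : ∀ n, Matrix (γ (n + 1)) (β n) k[G]}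
  {h : ∀ n, Matrix (γ (n + 1)) (α n) k[G]}

lemma vecMul_totalMatrix (n : ℕ) (a : α (n + 1) → k[G]) (b : β (n + 1) → k[G])
    (c : γ (n + 1) → k[G]) :
    Sum.elim a (Sum.elim b c) ᵥ* totalMatrix dA dB dC f g h n =
      Sum.elim (a ᵥ* dA n + (b ᵥ* f n + c ᵥ* h n))
        (Sum.elim (b ᵥ* dB n + c ᵥ* g n) (c ᵥ* dC n)) := by
  rw [totalMatrix, vecMul_fromBlocks, Sum.elim_comp_inl, Sum.elim_comp_inr, vecMul_fromBlocks,
    vecMul_fromRows, Sum.elim_comp_inl, Sum.elim_comp_inr, vecMul_zero, vecMul_zero, zero_add,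
    zero_add]

lemma totalMatrix_mul (hA : ∀ n, dA (n + 1) * dA n = 0) (hB : ∀ n, dB (n + 1) * dB n = 0)
    (hC : ∀ n, dC (n + 1) * dC n = 0) (hf : ∀ n, f (n + 1) * dA n + dB (n + 1) * f n = 0)
    (hg : ∀ n, g (n + 1) * dB n + dC (n + 1) * g n = 0)
    (hh : ∀ n, h (n + 1) * dA n + (g (n + 1) * f n + dC (n + 1) * h n) = 0) (n : ℕ) :
    totalMatrix dA dB dC f g h (n + 1) * totalMatrix dA dB dC f g h n = 0 := by
  simp only [totalMatrix, fromBlocks_multiply, fromRows_mul, fromBlocks_mul_fromRows, hA, hB, hC, hg,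
    Matrix.mul_zero, Matrix.zero_mul, add_zero, zero_add]
  have hadd : ∀ {l m n : Type} (A B : Matrix l n k[G]) (C D : Matrix m n k[G]),
      fromRows A C + fromRows B D = fromRows (A + B) (C + D) := by
    intro l m n A B C D
    ext1 i j
    rcases i with i | i <;> rfl
  rw [hadd, hf, hh]
  simp

/-- A criterion for the total complex of three columns to be a resolution. -/
theorem isResolution_totalMatrix [Nonempty (α 0)]
    (hA : ∀ n, dA (n + 1) * dA n = 0) (hB : ∀ n, dB (n + 1) * dB n = 0)
    (hC : ∀ n, dC (n + 1) * dC n = 0) (hf : ∀ n, f (n + 1) * dA n + dB (n + 1) * f n = 0)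
    (hg : ∀ n, g (n + 1) * dB n + dC (n + 1) * g n = 0)
    (hh : ∀ n, h (n + 1) * dA n + (g (n + 1) * f n + dC (n + 1) * h n) = 0)
    [IsEmpty (β 0)] [IsEmpty (γ 0)] [IsEmpty (γ 1)]
    (augA : ∀ i, ∑ j, aug k G (dA 0 i j) = 0) (augB : ∀ i, ∑ j, aug k G (f 0 i j) = 0)
    (exA : ∀ n x, x ᵥ* dA n = 0 → ∃ y, y ᵥ* dA (n + 1) = x)
    (exB : ∀ n b a, b ᵥ* dB n = 0 → a ᵥ* dA n + b ᵥ* f n = 0 →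
      ∃ b' c', b' ᵥ* dB (n + 1) + c' ᵥ* g (n + 1) = b ∧ c' ᵥ* dC (n + 1) = 0)
    (exC : ∀ n c b, c ᵥ* dC n = 0 → b ᵥ* dB n + c ᵥ* g n = 0 → ∃ c', c' ᵥ* dC (n + 1) = c)
    (exZero : ∀ x : α 0 → k[G], ∑ i, aug k G (x i) = 0 → ∃ a b, a ᵥ* dA 0 + b ᵥ* f 0 = x) :
    IsResolution k G (fun n => α n ⊕ β n ⊕ γ n) (totalMatrix dA dB dC f g h) where
  nonempty := ⟨Sum.inl (Classical.arbitrary _)⟩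
  mul_eq_zero := totalMatrix_mul hA hB hC hf hg hh
  aug_eq_zero i := by
    rcases i with i | i | i
    · simp [totalMatrix, augA]
    · simp [totalMatrix, augB]
    · exact isEmptyElim i
  exact_zero x hx := by
    obtain ⟨a, b, hab⟩ := exZero (x ∘ Sum.inl) (by simpa using hx)
    refine ⟨Sum.elim a (Sum.elim b isEmptyElim), ?_⟩
    rw [vecMul_totalMatrix]
    funext i
    rcases i with i | i | i
    · have : (isEmptyElim : γ 1 → k[G]) ᵥ* h 0 = 0 := by
        funext j; simp [vecMul, dotProduct]
      rw [this, add_zero, hab]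
      rfl
    · exact isEmptyElim i
    · exact isEmptyElim i
  exact_succ n x hx := by
    have split : ∀ {m} (x : α m ⊕ β m ⊕ γ m → k[G]), ∃ a b c, x = Sum.elim a (Sum.elim b c) :=
      fun x => ⟨x ∘ Sum.inl, x ∘ Sum.inr ∘ Sum.inl, x ∘ Sum.inr ∘ Sum.inr, by
        funext i; rcases i with i | i | i <;> rfl⟩
    have stable : ∀ {x} y, x ᵥ* totalMatrix dA dB dC f g h n = 0 →
        (x - y ᵥ* totalMatrix dA dB dC f g h (n + 1)) ᵥ* totalMatrix dA dB dC f g h n = 0 :=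
      fun y hx => by
        rw [sub_vecMul, hx, vecMul_vecMul, totalMatrix_mul hA hB hC hf hg hh, vecMul_zero, sub_zero]
    have stepA : ∀ a, Sum.elim a (Sum.elim 0 0) ᵥ* totalMatrix dA dB dC f g h n = 0 →
        ∃ y, y ᵥ* totalMatrix dA dB dC f g h (n + 1) = Sum.elim a (Sum.elim 0 0) := by
      intro a ha
      rw [vecMul_totalMatrix] at ha
      have h1 : a ᵥ* dA n = 0 := by simpa using congrArg (· ∘ Sum.inl) ha
      obtain ⟨y, rfl⟩ := exA n a h1
      refine ⟨Sum.elim y (Sum.elim 0 0), ?_⟩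
      rw [vecMul_totalMatrix]
      simp
    have stepB : ∀ a b, Sum.elim a (Sum.elim b 0) ᵥ* totalMatrix dA dB dC f g h n = 0 →
        ∃ y, y ᵥ* totalMatrix dA dB dC f g h (n + 1) = Sum.elim a (Sum.elim b 0) := by
      intro a b hab
      have hab' := hab
      rw [vecMul_totalMatrix] at hab
      have h1 : a ᵥ* dA n + b ᵥ* f n = 0 := by simpa using congrArg (· ∘ Sum.inl) hab
      have h2 : b ᵥ* dB n = 0 := by
        have : b ᵥ* dB n + 0 ᵥ* g n = 0 := congrArg (· ∘ Sum.inr ∘ Sum.inl) hab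
        simpa using this
      obtain ⟨b', c', h3, h4⟩ := exB n b a h2 h1
      have h5 := stable (Sum.elim 0 (Sum.elim b' c')) hab'
      rw [vecMul_totalMatrix, h3, h4, ← Sum.elim_sub_sub, ← Sum.elim_sub_sub, sub_self, sub_self] at h5
      obtain ⟨y, hy⟩ := stepA _ h5
      refine ⟨y + Sum.elim (0 : α (n + 2) → k[G]) (Sum.elim b' c'), ?_⟩
      rw [add_vecMul, hy, vecMul_totalMatrix, h3, h4, ← Sum.elim_add_add, ← Sum.elim_add_add]
      simp
    -- Subtracting boundaries first removes the face component, then the edge component, and leaves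
    -- a cycle in the exact vertex column.
    obtain ⟨a, b, c, rfl⟩ := split x
    have hx' := hx
    rw [vecMul_totalMatrix] at hx
    have h1 : b ᵥ* dB n + c ᵥ* g n = 0 := congrArg (· ∘ Sum.inr ∘ Sum.inl) hx
    have h2 : c ᵥ* dC n = 0 := congrArg (· ∘ Sum.inr ∘ Sum.inr) hx
    obtain ⟨c', h3⟩ := exC n c b h2 h1
    have h5 := stable (Sum.elim 0 (Sum.elim 0 c')) hx'
    rw [vecMul_totalMatrix, h3, ← Sum.elim_sub_sub, ← Sum.elim_sub_sub, sub_self] at h5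
    obtain ⟨y, hy⟩ := stepB _ _ h5
    refine ⟨y + Sum.elim (0 : α (n + 2) → k[G]) (Sum.elim (0 : β (n + 2) → k[G]) c'), ?_⟩
    rw [add_vecMul, hy, vecMul_totalMatrix, h3, ← Sum.elim_add_add, ← Sum.elim_add_add]
    simp

end total

end MatrixResolution

end

/-! ### Periodic resolutions of the quaternion group, chain maps and homotopies. -/

namespace QuaternionResolution

open MonoidAlgebra GroupRing QuaternionGroup

/-- The quaternion group of order eight. -/
abbrev Quat := QuaternionGroup 2

/-- The quaternion `i`. -/
abbrev qi : Quat := a 1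
/-- The quaternion `j`. -/
abbrev qj : Quat := xa 0
/-- The quaternion `k = ij`. -/
abbrev qk : Quat := xa 3
/-- The quaternion `-1`. -/
abbrev qz : Quat := a 2

/-- The ranks of the periodic free resolution of the quaternion group. -/
def rk : ℕ → ℕ
  | 0 => 1
  | 1 => 2
  | 2 => 2
  | 3 => 1
  | n + 4 => rk n

/-- The differential of the periodic free resolution of the quaternion group. -/
def dQuat : ∀ n, Matrix (Fin (rk (n + 1))) (Fin (rk n)) (List Quat)
  | 0 => ![![[1, qi]], ![[1, qj]]]
  | 1 => ![![[1, qi], [1, qj]], ![[1, qk], [1, qi]]]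
  | 2 => ![![[1, qi], [1, qk]]]
  | 3 => ![![[1, qi, qj, qk, qz, qz * qi, qz * qj, qz * qk]]]
  | n + 4 => dQuat n

/-- The differential of the periodic free resolution of the cyclic subgroup generated by an
element of order four. -/
def dCyclic (g : Quat) : ℕ → List Quat
  | 0 => [1, g]
  | 1 => [1, g, g * g, g * g * g]
  | n + 2 => dCyclic g n

/-- The chain map from the resolution of the center to the one of a cyclic subgroup. -/
def mu (g : Quat) : ℕ → List Quat
  | 0 => [1]
  | 1 => [1, g]
  | n + 2 => mu g n

/-- The chain map from the resolution of `⟨i⟩` to the one of the quaternion group. -/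
def phiI : ∀ n, Fin (rk n) → List Quat
  | 0 => ![[1]]
  | 1 => ![[1], []]
  | 2 => ![[1, qj], [qz, qz * qi]]
  | 3 => ![[1, qk]]
  | n + 4 => phiI n

/-- The chain map from the resolution of `⟨j⟩` to the one of the quaternion group. -/
def phiJ : ∀ n, Fin (rk n) → List Quat
  | 0 => ![[1]]
  | 1 => ![[], [1]]
  | 2 => ![[1, qz * qj], [1, qi]]
  | 3 => ![[qj, qz * qk]]
  | n + 4 => phiJ n

/-- The chain map from the resolution of `⟨k⟩` to the one of the quaternion group. -/
def phiK : ∀ n, Fin (rk n) → List Quat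
  | 0 => ![[1]]
  | 1 => ![[qk], [1]]
  | 2 => ![[1, qk], [qj, qz]]
  | 3 => ![[qz, qz * qi]]
  | n + 4 => phiK n

/-- A homotopy between the chain maps through `⟨i⟩` and `⟨j⟩`. -/
def homIJ : ∀ n, Fin (rk (n + 1)) → List Quat
  | 0 => ![[], []]
  | 1 => ![[1], []]
  | 2 => ![[1, qi, qk, qz * qj]]
  | 3 => ![[]]
  | n + 4 => homIJ n

/-- A homotopy between the chain maps through `⟨i⟩` and `⟨k⟩`. -/
def homIK : ∀ n, Fin (rk (n + 1)) → List Quat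
  | 0 => ![[], []]
  | 1 => ![[qi], [1]]
  | 2 => ![[1, qk, qz * qi]]
  | 3 => ![[]]
  | n + 4 => homIK n

/-- A homotopy between the chain map through `⟨i⟩` and its translate by `j`. -/
def homJ : ∀ n, Fin (rk (n + 1)) → List Quat
  | 0 => ![[], [1]]
  | 1 => ![[1, qj], []]
  | 2 => ![[qk, qz * qj]]
  | 3 => ![[]]
  | n + 4 => homJ n

/-- By period 4 this, like the identities below, is a finite check in the group ring of the
quaternion group. -/
lemma dQuat_mul : ∀ n i, RowEq (lvecMul (dQuat (n + 1) i) (dQuat n)) (fun _ => [])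
  | 0 => by decide
  | 1 => by decide
  | 2 => by decide
  | 3 => by decide
  | n + 4 => dQuat_mul n

lemma dCyclic_mul_of {g : Quat} (hg : g * g = qz) :
    ∀ n, ListEq (lmul (dCyclic g (n + 1)) (dCyclic g n)) []
  | 0 => by revert g; decide
  | 1 => by revert g; decide
  | n + 2 => dCyclic_mul_of hg n

lemma mu_mul_dCyclic {g : Quat} (hg : g * g = qz) :
    ∀ n, ListEq (lmul (mu g (n + 1)) (dCyclic g n)) (lmul [1, qz] (mu g n))
  | 0 => by revert g; decide
  | 1 => by revert g; decide
  | n + 2 => mu_mul_dCyclic hg n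

lemma phiI_mul : ∀ n, RowEq (lvecMul (phiI (n + 1)) (dQuat n)) (lsmul (dCyclic qi n) (phiI n))
  | 0 => by decide
  | 1 => by decide
  | 2 => by decide
  | 3 => by decide
  | n + 4 => phiI_mul n

lemma phiJ_mul : ∀ n, RowEq (lvecMul (phiJ (n + 1)) (dQuat n)) (lsmul (dCyclic qj n) (phiJ n))
  | 0 => by decide
  | 1 => by decide
  | 2 => by decide
  | 3 => by decide
  | n + 4 => phiJ_mul n

lemma phiK_mul : ∀ n, RowEq (lvecMul (phiK (n + 1)) (dQuat n)) (lsmul (dCyclic qk n) (phiK n))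
  | 0 => by decide
  | 1 => by decide
  | 2 => by decide
  | 3 => by decide
  | n + 4 => phiK_mul n

lemma homIJ_zero : RowEq (lvecMul (homIJ 0) (dQuat 0))
    (ladd (lsmul (mu qi 0) (phiI 0)) (lsmul (mu qj 0) (phiJ 0))) := by decide

lemma homIK_zero : RowEq (lvecMul (homIK 0) (dQuat 0))
    (ladd (lsmul (mu qi 0) (phiI 0)) (lsmul (mu qk 0) (phiK 0))) := by decide

lemma homJ_zero : RowEq (lvecMul (homJ 0) (dQuat 0))
    (lsmul [1, qj] (lsmul (mu qi 0) (phiI 0))) := by decide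

/-- The two composites from the resolution of the center, through ⟨i⟩ and through ⟨j⟩, differ by d·h
+ h·d; the differential of the center is 1 + z. -/
lemma homIJ_succ : ∀ n, RowEq
    (ladd (lvecMul (homIJ (n + 1)) (dQuat (n + 1))) (lsmul [1, qz] (homIJ n)))
    (ladd (lsmul (mu qi (n + 1)) (phiI (n + 1))) (lsmul (mu qj (n + 1)) (phiJ (n + 1))))
  | 0 => by decide
  | 1 => by decide
  | 2 => by decide
  | 3 => by decide
  | n + 4 => homIJ_succ n

lemma homIK_succ : ∀ n, RowEq
    (ladd (lvecMul (homIK (n + 1)) (dQuat (n + 1))) (lsmul [1, qz] (homIK n)))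
    (ladd (lsmul (mu qi (n + 1)) (phiI (n + 1))) (lsmul (mu qk (n + 1)) (phiK (n + 1))))
  | 0 => by decide
  | 1 => by decide
  | 2 => by decide
  | 3 => by decide
  | n + 4 => homIK_succ n

lemma homJ_succ : ∀ n, RowEq
    (ladd (lvecMul (homJ (n + 1)) (dQuat (n + 1))) (lsmul [1, qz] (homJ n)))
    (lsmul [1, qj] (lsmul (mu qi (n + 1)) (phiI (n + 1))))
  | 0 => by decide
  | 1 => by decide
  | 2 => by decide
  | 3 => by decide
  | n + 4 => homJ_succ n

end QuaternionResolution

/-! ### Contractions and exactness of the induced resolutions. -/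

namespace QuaternionResolution

open MonoidAlgebra GroupRing QuaternionGroup

/-- The function given by a table: the entry `((i, q), l, L)` means that `L` is the component `l`
of the image of the basis element `q` of the component `i`. -/
def ofTable (t : List ((ℕ × Quat) × ℕ × List Quat)) {m n : ℕ} (i : Fin m) (q : Quat) (l : Fin n) :
    List Quat :=
  (t.filter fun e => e.1 = (i.val, q) ∧ e.2.1 = l.val).flatMap fun e => e.2.2

/-- A contraction of the periodic free resolution of the quaternion group. -/
def contr : ∀ n, Fin (rk n) → Quat → Fin (rk (n + 1)) → List Quat
  | 0 => ofTable
      [((0, qi), 0, [1]), ((0, qz), 0, [1, qi]), ((0, qz * qi), 0, [1, qi, qz]),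
      ((0, qj), 1, [1]), ((0, qz * qk), 0, [qj]), ((0, qz * qk), 1, [1]),
      ((0, qz * qj), 0, [qj, qz * qk]), ((0, qz * qj), 1, [1]),
      ((0, qk), 0, [qj, qz * qk, qz * qj]), ((0, qk), 1, [1])]
  | 1 => ofTable
      [((0, qz * qi), 0, [qz, qz * qj]), ((0, qz * qi), 1, [1, qi]), ((0, qk), 0, [1, qj]),
      ((0, qk), 1, [1, qi]), ((1, qi), 0, [1, qj]), ((1, qi), 1, [qi]), ((1, qz), 0, [1, qj]),
      ((1, qz * qi), 0, [1, qz, qz * qi, qj, qz * qk, qz * qj]), ((1, qz * qi), 1, [1]),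
      ((1, qj), 0, [1]), ((1, qz * qk), 0, [1, qj, qz * qk]), ((1, qz * qk), 1, [qi]),
      ((1, qz * qj), 0, [1, qj, qz * qj]), ((1, qz * qj), 1, [1, qi]), ((1, qk), 0, [1, qi, qj]),
      ((1, qk), 1, [qi])]
  | 2 => ofTable
      [((0, qk), 0, [qi, qz * qi, qj, qz * qj]), ((1, qz), 0, [qz, qz * qk]),
      ((1, qz * qi), 0, [qz * qi, qj]), ((1, qj), 0, [qj]), ((1, qz * qk), 0, [qz * qk]),
      ((1, qz * qj), 0, [qi]), ((1, qk), 0, [1])]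
  | 3 => ofTable
      [((0, qk), 0, [1])]
  | n + 4 => contr n

/-- A contraction of the periodic free resolution of the group `⟨i⟩`. -/
def contrI : ℕ → Fin 1 → Quat → Fin 1 → List Quat
  | 0 => ofTable
      [((0, qi), 0, [1]), ((0, qz), 0, [1, qi]), ((0, qz * qi), 0, [1, qi, qz]),
      ((0, qz * qk), 0, [qj]), ((0, qz * qj), 0, [qj, qz * qk]),
      ((0, qk), 0, [qj, qz * qk, qz * qj])]
  | 1 => ofTable
      [((0, qz * qi), 0, [1]), ((0, qk), 0, [qj])]
  | n + 2 => contrI n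

/-- A contraction of the periodic free resolution of the group `⟨j⟩`. -/
def contrJ : ℕ → Fin 1 → Quat → Fin 1 → List Quat
  | 0 => ofTable
      [((0, qz), 0, [1, qj]), ((0, qz * qi), 0, [qz * qi, qz * qk]), ((0, qj), 0, [1]),
      ((0, qz * qk), 0, [qz * qk]), ((0, qz * qj), 0, [1, qz, qj]), ((0, qk), 0, [qi])]
  | 1 => ofTable
      [((0, qz * qj), 0, [1]), ((0, qk), 0, [qi])]
  | n + 2 => contrJ n

/-- A contraction of the periodic free resolution of the center. -/
def contrZ : Fin 1 → Quat → Fin 1 → List Quat := ofTable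
      [((0, qz), 0, [1]), ((0, qz * qi), 0, [qi]), ((0, qz * qj), 0, [qj]),
      ((0, qk), 0, [qz * qk])]

variable {G : Type} [Group G] {ψ : Quat →* G}

lemma contr_eq : ∀ n i q j, ListEq (if i = j then [q] else [])
    (lvecMul (contr (n + 1) i q) (dQuat (n + 1)) j ++ (List.finRange (rk n)).flatMap fun l =>
      (dQuat n i l).flatMap fun r => contr n l (q * r) j)
  | 0 => by decide
  | 1 => by decide
  | 2 => by decide
  | 3 => by decide
  | n + 4 => contr_eq n

lemma exact_dQuat (hψ : Function.Injective ψ) (n : ℕ) {x : Fin (rk (n + 1)) → (ZMod 2)[G]}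
    (hx : Matrix.vecMul x ((dQuat n).map (ofList ψ)) = 0) :
    ∃ y, Matrix.vecMul y ((dQuat (n + 1)).map (ofList ψ)) = x :=
  exact_of_contraction hψ (contr (n + 1)) (contr n) (contr_eq n) hx

/-- A one by one matrix. -/
def oneMat (L : List Quat) : Matrix (Fin 1) (Fin 1) (List Quat) := fun _ _ => L

lemma exact_oneMat (hψ : Function.Injective ψ) {L M : List Quat}
    (s t : Fin 1 → Quat → Fin 1 → List Quat)
    (h : ∀ i q j, ListEq (if i = j then [q] else [])
      (lvecMul (s i q) (oneMat L) j ++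
      (List.finRange 1).flatMap fun l => (oneMat M i l).flatMap fun r => t l (q * r) j))
    {x : (ZMod 2)[G]} (hx : x * ofList ψ M = 0) : ∃ y, y * ofList ψ L = x := by
  obtain ⟨y, hy⟩ := exact_of_contraction hψ (A := oneMat L) (B := oneMat M) s t h
    (x := fun _ => x) (by funext i; simpa [Matrix.vecMul, dotProduct, oneMat] using hx)
  exact ⟨y 0, by simpa [Matrix.vecMul, dotProduct, oneMat] using congrFun hy 0⟩

lemma contrI_eq : ∀ n i q j, ListEq (if i = j then [q] else [])
    (lvecMul (contrI (n + 1) i q) (oneMat (dCyclic qi (n + 1))) j ++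
      (List.finRange 1).flatMap fun l =>
      (oneMat (dCyclic qi n) i l).flatMap fun r => contrI n l (q * r) j)
  | 0 => by decide
  | 1 => by decide
  | n + 2 => contrI_eq n

lemma exact_dCyclic_qi (hψ : Function.Injective ψ) (n : ℕ) {x : (ZMod 2)[G]}
    (hx : x * ofList ψ (dCyclic qi n) = 0) : ∃ y, y * ofList ψ (dCyclic qi (n + 1)) = x :=
  exact_oneMat hψ (contrI (n + 1)) (contrI n) (contrI_eq n) hx

lemma contrJ_eq : ∀ n i q j, ListEq (if i = j then [q] else [])
    (lvecMul (contrJ (n + 1) i q) (oneMat (dCyclic qj (n + 1))) j ++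
      (List.finRange 1).flatMap fun l =>
      (oneMat (dCyclic qj n) i l).flatMap fun r => contrJ n l (q * r) j)
  | 0 => by decide
  | 1 => by decide
  | n + 2 => contrJ_eq n

lemma exact_dCyclic_qj (hψ : Function.Injective ψ) (n : ℕ) {x : (ZMod 2)[G]}
    (hx : x * ofList ψ (dCyclic qj n) = 0) : ∃ y, y * ofList ψ (dCyclic qj (n + 1)) = x :=
  exact_oneMat hψ (contrJ (n + 1)) (contrJ n) (contrJ_eq n) hx

lemma exact_one_add_qz (hψ : Function.Injective ψ) {x : (ZMod 2)[G]}
    (hx : x * ofList ψ [1, qz] = 0) : ∃ y, y * ofList ψ [1, qz] = x :=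
  exact_oneMat hψ contrZ contrZ (by decide) hx

end QuaternionResolution

noncomputable section

open MonoidAlgebra GroupRing QuaternionResolution Matrix

/-! ### The stabilizers in the congruence subgroup and the blocks of the total complex. -/

namespace BianchiTwo

/-- The map from the quaternion group given by the images of `i` and `j`. -/
def quatFun (x y : SL2) : Quat → SL2
  | .a n => x ^ n.val
  | .xa n => y * x ^ n.val

/-- The quaternion subgroup generated by `matI` and `matW`. -/
def quatW : Quat →* Gamma0SqrtNegTwo :=
  MonoidHom.codRestrict
    { toFun := quatFun matI matW
      map_one' := by decide +kernel
      map_mul' := by decide +kernel } _ (by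
        intro q
        rw [mem_gamma0_iff]
        revert q
        decide +kernel)

/-- The quaternion subgroup generated by `matI` and `matR`. -/
def quatR : Quat →* Gamma0SqrtNegTwo :=
  MonoidHom.codRestrict
    { toFun := quatFun matI matR
      map_one' := by decide +kernel
      map_mul' := by decide +kernel } _ (by
        intro q
        rw [mem_gamma0_iff]
        revert q
        decide +kernel)

lemma quatW_injective : Function.Injective quatW := by
  have : ∀ p q, quatFun matI matW p = quatFun matI matW q → p = q := by decide +kernel
  exact fun p q h => this p q (congrArg Subtype.val h)

lemma quatR_injective : Function.Injective quatR := by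
  have : ∀ p q, quatFun matI matR p = quatFun matI matR q → p = q := by decide +kernel
  exact fun p q h => this p q (congrArg Subtype.val h)

@[simp] lemma coe_quatW_qi : (quatW qi : SL2) = matI := by
  change quatFun matI matW qi = _; decide +kernel
@[simp] lemma coe_quatW_qj : (quatW qj : SL2) = matW := by
  change quatFun matI matW qj = _; decide +kernel
@[simp] lemma coe_quatW_qk : (quatW qk : SL2) = matI * matW := by
  change quatFun matI matW qk = _; decide +kernel
@[simp] lemma coe_quatW_qz : (quatW qz : SL2) = -1 := by
  change quatFun matI matW qz = _; decide +kernel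
@[simp] lemma coe_quatR_qi : (quatR qi : SL2) = matI := by
  change quatFun matI matR qi = _; decide +kernel
@[simp] lemma coe_quatR_qj : (quatR qj : SL2) = matR := by
  change quatFun matI matR qj = _; decide +kernel
@[simp] lemma coe_quatR_qk : (quatR qk : SL2) = matI * matR := by
  change quatFun matI matR qk = _; decide +kernel
@[simp] lemma coe_quatR_qz : (quatR qz : SL2) = -1 := by
  change quatFun matI matR qz = _; decide +kernel

/-- The element `matT` of the congruence subgroup. -/
def gT : Gamma0SqrtNegTwo := ⟨matT, by simp [mem_gamma0_iff]⟩
/-- The element `matU` of the congruence subgroup. -/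
def gU : Gamma0SqrtNegTwo := ⟨matU, by simp [mem_gamma0_iff]⟩

@[simp] lemma coe_gT : (gT : SL2) = matT := rfl
@[simp] lemma coe_gU : (gU : SL2) = matU := rfl

lemma quatW_qi : quatW qi = quatR qi := Subtype.ext (by simp)
lemma quatW_qz : quatW qz = quatR qz := Subtype.ext (by simp)

/-- W is the conjugate by T of an element of the first vertex group, so it fixes the far end of the
second edge too; this is where the chain map for ⟨k⟩ enters. -/
lemma quatW_mul_gT : quatW qj * gT = gT * quatW qk := Subtype.ext (by simp [matW_mul_matT])

lemma gT_mul_gU : gT * gU = gU * gT := Subtype.ext (by simp [matT_mul_matU])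

/-- The element `matU * matW * matR` of the congruence subgroup. -/
def gV : Gamma0SqrtNegTwo := gU * quatW qj * quatR qj

/-- The same for R and the far end of the third edge. -/
lemma quatR_mul_gV : quatR qj * gV = gV * quatR qk := Subtype.ext (by simp [gV, matR_mul_conj])

lemma quatR_qz_mul (g : Gamma0SqrtNegTwo) : quatR qz * g = g * quatR qz := Subtype.ext (by simp)

/-- The group ring of the congruence subgroup. -/
abbrev Ring2 := (ZMod 2)[Gamma0SqrtNegTwo]

/-- The sum of the elements of the center. -/
def zz : Ring2 := 1 + el (quatR qz)

lemma ofList_quatR_z : ofList quatR [1, qz] = zz := by simp [zz, el_one]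
lemma ofList_quatW_z : ofList quatW [1, qz] = zz := by simp [zz, el_one, quatW_qz]

lemma zz_mul (x : Ring2) : zz * x = x * zz := by
  induction x using induction_el with
  | zero => simp
  | add x y hx hy => rw [mul_add, add_mul, hx, hy]
  | el g => rw [zz, add_mul, mul_add, ← el_mul, ← el_mul, quatR_qz_mul, one_mul, mul_one]

lemma zz_smul_smul {n : ℕ} (x : Ring2) (v : Fin n → Ring2) : zz • x • v = x • zz • v := by
  rw [smul_smul, smul_smul, zz_mul]

section twist

variable {G : Type} [Group G] {ψ : Quat →* G} {t : G} {p q : Quat}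

lemma ofList_dCyclic_mul_el (h : ψ p * t = t * ψ q) :
    ∀ n, ofList ψ (dCyclic p n) * el t = el t * ofList ψ (dCyclic q n)
  | 0 => by
    simp only [dCyclic, ofList_cons, ofList_nil, add_zero, add_mul, mul_add, ← el_mul, h, map_one,
      one_mul, mul_one]
  | 1 => by
    have h2 : ψ (p * p) * t = t * ψ (q * q) := by
      rw [map_mul, mul_assoc, h, ← mul_assoc, h, mul_assoc, map_mul]
    have h3 : ψ (p * p * p) * t = t * ψ (q * q * q) := by
      rw [map_mul, mul_assoc, h, ← mul_assoc, h2, mul_assoc, ← map_mul]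
    simp only [dCyclic, ofList_cons, ofList_nil, add_zero, add_mul, mul_add, ← el_mul, h, h2, h3,
      map_one, one_mul, mul_one]
  | n + 2 => ofList_dCyclic_mul_el h n

lemma ofList_mu_mul_el (h : ψ p * t = t * ψ q) :
    ∀ n, ofList ψ (mu p n) * el t = el t * ofList ψ (mu q n)
  | 0 => by
    simp only [mu, ofList_cons, ofList_nil, add_zero, ← el_mul, map_one, one_mul, mul_one]
  | 1 => by
    simp only [mu, ofList_cons, ofList_nil, add_zero, add_mul, mul_add, ← el_mul, h, map_one,
      one_mul, mul_one]
  | n + 2 => ofList_mu_mul_el h n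

end twist

lemma ofList_dCyclic_qi : ∀ n, ofList quatR (dCyclic qi n) = ofList quatW (dCyclic qi n)
  | 0 => by simp [dCyclic, quatW_qi]
  | 1 => by simp only [dCyclic, ofList_cons, ofList_nil, map_mul, map_one, quatW_qi]
  | n + 2 => ofList_dCyclic_qi n

lemma ofList_mu_qi : ∀ n, ofList quatR (mu qi n) = ofList quatW (mu qi n)
  | 0 => by simp [mu]
  | 1 => by simp [mu, quatW_qi]
  | n + 2 => ofList_mu_qi n

/-- The differential of the resolutions of the vertex stabilizers. -/
def dVertex (n : ℕ) : Matrix (Fin (rk (n + 1)) ⊕ Fin (rk (n + 1))) (Fin (rk n) ⊕ Fin (rk n)) Ring2 :=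
  fromBlocks ((dQuat n).map (ofList quatW)) 0 0 ((dQuat n).map (ofList quatR))

/-- The diagonal of the differential of the resolutions of the edge stabilizers. -/
def edgeDiff (n : ℕ) : Fin 3 → Ring2 :=
  ![ofList quatW (dCyclic qi n), ofList quatW (dCyclic qj n), ofList quatR (dCyclic qj n)]

/-- The boundary from the edges to the vertices. -/
def edgeVertex (n : ℕ) : Matrix (Fin 3) (Fin (rk n) ⊕ Fin (rk n)) Ring2 :=
  .of ![Sum.elim (row quatW (phiI n)) (row quatR (phiI n)),
    Sum.elim (row quatW (phiJ n) + el gT • row quatW (phiK n)) 0,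
    Sum.elim 0 (row quatR (phiJ n) + el gV • row quatR (phiK n))]

/-- The boundary from the face to the edges. -/
def faceEdge (n : ℕ) : Fin 3 → Ring2 :=
  ![(1 + el gT) * (1 + el gU * el (quatW qj)) * ofList quatW (mu qi n),
      (1 + el gU) * ofList quatW (mu qj n), (1 + el gT) * ofList quatR (mu qj n)]

/-- The homotopy from the face to the first vertex. -/
def faceVertexW (n : ℕ) : Fin (rk (n + 1)) → Ring2 :=
  (1 + el gU) • (row quatW (homIJ n) + el gT • row quatW (homIK n)) +
    (el gU * (1 + el gT)) • row quatW (homJ n)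

/-- The homotopy from the face to the second vertex. -/
def faceVertexR (n : ℕ) : Fin (rk (n + 1)) → Ring2 :=
  (1 + el gT) • (row quatR (homIJ n) + (el gU * el (quatW qj)) •
    (row quatR (homJ n) + el (quatR qj) • row quatR (homIK n)))

/-- The homotopy from the face to the vertices. -/
def faceVertex (n : ℕ) : Fin (rk (n + 1)) ⊕ Fin (rk (n + 1)) → Ring2 :=
  Sum.elim (faceVertexW n) (faceVertexR n)

section rows

variable {G : Type} [Group G] (ψ : Quat →* G)

lemma row_dQuat_mul (n : ℕ) : (dQuat (n + 1)).map (ofList ψ) * (dQuat n).map (ofList ψ) = 0 := by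
  ext1 i j
  have h := congrFun (row_congr ψ (dQuat_mul n i)) j
  rw [row_lvecMul] at h
  exact h

lemma row_phiI_mul (n : ℕ) : row ψ (phiI (n + 1)) ᵥ* (dQuat n).map (ofList ψ) =
    ofList ψ (dCyclic qi n) • row ψ (phiI n) := by
  rw [← row_lvecMul, row_congr ψ (phiI_mul n), row_lsmul]

lemma row_phiJ_mul (n : ℕ) : row ψ (phiJ (n + 1)) ᵥ* (dQuat n).map (ofList ψ) =
    ofList ψ (dCyclic qj n) • row ψ (phiJ n) := by
  rw [← row_lvecMul, row_congr ψ (phiJ_mul n), row_lsmul]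

lemma row_phiK_mul (n : ℕ) : row ψ (phiK (n + 1)) ᵥ* (dQuat n).map (ofList ψ) =
    ofList ψ (dCyclic qk n) • row ψ (phiK n) := by
  rw [← row_lvecMul, row_congr ψ (phiK_mul n), row_lsmul]

lemma row_homIJ_zero : row ψ (homIJ 0) ᵥ* (dQuat 0).map (ofList ψ) =
    ofList ψ (mu qi 0) • row ψ (phiI 0) + ofList ψ (mu qj 0) • row ψ (phiJ 0) := by
  rw [← row_lvecMul, row_congr ψ homIJ_zero, row_ladd, row_lsmul, row_lsmul]

lemma row_homIK_zero : row ψ (homIK 0) ᵥ* (dQuat 0).map (ofList ψ) =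
    ofList ψ (mu qi 0) • row ψ (phiI 0) + ofList ψ (mu qk 0) • row ψ (phiK 0) := by
  rw [← row_lvecMul, row_congr ψ homIK_zero, row_ladd, row_lsmul, row_lsmul]

lemma row_homJ_zero : row ψ (homJ 0) ᵥ* (dQuat 0).map (ofList ψ) =
    (1 + el (ψ qj)) • ofList ψ (mu qi 0) • row ψ (phiI 0) := by
  rw [← row_lvecMul, row_congr ψ homJ_zero, row_lsmul, row_lsmul]
  simp [el_one]

lemma row_homIJ_succ (n : ℕ) : row ψ (homIJ (n + 1)) ᵥ* (dQuat (n + 1)).map (ofList ψ) +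
    ofList ψ [1, qz] • row ψ (homIJ n) =
    ofList ψ (mu qi (n + 1)) • row ψ (phiI (n + 1)) +
      ofList ψ (mu qj (n + 1)) • row ψ (phiJ (n + 1)) := by
  rw [← row_lvecMul, ← row_lsmul, ← row_lsmul, ← row_lsmul, ← row_ladd, ← row_ladd,
    row_congr ψ (homIJ_succ n)]

lemma row_homIK_succ (n : ℕ) : row ψ (homIK (n + 1)) ᵥ* (dQuat (n + 1)).map (ofList ψ) +
    ofList ψ [1, qz] • row ψ (homIK n) =
    ofList ψ (mu qi (n + 1)) • row ψ (phiI (n + 1)) +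
      ofList ψ (mu qk (n + 1)) • row ψ (phiK (n + 1)) := by
  rw [← row_lvecMul, ← row_lsmul, ← row_lsmul, ← row_lsmul, ← row_ladd, ← row_ladd,
    row_congr ψ (homIK_succ n)]

lemma row_homJ_succ (n : ℕ) : row ψ (homJ (n + 1)) ᵥ* (dQuat (n + 1)).map (ofList ψ) +
    ofList ψ [1, qz] • row ψ (homJ n) =
    (1 + el (ψ qj)) • ofList ψ (mu qi (n + 1)) • row ψ (phiI (n + 1)) := by
  rw [← row_lvecMul, ← row_lsmul, ← row_lsmul, ← row_ladd, row_congr ψ (homJ_succ n), row_lsmul]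
  simp [el_one]

end rows

section charTwo

lemma two_zsmul_module (R : Type) {M : Type} [Ring R] [CharP R 2] [AddCommGroup M] [Module R M]
    (x : M) : (2 : ℤ) • x = 0 := by
  rw [← Int.cast_smul_eq_zsmul R, Int.cast_ofNat, CharTwo.two_eq_zero, zero_smul]

variable {R M : Type} [Ring R] [CharP R 2] [AddCommGroup M] [Module R M]

/-- The boundary of the face cancels at the first vertex: a, b, c stand for the composites through
⟨i⟩, ⟨j⟩, ⟨k⟩, and the sums a + b, a + c, (1 + j)a are those realized by the three homotopies. The
next lemma is the analogue at the second vertex. -/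
lemma square_relation_left {U T : R} (j : R) (h : T * U = U * T) (a b c : M) :
    (1 + U) • (a + b + T • (a + c)) + (U * (1 + T)) • (1 + j) • a +
      (((1 + T) * (1 + U * j)) • a + (1 + U) • (b + T • c)) = 0 := by
  simp only [smul_add, add_smul, one_smul, smul_smul, mul_add, add_mul, mul_one, one_mul,
    ← mul_assoc, h]
  abel_nf
  simp [two_zsmul_module R]

lemma square_relation_right (T u j : R) (a b c : M) :
    (1 + T) • (a + b + u • ((1 + j) • a + j • (a + c))) +
      (((1 + T) * (1 + u)) • a + (1 + T) • (b + (u * j) • c)) = 0 := by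
  simp only [smul_add, add_smul, one_smul, smul_smul, mul_add, add_mul, mul_one, one_mul,
    ← mul_assoc]
  abel_nf
  simp [two_zsmul_module R]

end charTwo

/-! ### The differential of the total complex squares to zero. -/

section identities

lemma dVertex_mul (n : ℕ) : dVertex (n + 1) * dVertex n = 0 := by
  simp [dVertex, fromBlocks_multiply, row_dQuat_mul]

lemma ofList_dCyclic_mul {G : Type} [Group G] (ψ : Quat →* G) {g : Quat} (hg : g * g = qz)
    (n : ℕ) : ofList ψ (dCyclic g (n + 1)) * ofList ψ (dCyclic g n) = 0 := by
  rw [← ofList_lmul, ofList_congr ψ (dCyclic_mul_of hg n), ofList_nil]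

lemma edgeDiff_mul (n : ℕ) : diagonal (edgeDiff (n + 1)) * diagonal (edgeDiff n) = 0 := by
  rw [diagonal_mul_diagonal, diagonal_eq_zero]
  funext i
  fin_cases i
  · exact ofList_dCyclic_mul _ (by decide) n
  · exact ofList_dCyclic_mul _ (by decide) n
  · exact ofList_dCyclic_mul _ (by decide) n

lemma zz_mul_self : zz * zz = 0 := by
  rw [← ofList_quatR_z, ← ofList_lmul, ofList_congr quatR (M := []) (by decide), ofList_nil]

lemma row_add_mul (n : ℕ) (ψ : Quat →* Gamma0SqrtNegTwo) {g : Gamma0SqrtNegTwo}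
    (h : ψ qj * g = g * ψ qk) :
    (row ψ (phiJ (n + 1)) + el g • row ψ (phiK (n + 1))) ᵥ* (dQuat n).map (ofList ψ) =
    ofList ψ (dCyclic qj n) • (row ψ (phiJ n) + el g • row ψ (phiK n)) := by
  rw [add_vecMul, smul_vecMul, row_phiJ_mul, row_phiK_mul, smul_add, smul_smul, smul_smul,
    ofList_dCyclic_mul_el h]

lemma elim_vecMul_dVertex (n : ℕ) (v w : Fin (rk (n + 1)) → Ring2) :
    Sum.elim v w ᵥ* dVertex n =
      Sum.elim (v ᵥ* (dQuat n).map (ofList quatW)) (w ᵥ* (dQuat n).map (ofList quatR)) := by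
  simp [dVertex, vecMul_fromBlocks]

lemma smul_elim {m n : ℕ} (x : Ring2) (v : Fin m → Ring2) (w : Fin n → Ring2) :
    x • Sum.elim v w = Sum.elim (x • v) (x • w) := by
  funext i; rcases i with i | i <;> rfl

lemma edgeVertex_vecMul (n : ℕ) (i : Fin 3) :
    edgeVertex (n + 1) i ᵥ* dVertex n = edgeDiff n i • edgeVertex n i := by
  fin_cases i
  · change Sum.elim _ _ ᵥ* _ = ofList quatW (dCyclic qi n) • Sum.elim _ _
    rw [elim_vecMul_dVertex, smul_elim, row_phiI_mul, row_phiI_mul, ofList_dCyclic_qi]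
  · change Sum.elim _ _ ᵥ* _ = ofList quatW (dCyclic qj n) • Sum.elim _ _
    rw [elim_vecMul_dVertex, smul_elim, row_add_mul n quatW quatW_mul_gT, zero_vecMul, smul_zero]
  · change Sum.elim _ _ ᵥ* _ = ofList quatR (dCyclic qj n) • Sum.elim _ _
    rw [elim_vecMul_dVertex, smul_elim, row_add_mul n quatR quatR_mul_gV, zero_vecMul, smul_zero]

lemma edgeVertex_mul (n : ℕ) :
    edgeVertex (n + 1) * dVertex n + diagonal (edgeDiff n) * edgeVertex n = 0 := by
  ext1 i j
  rw [Matrix.add_apply, diagonal_mul]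
  have := congrFun (edgeVertex_vecMul n i) j
  change (edgeVertex (n + 1) i ᵥ* dVertex n) j + (edgeDiff n i • edgeVertex n i) j = 0
  rw [this, CharTwo.add_self_eq_zero]

lemma faceEdge_vecMul (n : ℕ) : faceEdge (n + 1) ᵥ* diagonal (edgeDiff n) + zz • faceEdge n = 0 := by
  have key : ∀ (ψ : Quat →* Gamma0SqrtNegTwo) (x : Ring2) {g : Quat}, g * g = qz →
      ofList ψ [1, qz] = zz → x * ofList ψ (mu g (n + 1)) * ofList ψ (dCyclic g n) +
        zz * (x * ofList ψ (mu g n)) = 0 := by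
    intro ψ x g hg hz
    rw [mul_assoc, ← ofList_lmul, ofList_congr ψ (mu_mul_dCyclic hg n), ofList_lmul, hz,
      ← mul_assoc, ← mul_assoc, zz_mul, CharTwo.add_self_eq_zero]
  funext i
  rw [Pi.add_apply, vecMul_diagonal]
  fin_cases i
  · exact key quatW _ (by decide) ofList_quatW_z
  · exact key quatW _ (by decide) ofList_quatW_z
  · exact key quatR _ (by decide) ofList_quatR_z

/-- Moving `mu qj` past T and V turns it into `mu qk`, which brings the boundary into the shape of
the two square relations. -/
lemma faceEdge_vecMul_edgeVertex (n : ℕ) : faceEdge n ᵥ* edgeVertex n = Sum.elim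
    (((1 + el gT) * (1 + el gU * el (quatW qj))) • ofList quatW (mu qi n) • row quatW (phiI n) +
      (1 + el gU) • (ofList quatW (mu qj n) • row quatW (phiJ n) +
        el gT • ofList quatW (mu qk n) • row quatW (phiK n)))
    (((1 + el gT) * (1 + el gU * el (quatW qj))) • ofList quatR (mu qi n) • row quatR (phiI n) +
      (1 + el gT) • (ofList quatR (mu qj n) • row quatR (phiJ n) +
        (el gU * el (quatW qj) * el (quatR qj)) • ofList quatR (mu qk n) • row quatR (phiK n))) := by
  have h1 := ofList_mu_mul_el quatW_mul_gT n
  have h2 := ofList_mu_mul_el quatR_mul_gV n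
  have h3 : el gV = el gU * el (quatW qj) * el (quatR qj) := by rw [gV, el_mul, el_mul]
  rw [← h3, smul_smul (el gV), smul_smul (el gT), ← h1, ← h2, ofList_mu_qi]
  funext i
  rcases i with i | i
  · simp [vecMul, dotProduct, Fin.sum_univ_three, faceEdge, edgeVertex, mul_add, mul_assoc]
  · simp [vecMul, dotProduct, Fin.sum_univ_three, faceEdge, edgeVertex, mul_add, mul_assoc]

lemma faceVertex_zero : faceVertex 0 ᵥ* dVertex 0 + faceEdge 0 ᵥ* edgeVertex 0 = 0 := by
  have hTU : el gT * el gU = el gU * el gT := by rw [← el_mul, gT_mul_gU, el_mul]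
  rw [faceVertex, elim_vecMul_dVertex, faceEdge_vecMul_edgeVertex, ← Sum.elim_add_add]
  have h1 := square_relation_left (el (quatW qj)) hTU (ofList quatW (mu qi 0) • row quatW (phiI 0))
    (ofList quatW (mu qj 0) • row quatW (phiJ 0)) (ofList quatW (mu qk 0) • row quatW (phiK 0))
  have h2 := square_relation_right (el gT) (el gU * el (quatW qj)) (el (quatR qj))
    (ofList quatR (mu qi 0) • row quatR (phiI 0))
    (ofList quatR (mu qj 0) • row quatR (phiJ 0)) (ofList quatR (mu qk 0) • row quatR (phiK 0))
  simp only [faceVertexW, faceVertexR, add_vecMul, smul_vecMul, row_homIJ_zero, row_homIK_zero,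
    row_homJ_zero]
  rw [h1, h2, Sum.elim_zero_zero]

lemma faceVertex_succ (n : ℕ) : faceVertex (n + 1) ᵥ* dVertex (n + 1) +
    (faceEdge (n + 1) ᵥ* edgeVertex (n + 1) + zz • faceVertex n) = 0 := by
  have hTU : el gT * el gU = el gU * el gT := by rw [← el_mul, gT_mul_gU, el_mul]
  rw [add_comm (faceEdge (n + 1) ᵥ* _), ← add_assoc, faceVertex, faceVertex, elim_vecMul_dVertex,
    faceEdge_vecMul_edgeVertex, smul_elim, ← Sum.elim_add_add, ← Sum.elim_add_add]
  have h1 := square_relation_left (el (quatW qj)) hTU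
    (ofList quatW (mu qi (n + 1)) • row quatW (phiI (n + 1)))
    (ofList quatW (mu qj (n + 1)) • row quatW (phiJ (n + 1)))
    (ofList quatW (mu qk (n + 1)) • row quatW (phiK (n + 1)))
  have h2 := square_relation_right (el gT) (el gU * el (quatW qj)) (el (quatR qj))
    (ofList quatR (mu qi (n + 1)) • row quatR (phiI (n + 1)))
    (ofList quatR (mu qj (n + 1)) • row quatR (phiJ (n + 1)))
    (ofList quatR (mu qk (n + 1)) • row quatR (phiK (n + 1)))
  have hl : faceVertexW (n + 1) ᵥ* (dQuat (n + 1)).map (ofList quatW) + zz • faceVertexW n =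
      (1 + el gU) • (ofList quatW (mu qi (n + 1)) • row quatW (phiI (n + 1)) +
        ofList quatW (mu qj (n + 1)) • row quatW (phiJ (n + 1)) +
        el gT • (ofList quatW (mu qi (n + 1)) • row quatW (phiI (n + 1)) +
          ofList quatW (mu qk (n + 1)) • row quatW (phiK (n + 1)))) +
      (el gU * (1 + el gT)) • (1 + el (quatW qj)) •
        ofList quatW (mu qi (n + 1)) • row quatW (phiI (n + 1)) := by
    rw [← row_homIJ_succ, ← row_homIK_succ, ← row_homJ_succ]
    simp only [faceVertexW, add_vecMul, smul_vecMul, ofList_quatW_z, zz_smul_smul, smul_add]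
    abel
  have hr : faceVertexR (n + 1) ᵥ* (dQuat (n + 1)).map (ofList quatR) + zz • faceVertexR n =
      (1 + el gT) • (ofList quatR (mu qi (n + 1)) • row quatR (phiI (n + 1)) +
        ofList quatR (mu qj (n + 1)) • row quatR (phiJ (n + 1)) +
        (el gU * el (quatW qj)) • ((1 + el (quatR qj)) •
          ofList quatR (mu qi (n + 1)) • row quatR (phiI (n + 1)) +
          el (quatR qj) • (ofList quatR (mu qi (n + 1)) • row quatR (phiI (n + 1)) +
            ofList quatR (mu qk (n + 1)) • row quatR (phiK (n + 1))))) := by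
    rw [← row_homIJ_succ, ← row_homIK_succ, ← row_homJ_succ]
    simp only [faceVertexR, add_vecMul, smul_vecMul, ofList_quatR_z, zz_smul_smul, smul_add]
    abel
  rw [hl, hr, h1, h2, Sum.elim_zero_zero]

end identities

end BianchiTwo

end

noncomputable section

open MonoidAlgebra GroupRing QuaternionResolution Matrix

namespace BianchiTwo

/-! ### Cellular exactness by pairing with sides of planes. -/

section sides

/-- The indicator function on the congruence subgroup of a translate of a set of matrices. -/
def side (P : SL2 → Prop) (γ g : Gamma0SqrtNegTwo) : ZMod 2 := ind (P (γ⁻¹ * g : Gamma0SqrtNegTwo))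

lemma pairing_side_flip {P P' : SL2 → Prop} {h : Gamma0SqrtNegTwo}
    (hP : ∀ g ∈ Gamma0SqrtNegTwo, ind (P g) + ind (P (g * h)) = ind (P' g))
    (γ : Gamma0SqrtNegTwo) (x : Ring2) :
    pairing (side P γ) (x * (1 + el h)) = pairing (side P' γ) x :=
  pairing_mul_one_add (fun g => by
    rw [side, side, side, ← hP _ (γ⁻¹ * g).2, ← mul_assoc]
    rfl) x

lemma pairing_zero (x : Ring2) : pairing (fun _ => 0) x = 0 := by
  induction x using induction_el with
  | zero => simp
  | add x y hx hy => rw [map_add, hx, hy, add_zero]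
  | el g => simp

lemma pairing_side_inv {P : SL2 → Prop} {h : Gamma0SqrtNegTwo}
    (hP : ∀ g ∈ Gamma0SqrtNegTwo, P (g * h) ↔ P g) (γ : Gamma0SqrtNegTwo) (x : Ring2) :
    pairing (side P γ) (x * (1 + el h)) = 0 := by
  rw [pairing_side_flip (P' := fun _ => False) fun g hg => ?_]
  · have : side (fun _ => False) γ = fun _ => 0 := funext fun g => ind_false id
    rw [this, pairing_zero]
  · rw [ind_add_self (hP g hg).symm, ind_false id]

lemma coeff_ofList {G Q : Type} [Group G] [Group Q] {ψ : Q →* G} (hψ : Function.Injective ψ)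
    {L : List Q} (hL : L.Nodup) (g : G) : (ofList ψ L).coeff g = ind (g ∈ L.map ψ) := by
  classical
  induction L with
  | nil => simp [ind]
  | cons q L ih =>
    obtain ⟨h1, h2⟩ := List.nodup_cons.1 hL
    rw [ofList_cons, coeff_add, Finsupp.add_apply, ih h2, el, coeff_single, Finsupp.single_apply]
    by_cases h : ψ q = g
    · subst h
      have : ψ q ∉ L.map ψ := by
        rw [List.mem_map]
        rintro ⟨p, hp, hpq⟩
        exact h1 (hψ hpq ▸ hp)
      rw [if_pos rfl, ind_false this, ind_true (by simp), add_zero]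
    · rw [if_neg h, zero_add]
      refine ind_congr ?_
      rw [List.map_cons, List.mem_cons]
      exact ⟨Or.inr, fun h' => h'.resolve_left (Ne.symm h)⟩

/-- When P is the indicator of the inverses of ψ(L), its translates compute the coefficients of the
product. Annihilation by a norm element then feeds the exactness of the periodic resolutions. -/
lemma mul_ofList_eq_zero {ψ : Quat →* Gamma0SqrtNegTwo} (hψ : Function.Injective ψ) {L : List Quat}
    (hL : L.Nodup) {P : SL2 → Prop}
    (hP : ∀ h : Gamma0SqrtNegTwo, P (h⁻¹ : Gamma0SqrtNegTwo) ↔ h ∈ L.map ψ) {x : Ring2}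
    (hx : ∀ γ, pairing (side P γ) x = 0) : x * ofList ψ L = 0 := by
  refine mul_eq_zero_of_pairing fun γ => ?_
  rw [← hx γ]
  congr 2
  funext g
  rw [coeff_ofList hψ hL, side, ← ind_congr (hP _), _root_.mul_inv_rev, inv_inv]

lemma one_or_neg_one_inv (h : Gamma0SqrtNegTwo) :
    (((h⁻¹ : Gamma0SqrtNegTwo) : SL2) = 1 ∨ ((h⁻¹ : Gamma0SqrtNegTwo) : SL2) = -1) ↔
      h ∈ [1, qz].map quatR := by
  have : (-1 : SL2)⁻¹ = -1 := by simp
  simp only [List.map_cons, List.map_nil, List.mem_cons, List.not_mem_nil, or_false, map_one,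
    Subtype.ext_iff, coe_quatR_qz, InvMemClass.coe_inv, OneMemClass.coe_one, inv_eq_iff_eq_inv, this,
    inv_one]

lemma inCyclic_inv_iff {x : SL2} (hx : x * x = -1) {ψ : Quat →* Gamma0SqrtNegTwo} {q : Quat}
    (hq : (ψ q : SL2) = x) (h : Gamma0SqrtNegTwo) :
    (((h⁻¹ : Gamma0SqrtNegTwo) : SL2) = 1 ∨ ((h⁻¹ : Gamma0SqrtNegTwo) : SL2) = -1 ∨
      ((h⁻¹ : Gamma0SqrtNegTwo) : SL2) = x ∨ ((h⁻¹ : Gamma0SqrtNegTwo) : SL2) = -x) ↔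
      h ∈ (dCyclic q 1).map ψ := by
  have h1 : (-1 : SL2)⁻¹ = -1 := by simp
  have h2 : x⁻¹ = -x := inv_eq_of_mul_eq_one_right (by rw [mul_neg, hx, neg_neg])
  have h3 : (-x)⁻¹ = x := by rw [← h2, inv_inv]
  simp only [dCyclic, List.map_cons, List.map_nil, List.mem_cons, List.not_mem_nil, or_false, map_one,
    map_mul, Subtype.ext_iff, InvMemClass.coe_inv, OneMemClass.coe_one, inv_eq_iff_eq_inv, h1, h2, h3,
    inv_one, MulMemClass.coe_mul, hq, hx, neg_one_mul]
  tauto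

end sides

section faces

/-- The half-plane is invariant under R and changes under T only at ±1, so pairing with its
translates reads off the coefficients of c·(1 + z). -/
lemma mul_zz_eq_zero {c b : Ring2} (h : b * (1 + el (quatR qj)) + c * (1 + el gT) = 0) :
    c * zz = 0 := by
  rw [← ofList_quatR_z]
  refine mul_ofList_eq_zero (P := fun g => g = 1 ∨ g = -1) quatR_injective (by decide)
    one_or_neg_one_inv fun γ => ?_
  have h1 := congrArg (pairing (side RealSide γ)) h
  rw [map_add, map_zero, pairing_side_inv (fun g _ => by rw [coe_quatR_qj, realSide_mul_R]), zero_add,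
    pairing_side_flip (P' := fun g => g = 1 ∨ g = -1)] at h1
  · exact h1
  · intro g hg
    rw [coe_gT]
    by_cases h1 : g = 1
    · obtain ⟨h2, h3⟩ := realSide_mul_T_one
      rw [h1, ind_true h2, ind_false h3, ind_true (Or.inl rfl), add_zero]
    by_cases h1' : g = -1
    · obtain ⟨h2, h3⟩ := realSide_mul_T_neg_one
      rw [h1', ind_true h2, ind_false h3, ind_true (Or.inr rfl), add_zero]
    rw [ind_add_self (realSide_mul_T_of_ne hg h1 h1').symm, ind_false (by tauto)]

end faces

section edges

lemma isReal_inv {g : SL2} (h : IsReal g) : IsReal g⁻¹ := by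
  obtain ⟨h1, h2, h3, h4⟩ := h
  have hg := Matrix.SpecialLinearGroup.SL2_inv_expl g
  refine ⟨?_, ?_, ?_, ?_⟩ <;> rw [hg] <;> simp [h1, h2, h3, h4]

/-- The real matrices in the congruence subgroup. -/
def realGroup : Subgroup Gamma0SqrtNegTwo where
  carrier := {g | IsReal g}
  one_mem' := by refine ⟨?_, ?_, ?_, ?_⟩ <;> simp
  mul_mem' {g h} hg hh := hg.mul hh
  inv_mem' {g} hg := isReal_inv hg

lemma realHeight_mul_mem {g h : SL2} (hh : h ∈ regionGroup) :
    0 < realHeight (g * h) ↔ 0 < realHeight g := hh g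

/-- The left ideal generated by the `1 + q` for `q` in the first quaternion subgroup. -/
def idealW : Ideal Ring2 := Submodule.span _ {1 + el (quatW qi), 1 + el (quatW qj)}
/-- The left ideal generated by the `1 + q` for `q` in the second quaternion subgroup. -/
def idealR : Ideal Ring2 := Submodule.span _ {1 + el (quatR qi), 1 + el (quatR qj)}

lemma mul_qi_mem_idealW (x : Ring2) : x * (1 + el (quatW qi)) ∈ idealW :=
  idealW.mul_mem_left _ (Submodule.subset_span (by simp))
lemma mul_qj_mem_idealW (x : Ring2) : x * (1 + el (quatW qj)) ∈ idealW :=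
  idealW.mul_mem_left _ (Submodule.subset_span (by simp))
lemma mul_qi_mem_idealR (x : Ring2) : x * (1 + el (quatR qi)) ∈ idealR :=
  idealR.mul_mem_left _ (Submodule.subset_span (by simp))
lemma mul_qj_mem_idealR (x : Ring2) : x * (1 + el (quatR qj)) ∈ idealR :=
  idealR.mul_mem_left _ (Submodule.subset_span (by simp))

lemma pairing_side_idealW {P : SL2 → Prop} (hI : ∀ g ∈ Gamma0SqrtNegTwo, P (g * matI) ↔ P g)
    (hW : ∀ g ∈ Gamma0SqrtNegTwo, P (g * matW) ↔ P g) (γ : Gamma0SqrtNegTwo) {x : Ring2}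
    (hx : x ∈ idealW) : pairing (side P γ) x = 0 := by
  obtain ⟨a, b, rfl⟩ := Submodule.mem_span_pair.1 hx
  rw [smul_eq_mul, smul_eq_mul, map_add, pairing_side_inv (by simpa using hI),
    pairing_side_inv (by simpa using hW), add_zero]

lemma pairing_side_idealR {P : SL2 → Prop} (hI : ∀ g ∈ Gamma0SqrtNegTwo, P (g * matI) ↔ P g)
    (hR : ∀ g ∈ Gamma0SqrtNegTwo, P (g * matR) ↔ P g) (γ : Gamma0SqrtNegTwo) {x : Ring2}
    (hx : x ∈ idealR) : pairing (side P γ) x = 0 := by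
  obtain ⟨a, b, rfl⟩ := Submodule.mem_span_pair.1 hx
  rw [smul_eq_mul, smul_eq_mul, map_add, pairing_side_inv (by simpa using hI),
    pairing_side_inv (by simpa using hR), add_zero]

/-- A side of the real plane is constant along first and second edges and changes along a third edge
exactly at real matrices. For a cycle, the sums of b₂ over cosets of the real group therefore
vanish, and R and T generate that group. -/
lemma exists_of_mem_ideals_third {b₀ b₁ b₂ : Ring2} (hW : b₀ + b₁ * (1 + el gT) ∈ idealW)
    (hR : b₀ + b₂ * (1 + el gV) ∈ idealR) :
    ∃ p c, b₂ = p * (1 + el (quatR qj)) + c * (1 + el gT) := by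
  let J : Ideal Ring2 := Submodule.span _ {1 + el (quatR qj), 1 + el gT}
  have key : b₂ ∈ J := by
    refine mem_of_pairing_coset (L := realGroup) (fun l hl => ?_) fun γ => ?_
    · have h := mem_of_isReal (H := (congrOne J).map Gamma0SqrtNegTwo.subtype)
        ⟨quatR qj, mem_congrOne.2 (Submodule.subset_span (by simp)), by simp⟩
        ⟨gT, mem_congrOne.2 (Submodule.subset_span (by simp)), by simp⟩ l.2 hl
      obtain ⟨l', hl', he⟩ := h
      rwa [← Subtype.ext he]
    · let P : SL2 → Prop := fun g => 0 < realHeight g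
      have h1 : pairing (side P γ) b₀ = 0 := by
        have := pairing_side_idealW (P := P) (fun g _ => realHeight_mul_mem matI_mem)
          (fun g _ => realHeight_mul_mem matW_mem) γ hW
        rwa [map_add, pairing_side_inv (fun g _ => realHeight_mul_mem matT_mem), add_zero] at this
      have h2 := pairing_side_idealR (P := P) (fun g _ => realHeight_mul_mem matI_mem)
          (fun g _ => realHeight_mul_mem matR_mem) γ hR
      rw [map_add, h1, zero_add, pairing_side_flip (P' := IsReal)] at h2
      · exact h2
      · intro g hg
        -- V = U·(WR) with WR in `regionGroup`, so V crosses the real plane exactly when U does.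
        have e : P (g * gV) ↔ P (g * matU) := by
          have : g * gV = g * matU * (matW * matR) := by simp [gV, mul_assoc]
          rw [this]
          exact realHeight_mul_mem (mul_mem matW_mem matR_mem)
        rw [ind_congr e]
        by_cases h : IsReal g
        · obtain ⟨h3, h4⟩ := realHeight_mul_U_of_isReal h
          rw [ind_true h3, ind_false h4, ind_true h, add_zero]
        · rw [ind_add_self (realHeight_mul_U_iff_of_not_isReal h).symm, ind_false h]
  obtain ⟨p, c, h⟩ := Submodule.mem_span_pair.1 key
  exact ⟨p, c, h.symm⟩

/-- The conjugated side on first vertices and the modified side on second vertices disagree only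
across the first edge at ⟨I⟩: that edge is a bridge and carries no cycle. -/
lemma exists_of_mem_ideals_first {b₀ b₁ : Ring2} (hW : b₀ + b₁ * (1 + el gT) ∈ idealW)
    (hR : b₀ ∈ idealR) : ∃ p, b₀ = p * (1 + el (quatW qi)) := by
  have h1 : b₀ * ofList quatW (dCyclic qi 1) = 0 := by
    refine mul_ofList_eq_zero (P := InCyclicI) quatW_injective (by decide)
      (inCyclic_inv_iff matI_sq coe_quatW_qi) fun γ => ?_
    have e1 := pairing_side_idealW (P := fun g => SideImag (matS⁻¹ * g))
      (fun g _ => sideImag_conj_mul_I) (fun g _ => sideImag_conj_mul_W) γ hW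
    rw [map_add, pairing_side_inv (fun g hg => sideImag_conj_mul_T hg), add_zero] at e1
    have e2 := pairing_side_idealR (P := SideConj) (fun g _ => sideConj_mul_I)
      (fun g _ => sideConj_mul_R) γ hR
    have e3 : side InCyclicI γ = fun g => side (fun g => SideImag (matS⁻¹ * g)) γ g +
        side SideConj γ g := by
      funext g
      simp only [side, SideConj]
      generalize SideImag (matS⁻¹ * _) = p
      generalize InCyclicI _ = q
      by_cases hp : p <;> by_cases hq : q <;> simp [ind, Xor, hp, hq]
      decide
    rw [e3, pairing_add_left, e1, e2, add_zero]
  obtain ⟨p, hp⟩ := exact_dCyclic_qi quatW_injective 1 h1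
  refine ⟨p, hp.symm.trans ?_⟩
  simp [dCyclic, el_one]

/-- The side of the imaginary plane is a function on first vertices that changes along a second edge
only at ⟨W⟩, so that edge is a bridge as well. -/
lemma exists_of_mem_ideals_second {b₁ : Ring2} (hW : b₁ * (1 + el gT) ∈ idealW) :
    ∃ p, b₁ = p * (1 + el (quatW qj)) := by
  have h1 : b₁ * ofList quatW (dCyclic qj 1) = 0 := by
    refine mul_ofList_eq_zero (P := InCyclicW) quatW_injective (by decide)
      (inCyclic_inv_iff matW_sq coe_quatW_qj) fun γ => ?_
    have e1 := pairing_side_idealW (P := SideImag)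
      (fun g _ => sideImag_mul_I g) (fun g _ => sideImag_mul_W g) γ hW
    rw [pairing_side_flip (P' := InCyclicW)] at e1
    · exact e1
    · intro g hg
      rw [coe_gT]
      by_cases h : InCyclicW g
      · obtain ⟨h2, h3⟩ := sideImag_mul_T_of_inCyclicW h
        rw [ind_true h2, ind_false h3, ind_true h, add_zero]
      · rw [ind_add_self (sideImag_mul_T_of_not hg h).symm, ind_false h]
  obtain ⟨p, hp⟩ := exact_dCyclic_qj quatW_injective 1 h1
  refine ⟨p, hp.symm.trans ?_⟩
  simp [dCyclic, el_one]

lemma add_eq_of_charTwo {x y z : Ring2} (h : x + y = z) : x = z + y := by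
  rw [← h, add_assoc, CharTwo.add_self_eq_zero, add_zero]

lemma exact_edges {b₀ b₁ b₂ : Ring2} (hW : b₀ + b₁ * (1 + el gT) ∈ idealW)
    (hR : b₀ + b₂ * (1 + el gV) ∈ idealR) : ∃ p₀ p₁ p₂ c,
      p₀ * (1 + el (quatW qi)) + c * ((1 + el gT) * (1 + el gU * el (quatW qj))) = b₀ ∧
      p₁ * (1 + el (quatW qj)) + c * (1 + el gU) = b₁ ∧
      p₂ * (1 + el (quatR qj)) + c * (1 + el gT) = b₂ := by
  obtain ⟨p₂, c, h2⟩ := exists_of_mem_ideals_third hW hR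
  have hTU : el gT * el gU = el gU * el gT := by rw [← el_mul, gT_mul_gU, el_mul]
  have hV : el gV = el gU * el (quatW qj) * el (quatR qj) := by rw [gV, el_mul, el_mul]
  have hRV : el (quatR qj) * el gV = el gV * (el (quatR qi) * el (quatR qj)) := by
    rw [← el_mul, quatR_mul_gV, el_mul, ← el_mul (quatR qi), ← map_mul]; rfl
  -- Adding c times the face boundary makes the third component a multiple of 1 + R. Its
  -- contribution at the second vertex is in `idealR` because RV = V(IR).
  have hR' : b₀ + c * ((1 + el gT) * (1 + el gU * el (quatW qj))) ∈ idealR := by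
    have e : b₀ + c * ((1 + el gT) * (1 + el gU * el (quatW qj))) =
        (b₀ + b₂ * (1 + el gV)) + (p₂ * (1 + el (quatR qj)) +
        (p₂ * el gV * (1 + el (quatR qi)) + p₂ * el gV * el (quatR qi) * (1 + el (quatR qj))) +
        c * (1 + el gT) * (el gU * el (quatW qj)) * (1 + el (quatR qj))) := by
      have e1 : c * (1 + el gT) * (el gU * el (quatW qj)) * (1 + el (quatR qj)) =
          c * (1 + el gT) * (el gU * el (quatW qj)) + c * (1 + el gT) * el gV := by
        rw [mul_add, mul_one, mul_assoc _ _ (el (quatR qj)), ← hV]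
      have e2 : p₂ * (1 + el (quatR qj)) * (1 + el gV) = p₂ * (1 + el (quatR qj)) +
          (p₂ * el gV + p₂ * el gV * el (quatR qi) * el (quatR qj)) := by
        simp only [mul_add, add_mul, mul_one, mul_assoc, hRV]
      rw [h2, e1, add_mul (p₂ * _), e2]
      simp only [mul_add, add_mul, mul_one, one_mul, mul_assoc]
      abel_nf
      simp [two_zsmul_module Ring2]
    rw [e]
    exact idealR.add_mem hR (idealR.add_mem (idealR.add_mem (mul_qj_mem_idealR _)
      (idealR.add_mem (mul_qi_mem_idealR _) (mul_qj_mem_idealR _))) (mul_qj_mem_idealR _))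
  -- The corrected chain is still a cycle at the first vertex; this uses TU = UT.
  have hW' : b₀ + c * ((1 + el gT) * (1 + el gU * el (quatW qj))) +
      (b₁ + c * (1 + el gU)) * (1 + el gT) ∈ idealW := by
    have e : b₀ + c * ((1 + el gT) * (1 + el gU * el (quatW qj))) +
      (b₁ + c * (1 + el gU)) * (1 + el gT) = (b₀ + b₁ * (1 + el gT)) +
        c * (1 + el gT) * el gU * (1 + el (quatW qj)) := by
      have e1 : c * (1 + el gU) * (1 + el gT) = c * (1 + el gT) + c * (1 + el gT) * el gU := by
        simp only [mul_add, add_mul, mul_one, mul_assoc, hTU]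
        abel
      rw [add_mul b₁, e1, ← mul_assoc, mul_add (_ * _) 1, mul_one, mul_add (_ * _) 1, mul_one,
        ← mul_assoc]
      abel_nf
      simp [two_zsmul_module Ring2]
    rw [e]
    exact idealW.add_mem hW (mul_qj_mem_idealW _)
  obtain ⟨p₀, h0⟩ := exists_of_mem_ideals_first hW' hR'
  obtain ⟨p₁, h1⟩ := exists_of_mem_ideals_second (b₁ := b₁ + c * (1 + el gU)) (by
    have := idealW.sub_mem hW' (mul_qi_mem_idealW p₀)
    rwa [← h0, add_sub_cancel_left] at this)
  exact ⟨p₀, p₁, p₂, c, (add_eq_of_charTwo h0).symm, (add_eq_of_charTwo h1).symm, h2.symm⟩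

end edges

/-! ### Connectedness: the augmentation ideal is generated by edge boundaries. -/

section vertices

/-- The elements of the augmentation ideal are generated by the boundaries of the edges. -/
lemma mem_of_aug_eq_zero {J : Ideal Ring2} (hT : 1 + el gT ∈ J) (hV : 1 + el gV ∈ J)
    (hI : 1 + el (quatW qi) ∈ J) (hW : 1 + el (quatW qj) ∈ J) (hR : 1 + el (quatR qj) ∈ J)
    {x : Ring2} (hx : MatrixResolution.aug (ZMod 2) Gamma0SqrtNegTwo x = 0) : x ∈ J := by
  refine mem_of_pairing_coset (L := ⊤) (fun l _ => ?_) fun γ => ?_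
  · have hU : gU ∈ congrOne J := by
      have : gU = gV * (quatR qj)⁻¹ * (quatW qj)⁻¹ := by simp [gV]
      rw [this]
      exact mul_mem (mul_mem hV (inv_mem (mem_congrOne.2 hR))) (inv_mem (mem_congrOne.2 hW))
    have h := mem_of_mem_gamma0 (H := (congrOne J).map Gamma0SqrtNegTwo.subtype)
      ⟨gT, hT, by simp⟩ ⟨gU, hU, by simp⟩ ⟨quatW qj, hW, by simp⟩ ⟨quatW qi, hI, by simp⟩
      ⟨quatR qj, hR, by simp⟩ l.2
    obtain ⟨l', hl', he⟩ := h
    rw [← Subtype.ext he]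
    exact hl'
  · rw [← hx]
    clear hx
    induction x using induction_el with
    | zero => simp
    | add x y hx hy => rw [map_add, map_add, hx, hy]
    | el g => rw [pairing_el, ind_true (Subgroup.mem_top _), el, MatrixResolution.aug_single]

end vertices

end BianchiTwo

end

noncomputable section

open MonoidAlgebra GroupRing QuaternionResolution MatrixResolution Matrix

/-! ### Assembly of the free resolution. -/

namespace BianchiTwo

/-- The number of edge orbits contributing to a degree. -/
def edgeRk : ℕ → ℕ
  | 0 => 0
  | _ + 1 => 3

/-- The number of face orbits contributing to a degree. -/
def faceRk : ℕ → ℕ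
  | 0 => 0
  | 1 => 0
  | _ + 2 => 1

/-- The differential of the resolutions of the edge stabilizers. -/
def dEdge : ∀ n, Matrix (Fin (edgeRk (n + 1))) (Fin (edgeRk n)) Ring2
  | 0 => 0
  | n + 1 => (diagonal (edgeDiff n) : Matrix (Fin 3) (Fin 3) Ring2)

/-- The differential of the resolution of the face stabilizer. -/
def dFace : ∀ n, Matrix (Fin (faceRk (n + 1))) (Fin (faceRk n)) Ring2
  | 0 => 0
  | 1 => 0
  | _ + 2 => (.of fun _ _ => zz : Matrix (Fin 1) (Fin 1) Ring2)

/-- The boundary from the face to the edges, by degree. -/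
def dFaceEdge : ∀ n, Matrix (Fin (faceRk (n + 1))) (Fin (edgeRk n)) Ring2
  | 0 => 0
  | n + 1 => (.of fun _ => faceEdge n : Matrix (Fin 1) (Fin 3) Ring2)

/-- The homotopy from the face to the vertices, by degree. -/
def dFaceVertex : ∀ n, Matrix (Fin (faceRk (n + 1))) (Fin (rk n) ⊕ Fin (rk n)) Ring2
  | 0 => 0
  | n + 1 => (.of fun _ => faceVertex n :
      Matrix (Fin 1) (Fin (rk (n + 1)) ⊕ Fin (rk (n + 1))) Ring2)

/-- The boundary from the edges to the vertices, by degree. -/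
def dEdgeVertex (n : ℕ) : Matrix (Fin (edgeRk (n + 1))) (Fin (rk n) ⊕ Fin (rk n)) Ring2 :=
  edgeVertex n

instance : IsEmpty (Fin (edgeRk 0)) := inferInstanceAs (IsEmpty (Fin 0))
instance : IsEmpty (Fin (faceRk 0)) := inferInstanceAs (IsEmpty (Fin 0))
instance : IsEmpty (Fin (faceRk 1)) := inferInstanceAs (IsEmpty (Fin 0))
instance : Nonempty (Fin (rk 0) ⊕ Fin (rk 0)) := ⟨Sum.inl (0 : Fin 1)⟩

section relations

lemma dEdge_mul : ∀ n, dEdge (n + 1) * dEdge n = 0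
  | 0 => Matrix.mul_zero _
  | n + 1 => edgeDiff_mul n

lemma dFace_mul : ∀ n, dFace (n + 1) * dFace n = 0
  | 0 => Matrix.mul_zero _
  | 1 => Matrix.mul_zero _
  | n + 2 => by
    ext1 i j
    change ∑ l : Fin 1, zz * zz = 0
    simp [zz_mul_self]

lemma dEdgeVertex_mul (n : ℕ) : dEdgeVertex (n + 1) * dVertex n + dEdge (n + 1) * dEdgeVertex n = 0 :=
  edgeVertex_mul n

lemma dFaceEdge_mul : ∀ n, dFaceEdge (n + 1) * dEdge n + dFace (n + 1) * dFaceEdge n = 0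
  | 0 => by ext1 i j; exact isEmptyElim (α := Fin (edgeRk 0)) j
  | n + 1 => by
    ext1 i j
    change (faceEdge (n + 1) ᵥ* diagonal (edgeDiff n)) j + ∑ l : Fin 1, zz * faceEdge n j = 0
    rw [Fin.sum_univ_one]
    exact congrFun (faceEdge_vecMul n) j

lemma dFaceVertex_mul : ∀ n, dFaceVertex (n + 1) * dVertex n +
    (dFaceEdge (n + 1) * dEdgeVertex n + dFace (n + 1) * dFaceVertex n) = 0
  | 0 => by
    rw [show dFaceVertex 0 = 0 from rfl, Matrix.mul_zero, add_zero]
    ext1 i j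
    exact congrFun faceVertex_zero j
  | n + 1 => by
    ext1 i j
    change (faceVertex (n + 1) ᵥ* dVertex (n + 1)) j +
      ((faceEdge (n + 1) ᵥ* edgeVertex (n + 1)) j + ∑ l : Fin 1, zz * faceVertex n j) = 0
    rw [Fin.sum_univ_one]
    exact congrFun (faceVertex_succ n) j

end relations

section exactness

lemma exact_dVertex (n : ℕ) (x : Fin (rk (n + 1)) ⊕ Fin (rk (n + 1)) → Ring2)
    (hx : x ᵥ* dVertex n = 0) : ∃ y, y ᵥ* dVertex (n + 1) = x := by
  obtain ⟨v, w, rfl⟩ : ∃ v w, x = Sum.elim v w := ⟨_, _, (Sum.elim_comp_inl_inr x).symm⟩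
  rw [elim_vecMul_dVertex] at hx
  obtain ⟨y, hy⟩ := exact_dQuat quatW_injective n (congrArg (· ∘ Sum.inl) hx)
  obtain ⟨y', hy'⟩ := exact_dQuat quatR_injective n (congrArg (· ∘ Sum.inr) hx)
  exact ⟨Sum.elim y y', by rw [elim_vecMul_dVertex, hy, hy']⟩

lemma ofList_one_add {G : Type} [Group G] (ψ : Quat →* G) (q : Quat) :
    ofList ψ [1, q] = 1 + el (ψ q) := by simp [el_one]

lemma boundary_vertices (v w : Fin (rk 1) → Ring2) (b : Fin 3 → Ring2) :
    Sum.elim v w ᵥ* dVertex 0 + b ᵥ* edgeVertex 0 =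
      Sum.elim (fun _ => v (0 : Fin 2) * (1 + el (quatW qi)) + v (1 : Fin 2) * (1 + el (quatW qj)) +
        (b 0 + b 1 * (1 + el gT)))
      (fun _ => w (0 : Fin 2) * (1 + el (quatR qi)) + w (1 : Fin 2) * (1 + el (quatR qj)) +
        (b 0 + b 2 * (1 + el gV))) := by
  rw [elim_vecMul_dVertex]
  funext i
  rcases i with i | i
  all_goals obtain rfl : i = (0 : Fin 1) := Subsingleton.elim (α := Fin 1) _ _
  · change ∑ l : Fin 2, v l * ofList quatW (dQuat 0 l (0 : Fin 1)) +
      ∑ l : Fin 3, b l * edgeVertex 0 l (Sum.inl (0 : Fin 1)) = _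
    rw [Fin.sum_univ_two, Fin.sum_univ_three]
    change v (0 : Fin 2) * ofList quatW [1, qi] + v (1 : Fin 2) * ofList quatW [1, qj] +
      (b 0 * ofList quatW [1] + b 1 * (ofList quatW [1] + el gT * ofList quatW [1]) + b 2 * 0) = _
    rw [ofList_one_add, ofList_one_add, ofList_singleton, map_one, el_one, mul_one, mul_zero,
      add_zero, mul_one]
    rfl
  · change ∑ l : Fin 2, w l * ofList quatR (dQuat 0 l (0 : Fin 1)) +
      ∑ l : Fin 3, b l * edgeVertex 0 l (Sum.inr (0 : Fin 1)) = _
    rw [Fin.sum_univ_two, Fin.sum_univ_three]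
    change w (0 : Fin 2) * ofList quatR [1, qi] + w (1 : Fin 2) * ofList quatR [1, qj] +
      (b 0 * ofList quatR [1] + b 1 * 0 + b 2 * (ofList quatR [1] + el gV * ofList quatR [1])) = _
    rw [ofList_one_add, ofList_one_add, ofList_singleton, map_one, el_one, mul_one, mul_zero,
      add_zero, mul_one]
    rfl

lemma mem_ideals_of_boundary_eq_zero {b : Fin 3 → Ring2} {a : Fin (rk 1) ⊕ Fin (rk 1) → Ring2}
    (h : a ᵥ* dVertex 0 + b ᵥ* edgeVertex 0 = 0) :
    b 0 + b 1 * (1 + el gT) ∈ idealW ∧ b 0 + b 2 * (1 + el gV) ∈ idealR := by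
  obtain ⟨v, w, rfl⟩ : ∃ v w, a = Sum.elim v w := ⟨_, _, (Sum.elim_comp_inl_inr a).symm⟩
  rw [boundary_vertices] at h
  constructor
  · have h1 := CharTwo.add_eq_zero.1 (congrFun h (Sum.inl (0 : Fin 1)))
    rw [← h1]
    exact idealW.add_mem (mul_qi_mem_idealW _) (mul_qj_mem_idealW _)
  · have h1 := CharTwo.add_eq_zero.1 (congrFun h (Sum.inr (0 : Fin 1)))
    rw [← h1]
    exact idealR.add_mem (mul_qi_mem_idealR _) (mul_qj_mem_idealR _)

lemma exact_vertices (x : Fin (rk 0) ⊕ Fin (rk 0) → Ring2)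
    (hx : ∑ i, aug (ZMod 2) Gamma0SqrtNegTwo (x i) = 0) :
    ∃ a b, a ᵥ* dVertex 0 + b ᵥ* dEdgeVertex 0 = x := by
  rw [Fintype.sum_sum_type] at hx
  change ∑ l : Fin 1, _ + ∑ l : Fin 1, _ = _ at hx
  rw [Fin.sum_univ_one, Fin.sum_univ_one, ← map_add] at hx
  have hJ := mem_of_aug_eq_zero (J := Submodule.span _ {1 + el gT, 1 + el gV, 1 + el (quatW qi),
    1 + el (quatW qj), 1 + el (quatR qj)}) (Submodule.subset_span (by simp))
    (Submodule.subset_span (by simp)) (Submodule.subset_span (by simp))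
    (Submodule.subset_span (by simp)) (Submodule.subset_span (by simp)) hx
  simp only [Submodule.mem_span_insert, Submodule.mem_span_singleton] at hJ
  obtain ⟨p₁, _, ⟨p₂, _, ⟨p₃, _, ⟨p₄, _, ⟨p₅, rfl⟩, rfl⟩, rfl⟩, rfl⟩, h⟩ := hJ
  simp only [smul_eq_mul] at h
  -- First edges move the second vertex component onto the first vertex, where the sum of both
  -- components has the expansion `h`; the extra terms compensate for the boundaries that live at
  -- the second vertex.
  refine ⟨Sum.elim ![p₃, p₄] ![0, p₅], (![x (Sum.inr (0 : Fin 1)) + p₅ * (1 + el (quatR qj)) +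
    p₂ * (1 + el gV), p₁, p₂] : Fin 3 → Ring2), ?_⟩
  refine (boundary_vertices ![p₃, p₄] ![0, p₅] _).trans ?_
  funext i
  rcases i with i | i
  all_goals obtain rfl : i = (0 : Fin 1) := Subsingleton.elim (α := Fin 1) _ _
  · refine Eq.trans ?_ (add_eq_of_charTwo h).symm
    change p₃ * (1 + el (quatW qi)) + p₄ * (1 + el (quatW qj)) + (_ + p₅ * (1 + el (quatR qj)) +
      p₂ * (1 + el gV) + p₁ * (1 + el gT)) = _
    abel
  · change 0 * (1 + el (quatR qi)) + p₅ * (1 + el (quatR qj)) + (_ + p₅ * (1 + el (quatR qj)) +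
      p₂ * (1 + el gV) + p₂ * (1 + el gV)) = _
    rw [zero_mul, zero_add, CharTwo.add_cancel_right, add_comm, CharTwo.add_cancel_right]

lemma exact_edge_zero {b : Fin 3 → Ring2} {a : Fin (rk 1) ⊕ Fin (rk 1) → Ring2}
    (h : a ᵥ* dVertex 0 + b ᵥ* edgeVertex 0 = 0) :
    ∃ (b' : Fin 3 → Ring2) (c : Ring2), b' ᵥ* diagonal (edgeDiff 0) + c • faceEdge 0 = b := by
  obtain ⟨hW, hR⟩ := mem_ideals_of_boundary_eq_zero h
  obtain ⟨p₀, p₁, p₂, c, h0, h1, h2⟩ := exact_edges hW hR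
  refine ⟨![p₀, p₁, p₂], c, ?_⟩
  funext i
  rw [Pi.add_apply, vecMul_diagonal]
  fin_cases i
  · simpa [edgeDiff, faceEdge, dCyclic, mu, el_one] using h0
  · simpa [edgeDiff, faceEdge, dCyclic, mu, el_one] using h1
  · simpa [edgeDiff, faceEdge, dCyclic, mu, el_one] using h2

lemma exact_edge_succ (n : ℕ) {b : Fin 3 → Ring2} (hb : b ᵥ* diagonal (edgeDiff n) = 0) :
    ∃ b' : Fin 3 → Ring2, b' ᵥ* diagonal (edgeDiff (n + 1)) = b := by
  have h : ∀ i, b i * edgeDiff n i = 0 := fun i => by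
    rw [← vecMul_diagonal]; exact congrFun hb i
  obtain ⟨p₀, h0⟩ := exact_dCyclic_qi quatW_injective n (h 0)
  obtain ⟨p₁, h1⟩ := exact_dCyclic_qj quatW_injective n (h 1)
  obtain ⟨p₂, h2⟩ := exact_dCyclic_qj quatR_injective n (h 2)
  refine ⟨![p₀, p₁, p₂], ?_⟩
  funext i
  rw [vecMul_diagonal]
  fin_cases i
  · exact h0
  · exact h1
  · exact h2

/-- Geometry enters only in the lowest degree; above it the cyclic resolutions are exact by
themselves and no face correction is needed. -/
lemma exact_dEdge : ∀ n (b : Fin (edgeRk (n + 1)) → Ring2)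
    (a : Fin (rk (n + 1)) ⊕ Fin (rk (n + 1)) → Ring2), b ᵥ* dEdge n = 0 →
    a ᵥ* dVertex n + b ᵥ* dEdgeVertex n = 0 →
    ∃ b' c', b' ᵥ* dEdge (n + 1) + c' ᵥ* dFaceEdge (n + 1) = b ∧ c' ᵥ* dFace (n + 1) = 0
  | 0, b, a, _, h => by
    obtain ⟨b', c, hb⟩ := exact_edge_zero h
    refine ⟨b', fun _ => c, ?_, funext fun i => isEmptyElim (α := Fin (faceRk 1)) i⟩
    rw [← hb]
    funext i
    change (b' ᵥ* diagonal (edgeDiff 0)) i + ∑ l : Fin 1, c * faceEdge 0 i = _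
    rw [Fin.sum_univ_one]
    rfl
  | n + 1, b, a, hb, _ => by
    obtain ⟨b', hb'⟩ := exact_edge_succ n hb
    exact ⟨b', 0, by rw [zero_vecMul, add_zero]; exact hb', zero_vecMul _⟩

lemma exact_face {c : Ring2} (h : c * zz = 0) :
    ∃ c' : Fin 1 → Ring2, c' ᵥ* (.of fun _ _ => zz : Matrix (Fin 1) (Fin 1) Ring2) = fun _ => c := by
  rw [← ofList_quatR_z] at h
  obtain ⟨c', hc⟩ := exact_one_add_qz quatR_injective h
  rw [ofList_quatR_z] at hc
  exact ⟨fun _ => c', by funext i; simp [vecMul, dotProduct, hc]⟩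

lemma face_mul_zz {c : Ring2} {b : Fin 3 → Ring2}
    (h : b ᵥ* diagonal (edgeDiff 0) + c • faceEdge 0 = 0) : c * zz = 0 := by
  have h1 := congrFun h 2
  rw [Pi.add_apply, vecMul_diagonal] at h1
  exact mul_zz_eq_zero (b := b 2) (by simpa [edgeDiff, faceEdge, dCyclic, mu, el_one] using h1)

/-- Face chains start in degree 2, so n = 1 is the geometric case; beyond it this is exactness of
the resolution of {±1}. -/
lemma exact_dFace : ∀ n (c : Fin (faceRk (n + 1)) → Ring2) (b : Fin (edgeRk (n + 1)) → Ring2),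
    c ᵥ* dFace n = 0 → b ᵥ* dEdge n + c ᵥ* dFaceEdge n = 0 → ∃ c', c' ᵥ* dFace (n + 1) = c
  | 0, c, b, _, _ => ⟨0, funext fun i => isEmptyElim (α := Fin (faceRk 1)) i⟩
  | 1, c, b, _, h => by
    have key : ∀ (b : Fin 3 → Ring2) (c : Fin 1 → Ring2),
        b ᵥ* diagonal (edgeDiff 0) + c ᵥ* (.of fun _ => faceEdge 0 : Matrix (Fin 1) (Fin 3) Ring2) =
          0 → c 0 * zz = 0 := by
      intro b c h
      refine face_mul_zz (b := b) (funext fun i => ?_)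
      have h1 := congrFun h i
      simpa [vecMul, dotProduct] using h1
    obtain ⟨c', hc⟩ := exact_face (key b c h)
    refine ⟨c', hc.trans ?_⟩
    funext i
    exact congrArg c (Subsingleton.elim (α := Fin 1) _ _)
  | n + 2, c, b, h, _ => by
    have h1 := congrFun h (0 : Fin 1)
    change ∑ l : Fin 1, c l * zz = 0 at h1
    rw [Fin.sum_univ_one] at h1
    obtain ⟨c', hc⟩ := exact_face h1
    refine ⟨c', hc.trans ?_⟩
    funext i
    exact congrArg c (Subsingleton.elim (α := Fin 1) _ _)

end exactness

/-! ### Reduction of the differentials along the augmentation. -/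

section augmentation

local notation "ε" => aug (ZMod 2) Gamma0SqrtNegTwo

lemma aug_el (g : Gamma0SqrtNegTwo) : ε (el g) = 1 := aug_single g 1

lemma aug_one_add_el (g : Gamma0SqrtNegTwo) : ε (1 + el g) = 0 := by
  rw [map_add, map_one, aug_el]; decide

lemma aug_ofList (ψ : Quat →* Gamma0SqrtNegTwo) (L : List Quat) : ε (ofList ψ L) = L.length := by
  induction L with
  | nil => simp
  | cons q L ih => rw [ofList_cons, map_add, ih, aug_el, List.length_cons]; push_cast; ring

lemma length_dQuat : ∀ n i j, ((dQuat n i j).length : ZMod 2) = 0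
  | 0 => by decide
  | 1 => by decide
  | 2 => by decide
  | 3 => by decide
  | n + 4 => length_dQuat n

lemma length_dCyclic (q : Quat) : ∀ n, ((dCyclic q n).length : ZMod 2) = 0
  | 0 => by simp [dCyclic]; decide
  | 1 => by simp [dCyclic]; decide
  | n + 2 => length_dCyclic q n

lemma aug_zz : ε zz = 0 := aug_one_add_el _

/-- All entries are lists of even length. The blocks below vanish likewise or through factors 1 + g,
except the one from edges to vertices. -/
lemma aug_dVertex (n : ℕ) : (dVertex n).map ε = 0 := by
  ext1 i j
  rcases i with i | i <;> rcases j with j | j <;> simp [dVertex, aug_ofList, length_dQuat]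

lemma aug_dEdge : ∀ n, (dEdge n).map ε = 0
  | 0 => by ext1 i j; exact isEmptyElim (α := Fin (edgeRk 0)) j
  | n + 1 => by
    have h : ∀ i, ε (edgeDiff n i) = 0 := by
      intro i
      fin_cases i <;> simp [edgeDiff, aug_ofList, length_dCyclic]
    have : (diagonal (edgeDiff n)).map ε = 0 := by
      ext1 i j
      rw [map_apply, diagonal_apply]
      split_ifs
      · exact h i
      · exact map_zero ε
    exact this

lemma aug_dFace : ∀ n, (dFace n).map ε = 0
  | 0 => by ext1 i j; exact isEmptyElim (α := Fin (faceRk 0)) j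
  | 1 => by ext1 i j; exact isEmptyElim (α := Fin (faceRk 1)) j
  | _ + 2 => by ext1 i j; exact aug_zz

lemma aug_dFaceEdge : ∀ n, (dFaceEdge n).map ε = 0
  | 0 => by ext1 i j; exact isEmptyElim (α := Fin (edgeRk 0)) j
  | n + 1 => by
    have : ∀ j, ε (faceEdge n j) = 0 := by
      intro j
      fin_cases j <;> simp [faceEdge, -map_add, aug_one_add_el]
    ext1 i j
    exact this j

lemma aug_dFaceVertex : ∀ n, (dFaceVertex n).map ε = 0
  | 0 => by ext1 i j; exact map_zero ε
  | n + 1 => by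
    have : ∀ j, ε (faceVertex n j) = 0 := by
      intro j
      rcases j with j | j
      · change ε ((1 + el gU) * _ + (el gU * (1 + el gT)) * _) = 0
        rw [map_add, map_mul, map_mul, map_mul, aug_one_add_el, aug_one_add_el]
        simp
      · change ε ((1 + el gT) * _) = 0
        rw [map_mul, aug_one_add_el, zero_mul]
    ext1 i j
    exact this j

/-- The boundary from the edges to the vertices after augmentation. -/
def edgeVertexMod (n : ℕ) : Matrix (Fin 3) (Fin (rk n) ⊕ Fin (rk n)) (ZMod 2) :=
  .of ![Sum.elim (fun j => (phiI n j).length) (fun j => (phiI n j).length),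
    Sum.elim (fun j => (phiJ n j).length + (phiK n j).length) 0,
    Sum.elim 0 (fun j => (phiJ n j).length + (phiK n j).length)]

lemma aug_dEdgeVertex (n : ℕ) : (dEdgeVertex n).map ε = edgeVertexMod n := by
  change (edgeVertex n).map ε = edgeVertexMod n
  ext1 i j
  fin_cases i <;> rcases j with j | j <;>
    simp [edgeVertex, edgeVertexMod, GroupRing.row, aug_ofList, aug_el]

/-- The differential of the total complex. -/
def dTotal : ∀ n, Matrix ((Fin (rk (n + 1)) ⊕ Fin (rk (n + 1))) ⊕ Fin (edgeRk (n + 1)) ⊕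
    Fin (faceRk (n + 1))) ((Fin (rk n) ⊕ Fin (rk n)) ⊕ Fin (edgeRk n) ⊕ Fin (faceRk n)) Ring2 :=
  totalMatrix (α := fun n => Fin (rk n) ⊕ Fin (rk n)) (β := fun n => Fin (edgeRk n))
    (γ := fun n => Fin (faceRk n)) dVertex dEdge dFace dEdgeVertex dFaceEdge dFaceVertex

/-- The free resolution of the congruence subgroup. -/
theorem isResolution : IsResolution (ZMod 2) Gamma0SqrtNegTwo
    (fun n => (Fin (rk n) ⊕ Fin (rk n)) ⊕ Fin (edgeRk n) ⊕ Fin (faceRk n))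
    dTotal :=
  isResolution_totalMatrix (α := fun n => Fin (rk n) ⊕ Fin (rk n)) (β := fun n => Fin (edgeRk n))
    (γ := fun n => Fin (faceRk n)) dVertex_mul dEdge_mul dFace_mul dEdgeVertex_mul dFaceEdge_mul
    dFaceVertex_mul (fun i => Finset.sum_eq_zero fun j _ => congrFun₂ (aug_dVertex 0) i j)
    (fun i => by
      have h : ∀ i, ∑ j, edgeVertexMod 0 i j = 0 := by decide
      have := aug_dEdgeVertex 0
      refine (Finset.sum_congr rfl fun j _ => congrFun₂ this i j).trans (h i))
    exact_dVertex exact_dEdge exact_dFace exact_vertices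

end augmentation

/-! ### Ranks of the reduced differentials and the resulting dimensions. -/

section ranks

/-- Factoring through dimension r bounds the rank above; recovering the identity of size r bounds it
below. -/
lemma rank_eq_of_factor {l m : Type} [Fintype l] [Fintype m] [DecidableEq m] {r : ℕ}
    {M : Matrix l m (ZMod 2)} (A : Matrix l (Fin r) (ZMod 2)) (B : Matrix (Fin r) m (ZMod 2))
    (L : Matrix (Fin r) l (ZMod 2)) (N : Matrix m (Fin r) (ZMod 2)) (h₁ : M = A * B)
    (h₂ : L * M * N = 1) : M.rank = r := by
  apply le_antisymm
  · rw [h₁]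
    exact (rank_mul_le_left A B).trans ((rank_le_card_width A).trans_eq (Fintype.card_fin r))
  · have : (L * M * N).rank = r := by rw [h₂, rank_one, Fintype.card_fin]
    rw [← this]
    exact (rank_mul_le_left _ _).trans (rank_mul_le_right _ _)

/-- The ranks of the augmented differentials. -/
def augRk : ℕ → ℕ
  | 0 => 1
  | 1 => 2
  | 2 => 0
  | 3 => 0
  | n + 4 => augRk n

lemma rank_edgeVertexMod : ∀ n, (edgeVertexMod n).rank = augRk n
  | 0 => rank_eq_of_factor (r := 1) (.of ![![1], ![0], ![0]])
      (.of ![Sum.elim (fun _ => 1) (fun _ => 1)]) (.of ![![1, 0, 0]])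
      (.of (Sum.elim (fun _ _ => 1) (fun _ _ => 0))) (by decide) (by decide)
  | 1 => rank_eq_of_factor (r := 2) (.of ![![1, 1], ![1, 0], ![0, 1]])
      (.of ![Sum.elim ![1, 0] ![0, 0], Sum.elim ![0, 0] ![1, 0]]) (.of ![![0, 1, 0], ![0, 0, 1]])
      (.of (Sum.elim ![![1, 0], ![0, 0]] ![![0, 1], ![0, 0]])) (by decide) (by decide)
  | 2 => by
    have : edgeVertexMod 2 = 0 := by decide
    rw [this, rank_zero]; rfl
  | 3 => by
    have : edgeVertexMod 3 = 0 := by decide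
    rw [this, rank_zero]; rfl
  | n + 4 => rank_edgeVertexMod n

lemma rank_fromBlocks_fromRows {a a' b b' c c' : Type} [Fintype a] [Fintype a'] [Fintype b]
    [Fintype b'] [Fintype c] [Fintype c'] [DecidableEq a] [DecidableEq b'] (E : Matrix b' a (ZMod 2)) :
    (fromBlocks (0 : Matrix a' a (ZMod 2)) (0 : Matrix a' (b ⊕ c) (ZMod 2))
      (fromRows E (0 : Matrix c' a (ZMod 2))) 0).rank = E.rank := by
  apply le_antisymm
  · have : fromBlocks (0 : Matrix a' a (ZMod 2)) (0 : Matrix a' (b ⊕ c) (ZMod 2))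
        (fromRows E (0 : Matrix c' a (ZMod 2))) 0 =
        fromRows (0 : Matrix a' b' (ZMod 2)) (fromRows 1 0) *
          (E * fromCols (1 : Matrix a a (ZMod 2)) (0 : Matrix a (b ⊕ c) (ZMod 2))) := by
      rw [mul_fromCols, fromRows_mul_fromCols]
      simp
    rw [this]
    exact (rank_mul_le_right _ _).trans (rank_mul_le_left _ _)
  · refine le_trans (le_of_eq ?_) (rank_submatrix_le _ (Sum.inr ∘ Sum.inl) Sum.inl)
    rfl

lemma rank_dTotal (n : ℕ) : ((dTotal n).map (aug (ZMod 2) Gamma0SqrtNegTwo)).rank = augRk n := by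
  have hrows : ∀ {l m n : Type} (A : Matrix l n Ring2) (C : Matrix m n Ring2),
      (fromRows A C).map (aug (ZMod 2) Gamma0SqrtNegTwo) =
        fromRows (A.map (aug (ZMod 2) Gamma0SqrtNegTwo))
          (C.map (aug (ZMod 2) Gamma0SqrtNegTwo)) := by
    intro l m n A C
    ext1 i j
    rcases i with i | i <;> rfl
  rw [dTotal, totalMatrix, fromBlocks_map, fromBlocks_map, hrows, aug_dVertex, aug_dEdge, aug_dFace,
    aug_dFaceEdge, aug_dFaceVertex, aug_dEdgeVertex, Matrix.map_zero _ (map_zero _),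
    Matrix.map_zero _ (map_zero _), fromBlocks_zero]
  exact (rank_fromBlocks_fromRows (edgeVertexMod n)).trans (rank_edgeVertexMod n)

lemma rk_eq : ∀ n, rk n = if n % 4 = 0 ∨ n % 4 = 3 then 1 else 2
  | 0 => rfl
  | 1 => rfl
  | 2 => rfl
  | 3 => rfl
  | n + 4 => by rw [Nat.add_mod_right]; exact rk_eq n

lemma augRk_eq : ∀ n, augRk n = if n % 4 = 0 then 1 else if n % 4 = 1 then 2 else 0
  | 0 => rfl
  | 1 => rfl
  | 2 => rfl
  | 3 => rfl
  | n + 4 => by rw [Nat.add_mod_right]; exact augRk_eq n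

lemma card_cells (n : ℕ) : Fintype.card ((Fin (rk n) ⊕ Fin (rk n)) ⊕ Fin (edgeRk n) ⊕
    Fin (faceRk n)) = rk n + rk n + (edgeRk n + faceRk n) := by
  rw [Fintype.card_sum, Fintype.card_sum, Fintype.card_sum, Fintype.card_fin, Fintype.card_fin,
    Fintype.card_fin]

lemma cohomology_zero_gamma0 : Module.Finite (ZMod 2) (cohomologyGamma0SqrtNegTwo 0) ∧
    Module.finrank (ZMod 2) (cohomologyGamma0SqrtNegTwo 0) = 1 := by
  obtain ⟨h1, h2⟩ := cohomology_zero isResolution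
  rw [rank_dTotal] at h2
  exact ⟨h1, Nat.add_right_cancel (h2.trans (card_cells 0))⟩

lemma cohomology_succ_gamma0 (n : ℕ) : Module.Finite (ZMod 2) (cohomologyGamma0SqrtNegTwo (n + 1)) ∧
    Module.finrank (ZMod 2) (cohomologyGamma0SqrtNegTwo (n + 1)) + augRk (n + 1) + augRk n =
      rk (n + 1) + rk (n + 1) + (3 + faceRk (n + 1)) := by
  obtain ⟨h1, h2⟩ := cohomology_succ isResolution n
  rw [rank_dTotal, rank_dTotal] at h2
  exact ⟨h1, h2.trans (card_cells (n + 1))⟩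

end ranks

end BianchiTwo

end

theorem mainTheorem3 :
    (∀ p : ℕ, Module.Finite (ZMod 2) (cohomologyGamma0SqrtNegTwo p)) ∧
    Module.finrank (ZMod 2) (cohomologyGamma0SqrtNegTwo 0) = 1 ∧
    Module.finrank (ZMod 2) (cohomologyGamma0SqrtNegTwo 1) = 4 ∧
    (∀ p : ℕ, 2 ≤ p → (p % 4 = 2 ∨ p % 4 = 3) →
      Module.finrank (ZMod 2) (cohomologyGamma0SqrtNegTwo p) = 6) ∧
    (∀ p : ℕ, 2 ≤ p → (p % 4 = 0 ∨ p % 4 = 1) →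
      Module.finrank (ZMod 2) (cohomologyGamma0SqrtNegTwo p) = 5) := by
  -- From degree 2 on, the three edges and the face contribute 4 basis elements in every degree.
  have key : ∀ n, Module.finrank (ZMod 2) (cohomologyGamma0SqrtNegTwo (n + 2)) +
      BianchiTwo.augRk (n + 2) + BianchiTwo.augRk (n + 1) =
        2 * QuaternionResolution.rk (n + 2) + 4 := fun n => by
    rw [(BianchiTwo.cohomology_succ_gamma0 (n + 1)).2]
    change _ + (3 + 1) = _
    ring
  refine ⟨?_, BianchiTwo.cohomology_zero_gamma0.2, ?_, ?_, ?_⟩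
  · rintro (_ | n)
    · exact BianchiTwo.cohomology_zero_gamma0.1
    · exact (BianchiTwo.cohomology_succ_gamma0 n).1
  · have := (BianchiTwo.cohomology_succ_gamma0 0).2
    -- Degree 1 is special because the face does not contribute yet: 7 basis elements minus the
    -- ranks 2 and 1.
    change _ + 2 + 1 = 2 + 2 + (3 + 0) at this
    exact Nat.add_right_cancel (m := 3) this
  · intro p hp h
    obtain ⟨n, rfl⟩ := Nat.exists_eq_add_of_le' hp
    have := key n
    rw [BianchiTwo.augRk_eq, BianchiTwo.augRk_eq, BianchiTwo.rk_eq] at this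
    split_ifs at this <;> omega
  · intro p hp h
    obtain ⟨n, rfl⟩ := Nat.exists_eq_add_of_le' hp
    have := key n
    rw [BianchiTwo.augRk_eq, BianchiTwo.augRk_eq, BianchiTwo.rk_eq] at this
    split_ifs at this <;> omega
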